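/- Let $K$ be a field of characteristic $0$ (e.g. $\mathbb R$ or $\mathbb C$) and $N\ge 0$. Consider fields $a_0(x),\dots,a_N(x),b_0(x),\dots,b_N(x)$ and $$z(w)=\frac{w^{N+1}+\sum_{i=0}^{N}a_iw^i}{\sum_{i=0}^{N}b_iw^i}=\sum_{n\le 1}u_nw^n ,$$ expanded at $w=\infty$. Work in the ring $\mathcal A$ of differential functions, i.e. polynomials over $K$ in the $a_k,b_l$, all their $x$-derivatives and $b_N^{-1}$, with total derivative $\partial=d/dx$; write $f'=\partial f$. Local functionals $\int f\,dx$ are classes of $f\in\mathcal A$ modulo $\partial\mathcal A$. A bracket on the fields prescribes $\{\phi(x),\psi(y)\}=\sum_j \kappa_j(x)\,\delta^{(j)}(x-y)$ (finite sum, $\kappa_j\in\mathcal A$ depending on $\phi,\psi$) for any two fields $\phi,\psi\in\{a_0,\dots,a_N,b_0,\dots,b_N\}$. It is extended to $\mathcal A$ by $$\{f(x),g(y)\}=\sum_{\phi,\psi,p,q}\frac{\partial f}{\partial \phi^{(p)}}(x)\frac{\partial g}{\partial \psi^{(q)}}(y)\,\partial_x^p\partial_y^q\{\phi(x),\psi(y)\},$$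 and to functionals by $\{\int f\,dx,g(y)\}=\int\{f(x),g(y)\}\,dx$ and $\{\int f\,dx,\int g\,dx\}=\iint\{f(x),g(y)\}\,dx\,dy$. It is a Poisson structure if the bracket of local functionals is skew-symmetric and satisfies the Jacobi identity. Put $c_n=1,\tfrac12,0$ for $n>0$, $n=0$, $n<0$, and $u_n=0$ for $n>1$. For $n,m\le 1$ let $$L_{nm}=2(c_n+c_m-1)\big[(n+m)u_{n+m}(x)\delta'(x-y)+m\,u_{n+m}'(x)\delta(x-y)\big],$$ $$Q_{nm}=\Big[\tfrac{n-m}{2}u_nu_m'+\sum_{k=1}^{1-n}\big((n-m+k)u_{n+k}u_{m-k}'+k\,u_{n+k}'u_{m-k}\big)\Big]\delta(x-y)+\Big[\tfrac{n-m}{2}u_nu_m+\sum_{k=1}^{1-n}(n-m+2k)u_{n+k}u_{m-k}\Big]\delta'(x-y),$$ all fields in $Q_{nm}$ being taken at $x$. These are the dispersionless linear and quadratic Toda brackets, up to normalization. Set $a_{N+1}=1$, $a_i=0$ for $i\notin\{0,\dots,N+1\}$, $b_j=0$ for $j\notin\{0,\dots,N\}$. For $0\le k,l\le N$ define $$\{a_k(x),a_l(y)\}_2=\Big[\sum_{n\ge1}\big((l+n-k)a_{k-n}(x)a_{l+n}(y)+n\,a_{k-n}(y)a_{l+n}(x)\big)+(l-N-1)a_k(x)a_l(y)\Big]\delta'(x-y),$$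 $$\{b_k(x),b_l(y)\}_2=\Big[\sum_{n\ge1}\big((k-l-n)b_{k-n}(x)b_{l+n}(y)-n\,b_{k-n}(y)b_{l+n}(x)\big)+\tfrac{k-l}{2}b_k(x)b_l(y)\Big]\delta'(x-y),$$ $$\{a_k(x),b_l(y)\}_2=\tfrac{k-N-1}{2}\,a_k(x)b_l(y)\,\delta'(x-y),$$ $$\begin{aligned}\{a_k(x),a_l(y)\}_1=\Big[&\sum_{n\ge1}\Big((k-l-n)\big(a_{k-n}(x)b_{l+n}(y)+b_{k-n}(x)a_{l+n}(y)\big)-n\big(a_{k-n}(y)b_{l+n}(x)+b_{k-n}(y)a_{l+n}(x)\big)\Big)\\&+\tfrac{N+1-l}{2}b_k(x)a_l(y)+\tfrac{k+N+1-2l}{2}a_k(x)b_l(y)\Big]\delta'(x-y),\end{aligned}$$ $$\{a_k(x),b_l(y)\}_1=\Big[\sum_{n\ge1}\big((k-l-n)b_{k-n}(x)b_{l+n}(y)-n\,b_{k-n}(y)b_{l+n}(x)\big)+\tfrac{N+1-l}{2}b_k(x)b_l(y)\Big]\delta'(x-y),\qquad \{b_k(x),b_l(y)\}_1=0,$$ and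 $\{b_l(x),a_k(y)\}_i=-\{a_k(y),b_l(x)\}_i$ for $i=1,2$. Then: 1. $\{\cdot,\cdot\}_1$ is the unique bracket on the fields $a_k,b_l$ that induces $\{u_n(x),u_m(y)\}=-\tfrac12L_{nm}$ for all $n,m\le1$, and $\{\cdot,\cdot\}_2$ is the unique one that induces $\{u_n(x),u_m(y)\}=Q_{nm}$ for all $n,m\le 1$. 2. $s\{\cdot,\cdot\}_1+t\{\cdot,\cdot\}_2$ is a Poisson structure for all $s,t\in K$; that is, the two brackets are compatible Poisson structures. 3. For every $i\ge0$ there is exactly one evolutionary vector field $\partial_{t_i}$ on the fields (a $K$-linear derivation of $\mathcal A$ commuting with $\partial$) such that $$\partial_{t_i}z=\big\{(z^i)_++\tfrac12(z^i)_0,\;z\big\},\qquad \{f,g\}=w\,\partial_wf\,\partial_xg-w\,\partial_xf\,\partial_wg,$$ where $(\cdot)_+$ and $(\cdot)_0$ denote the part with positive powers of $w$ and the coefficient of $w^0$ in the expansion at $\infty$. 4. With $\mathrm H_i=\frac1{i+1}\int(z^{i+1})_0\,dx$, these flows are bi-Hamiltonian: $\partial_{t_i}f=\{\mathrm H_i,f\}_1$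 for $i\ge0$ and $\partial_{t_i}f=-\{\mathrm H_{i-1},f\}_2$ for $i\ge1$, for all $f\in\mathcal A$. In particular $\partial_{t_i}z=\{\mathrm H_i,z\}_1=-\{\mathrm H_{i-1},z\}_2$. -/

import Mathlib

open scoped LaurentSeries

noncomputable section

namespace RatToda

/-! ### Extension of a derivation to a localization (quotient rule) -/

section Localization

variable {K R : Type*} (S : Type*) [Field K] [CommRing R] [CommRing S] [Algebra K R] [Algebra R S]
  [Algebra K S] [IsScalarTower K R S]

/-- The algebra map `r ↦ r + ε d(r)` that encodes a derivation `d`. -/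
def dualHom (d : Derivation K R R) : R →ₐ[K] TrivSqZeroExt S S :=
  AlgHom.ofLinearMap
    { toFun := fun r => TrivSqZeroExt.inl (algebraMap R S r) +
        TrivSqZeroExt.inr (algebraMap R S (d r))
      map_add' := fun r t => by
        simp only [map_add, TrivSqZeroExt.inl_add, TrivSqZeroExt.inr_add]
        abel
      map_smul' := fun c r => by
        have h : ∀ y : R, algebraMap R S (c • y) = c • algebraMap R S y :=
          fun y => map_smul (IsScalarTower.toAlgHom K R S) c y
        simp only [Derivation.map_smul, h, TrivSqZeroExt.inl_smul, TrivSqZeroExt.inr_smul, smul_add,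
          RingHom.id_apply] }
    (by simp)
    (fun r t => by
      ext
      · simp
      · simp only [LinearMap.coe_mk, AddHom.coe_mk, Derivation.leibniz, smul_eq_mul, map_add,
          map_mul, TrivSqZeroExt.snd_add, TrivSqZeroExt.snd_inl, TrivSqZeroExt.snd_inr,
          TrivSqZeroExt.snd_mul, TrivSqZeroExt.fst_add, TrivSqZeroExt.fst_inl,
          TrivSqZeroExt.fst_inr, zero_add, add_zero, MulOpposite.smul_eq_mul_unop,
          MulOpposite.unop_op]
        ring)

variable {S}

lemma dualHom_apply (d : Derivation K R R) (r : R) :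
    dualHom S d r = TrivSqZeroExt.inl (algebraMap R S r) +
        TrivSqZeroExt.inr (algebraMap R S (d r)) := rfl

variable (M : Submonoid R) [IsLocalization M S]

lemma dualHom_isUnit (d : Derivation K R R) (y : M) : IsUnit (dualHom S d y) := by
  rw [TrivSqZeroExt.isUnit_iff_isUnit_fst, dualHom_apply]
  simpa using IsLocalization.map_units S y

/-- The extension of `dualHom d` to the localized ring. -/
def dualHomLoc (d : Derivation K R R) : S →ₐ[K] TrivSqZeroExt S S :=
  IsLocalization.liftAlgHom (M := M) (f := dualHom S d) (dualHom_isUnit M d)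

lemma dualHomLoc_algebraMap (d : Derivation K R R) (r : R) :
    dualHomLoc (S := S) M d (algebraMap R S r) = dualHom S d r := by
  simp [dualHomLoc, IsLocalization.lift_eq]

lemma fst_dualHomLoc (d : Derivation K R R) (f : S) : (dualHomLoc M d f).fst = f := by
  obtain ⟨⟨r, t⟩, h⟩ := IsLocalization.surj M f
  have h' := congrArg (fun g => (dualHomLoc (S := S) M d g).fst) h
  simp only [map_mul, TrivSqZeroExt.fst_mul, dualHomLoc_algebraMap, dualHom_apply,
    TrivSqZeroExt.fst_add, TrivSqZeroExt.fst_inl, TrivSqZeroExt.fst_inr, add_zero] at h'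
  exact (IsLocalization.map_units S t).mul_right_cancel (h'.trans h.symm)

/-- The unique derivation of the localization that extends `d`. -/
def extDer (d : Derivation K R R) : Derivation K S S where
  toFun f := (dualHomLoc M d f).snd
  map_add' f g := by simp
  map_smul' c f := by simp
  map_one_eq_zero' := by simp
  leibniz' f g := by simp [fst_dualHomLoc, mul_comm]

lemma extDer_algebraMap (d : Derivation K R R) (r : R) :
    extDer (S := S) M d (algebraMap R S r) = algebraMap R S (d r) := by
  change (dualHomLoc M d _).snd = _
  rw [dualHomLoc_algebraMap, dualHom_apply, TrivSqZeroExt.snd_add, TrivSqZeroExt.snd_inl,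
    TrivSqZeroExt.snd_inr, zero_add]

end Localization

/-! ### Differential functions of the fields `a_0, …, a_N, b_0, …, b_N` -/

/-- The fields: `Sum.inl k` is `a_k`, `Sum.inr l` is `b_l`, for `0 ≤ k, l ≤ N`. -/
abbrev Var (N : ℕ) : Type := Fin (N + 1) ⊕ Fin (N + 1)

/-- A jet variable `(v, s)` stands for `∂_x^s v`. -/
abbrev JetVar (N : ℕ) : Type := Var N × ℕ

/-- Differential polynomials in the fields. -/
abbrev JetPoly (K : Type*) [Field K] (N : ℕ) : Type _ := MvPolynomial (JetVar N) K

/-- The leading coefficient `b_N` of the denominator. -/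
abbrev bTop (K : Type*) [Field K] (N : ℕ) : JetPoly K N :=
  MvPolynomial.X (Sum.inr (Fin.last N), 0)

/-- The ring of differential functions: polynomials in the `a_k`, the `b_l`, all their
`x`-derivatives, and `b_N⁻¹`. -/
abbrev DiffFun (K : Type*) [Field K] (N : ℕ) : Type _ := Localization.Away (bTop K N)

variable {K : Type*} [Field K] {N : ℕ}

/-- The total derivative `∂ = d/dx`, with `∂ v^{(s)} = v^{(s+1)}`. -/
def dx : Derivation K (DiffFun K N) (DiffFun K N) :=
  extDer (Submonoid.powers (bTop K N)) (MvPolynomial.mkDerivation K fun v =>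
    MvPolynomial.X (v.1, v.2 + 1))

/-- The partial derivative with respect to a jet variable. -/
def partialD (v : JetVar N) : Derivation K (DiffFun K N) (DiffFun K N) :=
  extDer (Submonoid.powers (bTop K N)) (MvPolynomial.pderiv v)

/-- A differential function depends on finitely many jet variables, so all the sums over jet
variables below are finite. -/
lemma partialD_finite (f : DiffFun K N) : {v : JetVar N | partialD v f ≠ 0}.Finite := by
  classical
  obtain ⟨⟨p, s⟩, hs⟩ := IsLocalization.surj (Submonoid.powers (bTop K N)) f
  refine Set.Finite.subset (p.vars ∪ (s : JetPoly K N).vars).finite_toSet ?_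
  intro v hv
  by_contra hmem
  simp only [Finset.coe_union, Set.mem_union, Finset.mem_coe, not_or] at hmem
  apply hv
  have h := congrArg (partialD v) hs
  simp only [Derivation.leibniz] at h
  rw [partialD, extDer_algebraMap, extDer_algebraMap,
    MvPolynomial.pderiv_eq_zero_of_notMem_vars hmem.1,
    MvPolynomial.pderiv_eq_zero_of_notMem_vars hmem.2] at h
  simp only [map_zero, smul_eq_mul, mul_zero, zero_add] at h
  exact (IsLocalization.map_units (DiffFun K N) s).mul_right_eq_zero.mp h

/-- The jet variable `v` itself as a differential function. -/
def jet (v : JetVar N) : DiffFun K N := algebraMap (JetPoly K N) _ (MvPolynomial.X v)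

/-! ### Kernels supported on the diagonal -/

/-- A distribution `∑_k c_k(x) δ^{(k)}(x - y)`; the monomial `X^k` of the polynomial stands for
`δ^{(k)}(x - y)`, the `k`-th derivative of `δ` at the argument `x - y`. -/
abbrev Kernel (K : Type*) [Field K] (N : ℕ) : Type _ := Polynomial (DiffFun K N)

namespace Kernel

/-- The product `f(x) P(x, y)`. -/
def mulX (f : DiffFun K N) (P : Kernel K N) : Kernel K N := Polynomial.C f * P

/-- The product `g(y) P(x, y)`, by
`g(y) δ^{(k)}(x - y) = ∑_j (k choose j) g^{(j)}(x) δ^{(k-j)}(x - y)`. -/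
def mulY (g : DiffFun K N) (P : Kernel K N) : Kernel K N :=
  P.sum fun k c => ∑ j ∈ Finset.range (k + 1),
    Polynomial.monomial (k - j) ((k.choose j : DiffFun K N) * (dx^[j]) g * c)

/-- `∂_x P(x, y)`. -/
def derivX (P : Kernel K N) : Kernel K N :=
  P.sum fun k c => Polynomial.monomial k (dx c) + Polynomial.monomial (k + 1) c

/-- `∂_y P(x, y)`. -/
def derivY (P : Kernel K N) : Kernel K N := -(Polynomial.X * P)

/-- `P(y, x)` as a distribution in `(x, y)`. -/
def swap (P : Kernel K N) : Kernel K N :=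
  P.sum fun k c => mulY c (Polynomial.monomial k ((-1) ^ k))

/-- `∫ P(x, y) dx` as a function of the remaining variable. -/
def integrateX (P : Kernel K N) : DiffFun K N :=
  P.sum fun k c => (-1) ^ k * (dx^[k]) c

/-- `δ(x - y)`. -/
def delta : Kernel K N := 1

/-- `δ'(x - y)`. -/
def delta' : Kernel K N := Polynomial.X

/-- `f(x) g(y) δ'(x - y)`. -/
def xy (f g : DiffFun K N) : Kernel K N := mulX f (mulY g delta')

end Kernel

open Kernel

/-! ### Brackets -/

/-- Brackets of the fields: `P v w` is `{v(x), w(y)}`. -/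
abbrev Bracket (K : Type*) [Field K] (N : ℕ) : Type _ := Var N → Var N → Kernel K N

/-- `{f(x), g(y)}` for arbitrary differential functions, by the Leibniz rule:
`∑ ∂f/∂v^{(p)}(x) ∂g/∂w^{(q)}(y) ∂_x^p ∂_y^q {v(x), w(y)}`. -/
def localBracket (P : Bracket K N) (f g : DiffFun K N) : Kernel K N :=
  ∑ᶠ (v : JetVar N) (w : JetVar N),
    mulX (partialD v f) (mulY (partialD w g) (derivX^[v.2] (derivY^[w.2] (P v.1 w.1))))

/-- `{∫ f dx, g(y)}`. As a density, taken modulo total derivatives, it is also the bracket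
`{∫ f dx, ∫ g dx}` of local functionals. -/
def functionalBracket (P : Bracket K N) (f g : DiffFun K N) : DiffFun K N :=
  integrateX (localBracket P f g)

/-- `∫ f dx = 0` for local functionals: the density is a total derivative. -/
def IntegralZero (f : DiffFun K N) : Prop := ∃ g : DiffFun K N, f = dx g

/-- A Poisson structure: the bracket of local functionals is skew-symmetric and satisfies the
Jacobi identity. -/
structure IsPoisson (P : Bracket K N) : Prop where
  skew : ∀ f g : DiffFun K N,
    IntegralZero (functionalBracket P f g + functionalBracket P g f)
  jacobi : ∀ f g h : DiffFun K N,
    IntegralZero (functionalBracket P (functionalBracket P f g) h +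
      functionalBracket P (functionalBracket P g h) f +
      functionalBracket P (functionalBracket P h f) g)

/-! ### The rational function `z(w)` -/

/-- `a_k` for `k ∈ ℤ`, with `a_{N+1} = 1` and `a_k = 0` outside `0, …, N + 1`. -/
def a (k : ℤ) : DiffFun K N :=
  if k = N + 1 then 1
  else if h : 0 ≤ k ∧ k ≤ N then jet (Sum.inl ⟨k.toNat, by omega⟩, 0) else 0

/-- `b_l` for `l ∈ ℤ`, with `b_l = 0` outside `0, …, N`. -/
def b (l : ℤ) : DiffFun K N :=
  if h : 0 ≤ l ∧ l ≤ N then jet (Sum.inr ⟨l.toNat, by omega⟩, 0) else 0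

/-- `b_N` as a unit. -/
def bUnit : (DiffFun K N)ˣ :=
  (IsLocalization.Away.algebraMap_isUnit (S := DiffFun K N) (bTop K N)).unit

/-- Laurent series in `w⁻¹`: the coefficient of index `k` belongs to `w^{-k}`. -/
abbrev WSeries (K : Type*) [Field K] (N : ℕ) : Type _ := (DiffFun K N)⸨X⸩

/-- The coefficient of `w^n`. -/
def wCoeff (f : WSeries K N) (n : ℤ) : DiffFun K N := f.coeff (-n)

/-- `w^{-(N+1)} q_{N+1}(w) = 1 + a_N w⁻¹ + ⋯ + a_0 w^{-(N+1)}`. -/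
def numer : PowerSeries (DiffFun K N) := PowerSeries.mk fun j => a ((N : ℤ) + 1 - j)

/-- `w^{-N} p_N(w) = b_N + b_{N-1} w⁻¹ + ⋯ + b_0 w^{-N}`. -/
def denom : PowerSeries (DiffFun K N) := PowerSeries.mk fun j => b ((N : ℤ) - j)

/-- The expansion at `w = ∞` of
`z(w) = (w^{N+1} + ∑_{i ≤ N} a_i w^i) / ∑_{i ≤ N} b_i w^i`. -/
def z : WSeries K N :=
  HahnSeries.single (-1 : ℤ) 1 *
    HahnSeries.ofPowerSeries ℤ (DiffFun K N) (numer * PowerSeries.invOfUnit denom bUnit)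

/-- `u_n`, the coefficient of `w^n` in `z`; it vanishes for `n > 1`. -/
def u (n : ℤ) : DiffFun K N := wCoeff z n

/-! ### The Toda flows -/

/-- `w ∂/∂w`. -/
def wdw (f : WSeries K N) : WSeries K N where
  coeff k := ((-k : ℤ) : DiffFun K N) * f.coeff k
  isPWO_support' := f.isPWO_support.mono fun k hk hz => hk (by simp [hz])

/-- `∂/∂x` on coefficients. -/
def wdx (f : WSeries K N) : WSeries K N := f.map dx

/-- The Lax bracket `{f, g} = w f_w g_x - w f_x g_w`. -/
def laxBracket (f g : WSeries K N) : WSeries K N := wdw f * wdx g - wdx f * wdw g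

/-- `f_+ + (1/2) f_0`. -/
def plusHalf (f : WSeries K N) : WSeries K N where
  coeff k := if k < 0 then f.coeff k else if k = 0 then (2⁻¹ : K) • f.coeff k else 0
  isPWO_support' := f.isPWO_support.mono fun k hk hz => hk (by simp [hz])

/-- `D = ∂_{t_i}` is the `i`-th flow of the 1dToda hierarchy on the rational functions `z`: an
evolutionary vector field (a derivation that commutes with `∂`) on the fields `a_k, b_l` with
`∂_{t_i} z = {(z^i)_+ + (1/2) (z^i)_0, z}`, coefficient by coefficient in `w`. -/
structure IsTodaFlow (i : ℕ) (D : Derivation K (DiffFun K N) (DiffFun K N)) : Prop where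
  comm : ∀ f, D (dx f) = dx (D f)
  lax : z.map D = laxBracket (plusHalf (z ^ i)) z

/-- The density `(1/(i+1)) (z^{i+1})_0` of the Hamiltonian `H_i`. -/
def hamDensity (i : ℕ) : DiffFun K N := ((i + 1 : K)⁻¹) • wCoeff (z ^ (i + 1)) 0

/-! ### Brackets of the generic Toda field variables `u_n`, `n ≤ 1` -/

/-- `1` for `k > 0`, `1/2` for `k = 0`, `0` for `k < 0`. -/
def c (k : ℤ) : K := if 0 < k then 1 else if k = 0 then 2⁻¹ else 0

/-- The linear bracket `{u_n(x), u_m(y)}`: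
`2 (c_n + c_m - 1) [(n+m) u_{n+m}(x) δ'(x-y) + m u_{n+m}'(x) δ(x-y)]`. -/
def genericLinear (n m : ℤ) : Kernel K N :=
  (2 * (c n + c m - 1) : K) •
    (((n + m : ℤ) : K) • mulX (u (n + m)) delta' + (m : K) • mulX (dx (u (n + m))) delta)

/-- The quadratic bracket `{u_n(x), u_m(y)}`. -/
def genericQuadratic (n m : ℤ) : Kernel K N :=
  mulX ((((n - m : ℤ) : K) / 2) • (u n * dx (u m)) +
      ∑ k ∈ Finset.Icc 1 (1 - n),
        (((n - m + k : ℤ) : K) • (u (n + k) * dx (u (m - k))) +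
          (k : K) • (dx (u (n + k)) * u (m - k)))) delta +
    mulX ((((n - m : ℤ) : K) / 2) • (u n * u m) +
      ∑ k ∈ Finset.Icc 1 (1 - n), ((n - m + 2 * k : ℤ) : K) • (u (n + k) * u (m - k))) delta'

/-! ### The explicit brackets of the fields `a_k, b_l`

In the sums over `n ≥ 1` the terms with `n > N` vanish, since `a_{k-n} = b_{k-n} = 0` there. -/

/-- `{a_k(x), a_l(y)}_2`. -/
def aa2 (k l : ℤ) : Kernel K N :=
  (∑ n ∈ Finset.Icc (1 : ℤ) N,
    (((l + n - k : ℤ) : K) • xy (a (k - n)) (a (l + n)) +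
      (n : K) • mulY (a (k - n)) (mulX (a (l + n)) delta'))) +
  ((l - N - 1 : ℤ) : K) • xy (a k) (a l)

/-- `{b_k(x), b_l(y)}_2`. -/
def bb2 (k l : ℤ) : Kernel K N :=
  (∑ n ∈ Finset.Icc (1 : ℤ) N,
    (((k - l - n : ℤ) : K) • xy (b (k - n)) (b (l + n)) -
      (n : K) • mulY (b (k - n)) (mulX (b (l + n)) delta'))) +
  (((k - l : ℤ) : K) / 2) • xy (b k) (b l)

/-- `{a_k(x), b_l(y)}_2`. -/
def ab2 (k l : ℤ) : Kernel K N := (((k - N - 1 : ℤ) : K) / 2) • xy (a k) (b l)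

/-- `{a_k(x), a_l(y)}_1`. -/
def aa1 (k l : ℤ) : Kernel K N :=
  (∑ n ∈ Finset.Icc (1 : ℤ) N,
    (((k - l - n : ℤ) : K) • (xy (a (k - n)) (b (l + n)) + xy (b (k - n)) (a (l + n))) -
      (n : K) • (mulY (a (k - n)) (mulX (b (l + n)) delta') +
        mulY (b (k - n)) (mulX (a (l + n)) delta')))) +
  (((N + 1 - l : ℤ) : K) / 2) • xy (b k) (a l) +
  (((k + N + 1 - 2 * l : ℤ) : K) / 2) • xy (a k) (b l)

/-- `{a_k(x), b_l(y)}_1`. -/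
def ab1 (k l : ℤ) : Kernel K N :=
  (∑ n ∈ Finset.Icc (1 : ℤ) N,
    (((k - l - n : ℤ) : K) • xy (b (k - n)) (b (l + n)) -
      (n : K) • mulY (b (k - n)) (mulX (b (l + n)) delta'))) +
  (((N + 1 - l : ℤ) : K) / 2) • xy (b k) (b l)

/-- The first (linear) bracket; `{b_l(x), a_k(y)} = -{a_k(y), b_l(x)}`. -/
def bracket1 : Bracket K N
  | Sum.inl k, Sum.inl l => aa1 (k : ℕ) (l : ℕ)
  | Sum.inl k, Sum.inr l => ab1 (k : ℕ) (l : ℕ)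
  | Sum.inr l, Sum.inl k => -swap (ab1 (k : ℕ) (l : ℕ))
  | Sum.inr _, Sum.inr _ => 0

/-- The second (quadratic) bracket; `{b_l(x), a_k(y)} = -{a_k(y), b_l(x)}`. -/
def bracket2 : Bracket K N
  | Sum.inl k, Sum.inl l => aa2 (k : ℕ) (l : ℕ)
  | Sum.inl k, Sum.inr l => ab2 (k : ℕ) (l : ℕ)
  | Sum.inr l, Sum.inl k => -swap (ab2 (k : ℕ) (l : ℕ))
  | Sum.inr k, Sum.inr l => bb2 (k : ℕ) (l : ℕ)

end RatToda

end

open RatToda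

open scoped LaurentSeries
noncomputable section
namespace RatToda
variable {K : Type*} [Field K] {N : ℕ}
open Kernel Polynomial

/-! ### Kernels as differential operators -/

namespace Kernel

/-! A kernel `∑ c_k(x) δ^{(k)}(x - y)` is treated as the differential operator `∑ c_k ∂^k`. Then
`derivX` is composition with `∂` on the left, multiplication by `X` is composition with `∂` on the
right, `mulY g` is composition with `g` on the right, and `swap` is the formal adjoint. The bracket
of two functions becomes a sum of `F_f ∘ P ∘ F_g^*` over pairs of fields, with Fréchet derivatives
`F`.

The quadratic bracket is simple in terms of the zeros and poles of `z` and the leading coefficient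
`b_N`. There it reads `{v(x), w(y)} = η_{vw} v(x) w(y) δ'(x - y)`, with `η = -1` for a zero with
itself, `+1` for a pole with itself, `-1/2` between `b_N` and any root, and `0` otherwise. In
logarithms this is the constant operator `η ∂`, so the Jacobi identity is the symmetry of second
variational derivatives (`strongJacobi_logBracket`, `frechet_varD`). The same ring serves as the
ring of functions of zeros and poles: `rootHom` sends the fields to the coefficients of products of
linear factors. It is injective because the Jacobian is nonsingular (`hom_injective`,
`rootHom_injective`), so identities between brackets of the fields may be checked after applying it.

The explicit sums come from telescoping. If `F` is a product of factors `(w - β_j)^{ε_j}`, then `(w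
- β_j) ∂F/∂β_j = -ε_j F`. This is a recursion for the coefficients (`RootSeq`), and with Euler's
identity and the chain rule it evaluates the log-canonical bracket of two coefficients by moving
their indices apart until one coefficient vanishes: downwards for the numerator and denominator,
upwards for `z`.

The first bracket is obtained by the substitution `z ↦ z + ε`, that is `a_k ↦ a_k + ε b_k`, which
carries the second bracket to itself minus `ε` times the first (`shift_bracket`). So these
combinations satisfy Jacobi, and since the Jacobiator of the pencil is a quadratic form in its two
parameters, the whole pencil does. The same shift extracts the linear Toda bracket from the
quadratic one.

Uniqueness rests on a Vandermonde argument: the derivatives of all `u_n` along a nonzero vector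
cannot vanish simultaneously (`eq_zero_of_sum_partialD_u`). Existence of the flows is the
computation that the Hamiltonian vector fields of `H_i` and `H_{i-1}` act on every `u_m` by the Lax
equation. It uses that `z^i` and `z` commute for the Lax bracket, and it yields both Hamiltonian
forms at once. -/

lemma mulX_eq_smul (f : DiffFun K N) (A : Kernel K N) : mulX f A = f • A :=
  (Polynomial.smul_eq_C_mul f).symm

lemma derivX_add (A B : Kernel K N) : derivX (A + B) = derivX A + derivX B := by
  unfold derivX
  refine Polynomial.sum_add_index _ _ _ (fun i => by simp) (fun i a b => ?_)
  simp only [map_add]; abel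

lemma derivX_monomial (k : ℕ) (c : DiffFun K N) :
    derivX (monomial k c) = monomial k (dx c) + monomial (k + 1) c := by
  simp [derivX]

lemma derivX_zero : derivX (0 : Kernel K N) = 0 := by simp [derivX]

/-- `∂_x` as an additive map. -/
def derivXHom : Kernel K N →+ Kernel K N where
  toFun := derivX
  map_zero' := derivX_zero
  map_add' := derivX_add

lemma derivX_neg (A : Kernel K N) : derivX (-A) = -derivX A := map_neg derivXHom A

lemma derivX_sum {ι : Type*} (s : Finset ι) (A : ι → Kernel K N) :
    derivX (∑ i ∈ s, A i) = ∑ i ∈ s, derivX (A i) := map_sum derivXHom A s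

lemma derivX_smul (f : DiffFun K N) (A : Kernel K N) :
    derivX (f • A) = dx f • A + f • derivX A := by
  induction A using Polynomial.induction_on' with
  | add p q hp hq => simp only [smul_add, derivX_add, hp, hq]; abel
  | monomial k c =>
    simp only [smul_monomial, derivX_monomial, smul_eq_mul, smul_add, Derivation.leibniz, map_add]
    rw [mul_comm c]; abel

/-- Composition with `∂` on the left commutes with composition with `∂` on the right. -/
lemma derivX_X_mul (A : Kernel K N) : derivX (X * A) = X * derivX A := by
  induction A using Polynomial.induction_on' with
  | add p q hp hq => simp only [mul_add, derivX_add, hp, hq]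
  | monomial k c => simp only [X_mul_monomial, derivX_monomial, mul_add]

lemma derivX_C (f : DiffFun K N) : derivX (C f : Kernel K N) = C (dx f) + f • X := by
  rw [← monomial_zero_left, derivX_monomial, monomial_zero_left, zero_add, ← smul_X_eq_monomial, pow_one]

lemma derivX_one : derivX (1 : Kernel K N) = X := by
  rw [← C_1, derivX_C]; simp

lemma derivX_X_pow (k : ℕ) : derivX (X ^ k : Kernel K N) = X ^ (k + 1) := by
  induction k with
  | zero => simp [derivX_one]
  | succ k ih => rw [pow_succ', derivX_X_mul, ih, ← pow_succ']

lemma derivX_iterate_add (k : ℕ) (A B : Kernel K N) :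
    derivX^[k] (A + B) = derivX^[k] A + derivX^[k] B := iterate_map_add derivXHom k A B

lemma derivX_iterate_one (k : ℕ) : derivX^[k] (1 : Kernel K N) = X ^ k := by
  induction k with
  | zero => rfl
  | succ k ih =>
    rw [Function.iterate_succ_apply', ih, derivX_X_pow]

/-- Composition of differential operators. -/
def opComp (A B : Kernel K N) : Kernel K N := A.sum fun k c => c • derivX^[k] B

lemma opComp_add_left (A A' B : Kernel K N) : opComp (A + A') B = opComp A B + opComp A' B := by
  unfold opComp
  exact Polynomial.sum_add_index _ _ _ (fun i => by simp) (fun i a b => add_smul _ _ _)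

lemma opComp_add_right (A B B' : Kernel K N) : opComp A (B + B') = opComp A B + opComp A B' := by
  simp only [opComp, derivX_iterate_add, smul_add, Polynomial.sum_add]

lemma opComp_monomial (k : ℕ) (c : DiffFun K N) (B : Kernel K N) :
    opComp (monomial k c) B = c • derivX^[k] B := by
  simp [opComp]

lemma opComp_zero_left (B : Kernel K N) : opComp 0 B = 0 := by simp [opComp]

lemma opComp_zero_right (A : Kernel K N) : opComp A 0 = 0 := by
  have h := opComp_add_right A 0 0
  simpa using h

/-- Composition as a biadditive map. -/
def opCompHom : Kernel K N →+ Kernel K N →+ Kernel K N where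
  toFun A := ⟨⟨opComp A, opComp_zero_right A⟩, opComp_add_right A⟩
  map_zero' := AddMonoidHom.ext fun B => opComp_zero_left B
  map_add' A A' := AddMonoidHom.ext fun B => opComp_add_left A A' B

lemma opComp_sum_left {ι : Type*} (s : Finset ι) (A : ι → Kernel K N) (B : Kernel K N) :
    opComp (∑ i ∈ s, A i) B = ∑ i ∈ s, opComp (A i) B := by
  exact map_sum (opCompHom.flip B) A s

lemma opComp_sum_right {ι : Type*} (s : Finset ι) (A : Kernel K N) (B : ι → Kernel K N) :
    opComp A (∑ i ∈ s, B i) = ∑ i ∈ s, opComp A (B i) := map_sum (opCompHom A) B s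

lemma opComp_neg_right (A B : Kernel K N) : opComp A (-B) = -opComp A B := map_neg (opCompHom A) B

lemma opComp_neg_left (A B : Kernel K N) : opComp (-A) B = -opComp A B := by
  exact map_neg (opCompHom.flip B) A

lemma opComp_smul (f : DiffFun K N) (A B : Kernel K N) : opComp (f • A) B = f • opComp A B := by
  induction A using Polynomial.induction_on' with
  | add p q hp hq => simp only [smul_add, opComp_add_left, hp, hq]
  | monomial k c => simp only [smul_monomial, opComp_monomial, smul_smul, smul_eq_mul]

lemma opComp_derivX (A B : Kernel K N) : opComp (derivX A) B = derivX (opComp A B) := by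
  induction A using Polynomial.induction_on' with
  | add p q hp hq => simp only [derivX_add, opComp_add_left, hp, hq]
  | monomial k c =>
    simp only [derivX_monomial, opComp_monomial, opComp_add_left, derivX_smul,
      Function.iterate_succ_apply']

lemma opComp_derivX_iterate (k : ℕ) (A B : Kernel K N) :
    opComp (derivX^[k] A) B = derivX^[k] (opComp A B) := by
  induction k with
  | zero => rfl
  | succ k ih => rw [Function.iterate_succ_apply', opComp_derivX, ih, Function.iterate_succ_apply']

lemma opComp_assoc (A B D : Kernel K N) : opComp (opComp A B) D = opComp A (opComp B D) := by
  induction A using Polynomial.induction_on' with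
  | add p q hp hq => simp only [opComp_add_left, hp, hq]
  | monomial k c => simp only [opComp_monomial, opComp_smul, opComp_derivX_iterate]

lemma opComp_C (f : DiffFun K N) (B : Kernel K N) : opComp (C f) B = f • B := by
  rw [← monomial_zero_left, opComp_monomial]; rfl

lemma one_comp (B : Kernel K N) : opComp 1 B = B := by rw [← C_1, opComp_C, one_smul]

lemma X_comp (B : Kernel K N) : opComp X B = derivX B := by
  rw [← monomial_one_one_eq_X, opComp_monomial, one_smul]; rfl

lemma opComp_one (A : Kernel K N) : opComp A 1 = A := by
  induction A using Polynomial.induction_on' with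
  | add p q hp hq => simp only [opComp_add_left, hp, hq]
  | monomial k c => rw [opComp_monomial, derivX_iterate_one, ← monomial_one_right_eq_X_pow, smul_monomial, smul_eq_mul, mul_one]

lemma X_mul_smul (f : DiffFun K N) (A : Kernel K N) : X * f • A = f • (X * A) :=
  mul_smul_comm _ _ _

lemma derivX_iterate_X_mul (k : ℕ) (A : Kernel K N) :
    derivX^[k] (X * A) = X * derivX^[k] A := by
  induction k generalizing A with
  | zero => rfl
  | succ k ih => rw [Function.iterate_succ_apply, derivX_X_mul, ih, Function.iterate_succ_apply]

lemma opComp_X_mul (A B : Kernel K N) : opComp A (X * B) = X * opComp A B := by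
  induction A using Polynomial.induction_on' with
  | add p q hp hq => simp only [opComp_add_left, hp, hq, mul_add]
  | monomial k c => simp only [opComp_monomial, derivX_iterate_X_mul, X_mul_smul]

lemma opComp_X (A : Kernel K N) : opComp A X = X * A := by
  rw [← mul_one X, opComp_X_mul, opComp_one, mul_one]

lemma X_mul_comp (A B : Kernel K N) : opComp (X * A) B = opComp A (derivX B) := by
  rw [← opComp_X, opComp_assoc, X_comp]

lemma derivX_iterate_C (k : ℕ) (g : DiffFun K N) :
    derivX^[k] (C g : Kernel K N) =
      ∑ j ∈ Finset.range (k + 1), monomial (k - j) ((k.choose j : DiffFun K N) * (dx^[j]) g) := by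
  -- `∂ ∘` splits as `S + T`, where `T` raises the order of the operator and `S` differentiates its
  -- coefficients. They commute, so the binomial theorem gives the Leibniz rule for `∂^k ∘ g`.
  let T : AddMonoid.End (Kernel K N) := AddMonoidHom.mulLeft X
  let D : AddMonoid.End (Kernel K N) := derivXHom
  let S : AddMonoid.End (Kernel K N) := D - T
  have hT : ∀ m (g : DiffFun K N), (T ^ m) (C g) = monomial m g := by
    intro m g
    induction m with
    | zero => rfl
    | succ m ih =>
      rw [pow_succ', AddMonoid.End.coe_mul, Function.comp_apply, ih]
      exact X_mul_monomial m g
  have hS : ∀ m n (g : DiffFun K N), (S ^ m) (monomial n g) = monomial n ((dx^[m]) g) := by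
    intro m n g
    induction m with
    | zero => rfl
    | succ m ih =>
      rw [pow_succ', AddMonoid.End.coe_mul, Function.comp_apply, ih, Function.iterate_succ_apply']
      change derivX _ - X * _ = _
      rw [derivX_monomial, X_mul_monomial, add_sub_cancel_right]
  have hc : Commute S T := by
    refine AddMonoidHom.ext fun A => ?_
    change derivX (X * A) - X * (X * A) = X * (derivX A - X * A)
    rw [derivX_X_mul, mul_sub]
  have hk : derivX^[k] (C g : Kernel K N) = ((S + T) ^ k) (C g) := by
    rw [AddMonoid.End.coe_pow, show S + T = D from sub_add_cancel _ _]; rfl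
  rw [hk, hc.add_pow]
  refine (AddMonoidHom.finsetSum_apply _ _ _).trans ?_
  refine Finset.sum_congr rfl fun j _ => ?_
  change (S ^ j) ((T ^ (k - j)) ((k.choose j : AddMonoid.End (Kernel K N)) (C g))) = _
  rw [AddMonoid.End.natCast_apply, map_nsmul, map_nsmul, hT, hS, ← nsmul_eq_mul, map_nsmul]

/-- The defining formula for `g(y) δ^{(k)}(x - y)` is the Leibniz expansion of `∂^k ∘ g`. From here
on, all rules for `mulY` follow from associativity of composition. -/
lemma mulY_eq_comp (g : DiffFun K N) (A : Kernel K N) : mulY g A = opComp A (C g) := by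
  unfold mulY opComp
  refine Finset.sum_congr rfl fun k _ => ?_
  dsimp only
  rw [derivX_iterate_C, Finset.smul_sum]
  refine Finset.sum_congr rfl fun j _ => ?_
  rw [smul_monomial, smul_eq_mul, mul_comm]

lemma mulY_add (g : DiffFun K N) (A B : Kernel K N) : mulY g (A + B) = mulY g A + mulY g B := by
  simp only [mulY_eq_comp, opComp_add_left]

lemma mulY_add_left (f g : DiffFun K N) (A : Kernel K N) :
    mulY (f + g) A = mulY f A + mulY g A := by
  simp only [mulY_eq_comp, C_add, opComp_add_right]

lemma mulY_smul (f g : DiffFun K N) (A : Kernel K N) : mulY g (f • A) = f • mulY g A := by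
  simp only [mulY_eq_comp, opComp_smul]

lemma mulY_mulY (f g : DiffFun K N) (A : Kernel K N) : mulY f (mulY g A) = mulY (f * g) A := by
  simp only [mulY_eq_comp, opComp_assoc, opComp_C, smul_C, smul_eq_mul, mul_comm]

lemma mulY_derivX (g : DiffFun K N) (A : Kernel K N) : mulY g (derivX A) = derivX (mulY g A) := by
  simp only [mulY_eq_comp, opComp_derivX]

lemma mulY_X_mul (g : DiffFun K N) (A : Kernel K N) :
    mulY g (X * A) = X * mulY g A + mulY (dx g) A := by
  simp only [mulY_eq_comp, X_mul_comp, derivX_C, opComp_add_right, ← opComp_X_mul]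
  rw [add_comm, smul_eq_C_mul, mul_comm]

lemma mulY_one (g : DiffFun K N) : mulY g (1 : Kernel K N) = C g := by
  rw [mulY_eq_comp, one_comp]

lemma mulY_X (g : DiffFun K N) : mulY g (X : Kernel K N) = g • X + C (dx g) := by
  rw [mulY_eq_comp, X_comp, derivX_C, add_comm]

/-- A constant commutes with every differential operator; this makes all operations on kernels
`K`-linear. -/
lemma mulY_of_dx_eq_zero {r : DiffFun K N} (h : dx r = 0) (A : Kernel K N) :
    mulY r A = r • A := by
  have key : ∀ k, derivX^[k] (C r : Kernel K N) = r • X ^ k := by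
    intro k
    induction k with
    | zero => rw [pow_zero, ← C_1, smul_C, smul_eq_mul, mul_one]; rfl
    | succ k ih => rw [Function.iterate_succ_apply', ih, derivX_smul, h, zero_smul, zero_add,
        derivX_X_pow]
  rw [mulY_eq_comp]
  induction A using Polynomial.induction_on' with
  | add p q hp hq => simp only [opComp_add_left, smul_add, hp, hq]
  | monomial k c => rw [opComp_monomial, key, smul_comm, ← C_mul_X_pow_eq_monomial, smul_eq_C_mul c]

/-! ### The adjoint -/

lemma swap_monomial (k : ℕ) (f : DiffFun K N) :
    swap (monomial k f) = (-1) ^ k * mulY f (X ^ k : Kernel K N) := by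
  have h : (monomial k ((-1) ^ k) : Kernel K N) = C ((-1) ^ k) * X ^ k :=
    (C_mul_X_pow_eq_monomial).symm
  rw [swap, sum_monomial_index]
  · rw [h, ← smul_eq_C_mul, mulY_smul, smul_eq_C_mul]; simp
  · simp [mulY_eq_comp, opComp_zero_right]

lemma swap_add (A B : Kernel K N) : swap (A + B) = swap A + swap B := by
  unfold swap
  refine Polynomial.sum_add_index _ _ _ (fun i => ?_) (fun i a b => mulY_add_left _ _ _)
  simp [mulY_eq_comp, opComp_zero_right]

lemma swap_zero : swap (0 : Kernel K N) = 0 := by simp [swap]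

/-- `swap` as an additive map. -/
def swapHom : Kernel K N →+ Kernel K N where
  toFun := swap
  map_zero' := swap_zero
  map_add' := swap_add

lemma swap_neg (A : Kernel K N) : swap (-A) = -swap A := map_neg swapHom A

lemma swap_sub (A B : Kernel K N) : swap (A - B) = swap A - swap B := map_sub swapHom A B

lemma swap_sum {ι : Type*} (s : Finset ι) (A : ι → Kernel K N) :
    swap (∑ i ∈ s, A i) = ∑ i ∈ s, swap (A i) := map_sum swapHom A s

lemma swap_C (f : DiffFun K N) : swap (C f : Kernel K N) = C f := by
  rw [← monomial_zero_left, swap_monomial, pow_zero, pow_zero, mulY_one, one_mul, monomial_zero_left]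

lemma swap_smul (f : DiffFun K N) (A : Kernel K N) : swap (f • A) = mulY f (swap A) := by
  induction A using Polynomial.induction_on' with
  | add p q hp hq => simp only [smul_add, swap_add, hp, hq, mulY_add]
  | monomial k c =>
    rw [smul_monomial, swap_monomial, swap_monomial]
    have h : ((-1) ^ k : Kernel K N) = C ((-1) ^ k) := by simp
    rw [h, ← smul_eq_C_mul, ← smul_eq_C_mul, mulY_smul, mulY_mulY, smul_eq_mul]

lemma swap_X_mul (A : Kernel K N) : swap (X * A) = -derivX (swap A) := by
  induction A using Polynomial.induction_on' with
  | add p q hp hq => simp only [mul_add, swap_add, hp, hq, derivX_add, neg_add]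
  | monomial k c =>
    have h : ∀ k, ((-1) ^ k : Kernel K N) = C ((-1) ^ k) := by simp
    rw [X_mul_monomial, swap_monomial, swap_monomial, h, h, ← smul_eq_C_mul, ← smul_eq_C_mul,
      derivX_smul, ← mulY_derivX, derivX_X_pow, pow_succ]
    have h0 : dx ((-1) ^ k : DiffFun K N) = 0 := by
      rcases neg_one_pow_eq_or (DiffFun K N) k with h | h <;> simp [h]
    rw [h0]; simp

lemma swap_mulY (g : DiffFun K N) (A : Kernel K N) : swap (mulY g A) = g • swap A := by
  have key : ∀ k, ∀ g : DiffFun K N, swap (mulY g (X ^ k)) = g • swap (X ^ k : Kernel K N) := by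
    intro k
    induction k with
    | zero => intro g; rw [pow_zero, mulY_one, swap_C, ← C_1, swap_C, smul_C]; simp
    | succ k ih =>
      intro g
      rw [pow_succ', mulY_X_mul, swap_add, swap_X_mul, ih, ih, swap_X_mul, derivX_smul]
      rw [smul_neg]; abel
  induction A using Polynomial.induction_on' with
  | add p q hp hq => simp only [mulY_add, swap_add, hp, hq, smul_add]
  | monomial k c =>
    rw [← C_mul_X_pow_eq_monomial, ← smul_eq_C_mul, mulY_smul, swap_smul, key, swap_smul,
      mulY_smul]

lemma swap_derivX (A : Kernel K N) : swap (derivX A) = -(X * swap A) := by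
  have key : ∀ k, swap (derivX (X ^ k)) = -(X * swap (X ^ k : Kernel K N)) := by
    intro k
    have h : ∀ k, swap (X ^ k : Kernel K N) = (-1) ^ k * X ^ k := fun k => by
      rw [← monomial_one_right_eq_X_pow, swap_monomial, mulY_eq_comp, C_1, opComp_one,
        monomial_one_right_eq_X_pow]
    rw [derivX_X_pow, h, h]
    ring
  induction A using Polynomial.induction_on' with
  | add p q hp hq => simp only [derivX_add, swap_add, hp, hq, mul_add, neg_add]
  | monomial k c =>
    rw [← C_mul_X_pow_eq_monomial, ← smul_eq_C_mul, derivX_smul, swap_add, swap_smul, swap_smul,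
      key, swap_smul, mulY_eq_comp c (-_), opComp_neg_left, ← mulY_eq_comp, mulY_X_mul]
    abel

lemma swap_swap (A : Kernel K N) : swap (swap A) = A := by
  induction A using Polynomial.induction_on' with
  | add p q hp hq => simp only [swap_add, hp, hq]
  | monomial k c =>
    rw [← C_mul_X_pow_eq_monomial, ← smul_eq_C_mul, swap_smul, swap_mulY]
    congr 1
    induction k with
    | zero => rw [pow_zero, ← C_1, swap_C, swap_C]
    | succ k ih => rw [pow_succ', swap_X_mul, swap_neg, swap_derivX, ih, neg_neg]

/-- The adjoint reverses composition. This is what carries skew-symmetry from the fields to all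
differential functions. -/
lemma swap_comp (A B : Kernel K N) : swap (opComp A B) = opComp (swap B) (swap A) := by
  have key : ∀ k, ∀ B : Kernel K N, swap (derivX^[k] B) = opComp (swap B) (swap (X ^ k)) := by
    intro k
    induction k with
    | zero => intro B; rw [pow_zero, ← C_1, swap_C, C_1, opComp_one]; rfl
    | succ k ih =>
      intro B
      rw [Function.iterate_succ_apply, ih, swap_derivX, pow_succ', swap_X_mul, opComp_neg_left,
        opComp_neg_right, X_mul_comp]
  induction A using Polynomial.induction_on' with
  | add p q hp hq => simp only [opComp_add_left, swap_add, hp, hq, opComp_add_right]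
  | monomial k c =>
    rw [opComp_monomial, swap_smul, key, ← C_mul_X_pow_eq_monomial, ← smul_eq_C_mul, swap_smul,
      mulY_eq_comp, mulY_eq_comp, opComp_assoc]

/-! ### Integration -/

lemma integrateX_add (A B : Kernel K N) : integrateX (A + B) = integrateX A + integrateX B := by
  unfold integrateX
  refine Polynomial.sum_add_index _ _ _ (fun i => ?_) (fun i a b => ?_)
  · simp [iterate_map_zero]
  · rw [iterate_map_add, mul_add]

lemma integrateX_zero : integrateX (0 : Kernel K N) = 0 := by simp [integrateX]

/-- `integrateX` as an additive map. -/
def integrateXHom : Kernel K N →+ DiffFun K N where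
  toFun := integrateX
  map_zero' := integrateX_zero
  map_add' := integrateX_add

lemma integrateX_neg (A : Kernel K N) : integrateX (-A) = -integrateX A := map_neg integrateXHom A

lemma integrateX_sum {ι : Type*} (s : Finset ι) (A : ι → Kernel K N) :
    integrateX (∑ i ∈ s, A i) = ∑ i ∈ s, integrateX (A i) := map_sum integrateXHom A s

lemma integrateX_monomial (k : ℕ) (f : DiffFun K N) :
    integrateX (monomial k f) = (-1) ^ k * (dx^[k]) f := by
  rw [integrateX, sum_monomial_index]
  simp [iterate_map_zero]

lemma dx_neg_one_pow_mul (k : ℕ) (f : DiffFun K N) : dx ((-1) ^ k * f) = (-1) ^ k * dx f := by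
  rcases neg_one_pow_eq_or (DiffFun K N) k with h | h <;> simp [h]

lemma integrateX_X_mul (A : Kernel K N) : integrateX (X * A) = -dx (integrateX A) := by
  induction A using Polynomial.induction_on' with
  | add p q hp hq => simp only [mul_add, integrateX_add, hp, hq, map_add, neg_add]
  | monomial k c =>
    rw [X_mul_monomial, integrateX_monomial, integrateX_monomial, dx_neg_one_pow_mul,
      Function.iterate_succ_apply', pow_succ]
    ring

lemma integrateX_derivX (A : Kernel K N) : integrateX (derivX A) = 0 := by
  induction A using Polynomial.induction_on' with
  | add p q hp hq => simp only [derivX_add, integrateX_add, hp, hq, add_zero]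
  | monomial k c =>
    rw [derivX_monomial, integrateX_add, integrateX_monomial, integrateX_monomial,
      ← Function.iterate_succ_apply dx, pow_succ]
    ring

lemma integrateX_C (f : DiffFun K N) : integrateX (C f : Kernel K N) = f := by
  rw [← monomial_zero_left, integrateX_monomial]; simp

/-- Integration by parts moves all derivatives of `A` onto its coefficients. Hence only the
variational derivative of the first argument survives in `{∫ f dx, g}`. -/
lemma integrateX_comp (A B : Kernel K N) :
    integrateX (opComp A B) = integrateX (integrateX A • B) := by
  have key : ∀ k, ∀ (c : DiffFun K N) (B : Kernel K N), integrateX (c • derivX^[k] B) =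
      integrateX (((-1) ^ k * (dx^[k]) c) • B) := by
    intro k
    induction k with
    | zero => intro c B; simp
    | succ k ih =>
      intro c B
      have h := ih c (derivX B)
      rw [Function.iterate_succ_apply, h]
      have h2 := integrateX_derivX (((-1) ^ k * (dx^[k]) c) • B)
      rw [derivX_smul, integrateX_add, dx_neg_one_pow_mul, ← Function.iterate_succ_apply' dx] at h2
      rw [eq_neg_of_add_eq_zero_right h2, ← integrateX_neg, ← neg_smul, pow_succ]
      congr 2; ring
  induction A using Polynomial.induction_on' with
  | add p q hp hq => simp only [opComp_add_left, integrateX_add, hp, hq, add_smul]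
  | monomial k c => rw [opComp_monomial, key, integrateX_monomial]

lemma integrateX_mulY (g : DiffFun K N) (A : Kernel K N) :
    integrateX (mulY g A) = integrateX A * g := by
  rw [mulY_eq_comp, integrateX_comp, smul_C, integrateX_C, smul_eq_mul]

lemma coeff_zero_derivX (A : Kernel K N) : (derivX A).coeff 0 = dx (A.coeff 0) := by
  induction A using Polynomial.induction_on' with
  | add p q hp hq => simp only [derivX_add, coeff_add, hp, hq, map_add]
  | monomial k c => 
    rw [derivX_monomial, coeff_add, coeff_monomial, coeff_monomial, coeff_monomial]
    split_ifs <;> simp_all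

/-- Integrating `∑ c_k(x) δ^{(k)}(x - y)` over `y` instead of `x` leaves `c_0` alone. -/
lemma integrateX_swap (A : Kernel K N) : integrateX (swap A) = A.coeff 0 := by
  induction A using Polynomial.induction_on' with
  | add p q hp hq => simp only [swap_add, integrateX_add, hp, hq, coeff_add]
  | monomial k c =>
    rw [← C_mul_X_pow_eq_monomial, ← smul_eq_C_mul, swap_smul, integrateX_mulY, coeff_smul,
      smul_eq_mul, mul_comm]
    congr 1
    cases k with
    | zero => rw [pow_zero, ← C_1, swap_C, integrateX_C]; simp
    | succ k => rw [pow_succ', swap_X_mul, integrateX_neg, integrateX_derivX]; simp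

/-- The action of a differential operator on a function. -/
def act (A : Kernel K N) (f : DiffFun K N) : DiffFun K N := (mulY f A).coeff 0

lemma act_add_left (A B : Kernel K N) (f : DiffFun K N) : act (A + B) f = act A f + act B f := by
  rw [act, mulY_add, coeff_add]; rfl

lemma act_add_right (A : Kernel K N) (f g : DiffFun K N) : act A (f + g) = act A f + act A g := by
  rw [act, mulY_add_left, coeff_add]; rfl

/-- `act` as a biadditive map. -/
def actHom : Kernel K N →+ DiffFun K N →+ DiffFun K N :=
  AddMonoidHom.mk' (fun A => AddMonoidHom.mk' (act A) (act_add_right A))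
    fun A B => AddMonoidHom.ext fun f => act_add_left A B f

lemma act_sum_right {ι : Type*} (s : Finset ι) (A : Kernel K N) (f : ι → DiffFun K N) :
    act A (∑ i ∈ s, f i) = ∑ i ∈ s, act A (f i) := map_sum (actHom A) f s

lemma act_smul (f g : DiffFun K N) (A : Kernel K N) : act (g • A) f = g * act A f := by
  rw [act, mulY_smul, coeff_smul, smul_eq_mul]; rfl

lemma act_neg (A : Kernel K N) (f : DiffFun K N) : act (-A) f = -act A f := map_neg (actHom.flip f) A

lemma act_derivX (A : Kernel K N) (f : DiffFun K N) : act (derivX A) f = dx (act A f) := by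
  rw [act, mulY_derivX, coeff_zero_derivX]; rfl

lemma act_X_mul (A : Kernel K N) (f : DiffFun K N) : act (X * A) f = act A (dx f) := by
  rw [act, mulY_X_mul, coeff_add, coeff_X_mul_zero, zero_add]; rfl

lemma act_mulY (A : Kernel K N) (f g : DiffFun K N) : act (mulY g A) f = act A (f * g) := by
  rw [act, mulY_mulY]; rfl

lemma act_C (f g : DiffFun K N) : act (C g) f = g * f := by
  rw [act, mulY_eq_comp, opComp_C, smul_C, coeff_C_zero, smul_eq_mul]

/-- Integration over `x` against `f(x)` is the action of the adjoint operator on `f`. -/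
lemma integrateX_smul (f : DiffFun K N) (A : Kernel K N) :
    integrateX (f • A) = act (swap A) f := by
  rw [← swap_swap (f • A), integrateX_swap, swap_smul]; rfl

/-- `∫ A dx` differs from the coefficient of `δ` by a total derivative. -/
lemma exists_integrateX_eq (A : Kernel K N) : ∃ g, integrateX A = A.coeff 0 + dx g := by
  induction A using Polynomial.induction_on' with
  | add p q hp hq =>
    obtain ⟨g, hg⟩ := hp
    obtain ⟨g', hg'⟩ := hq
    exact ⟨g + g', by rw [integrateX_add, hg, hg', coeff_add, map_add]; ring⟩
  | monomial k c =>
    cases k with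
    | zero => exact ⟨0, by rw [monomial_zero_left, integrateX_C]; simp⟩
    | succ k =>
      refine ⟨-integrateX (monomial k c), ?_⟩
      rw [← X_mul_monomial, integrateX_X_mul, coeff_X_mul_zero, zero_add, map_neg]

end Kernel
end RatToda
end

open scoped LaurentSeries
noncomputable section
namespace RatToda
variable {K : Type*} [Field K] {N : ℕ}
open Kernel Polynomial

/-! ### Derivations of the ring of differential functions -/

lemma exists_mul_eq (f : DiffFun K N) : ∃ (p s : JetPoly K N), s ∈ Submonoid.powers (bTop K N) ∧
    f * algebraMap _ _ s = algebraMap _ _ p := by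
  obtain ⟨⟨p, s⟩, hs⟩ := IsLocalization.surj (Submonoid.powers (bTop K N)) f
  exact ⟨p, s, s.2, hs⟩

lemma algebraMap_C (r : K) : algebraMap (JetPoly K N) (DiffFun K N) (MvPolynomial.C r) =
    algebraMap K _ r := by
  rw [IsScalarTower.algebraMap_apply K (JetPoly K N) (DiffFun K N)]; rfl

/-- An additive map that satisfies the Leibniz rule and vanishes on constants and jet variables
vanishes. -/
lemma leibniz_eq_zero {M : Type*} [AddCommGroup M] (act : DiffFun K N → M → M)
    (act_one : ∀ m, act 1 m = m) (act_mul : ∀ f g m, act (f * g) m = act f (act g m))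
    (act_zero : ∀ f, act f 0 = 0) (D : DiffFun K N →+ M)
    (leibniz : ∀ f g, D (f * g) = act f (D g) + act g (D f))
    (hK : ∀ r : K, D (algebraMap K _ r) = 0) (hjet : ∀ v, D (jet v) = 0) (f : DiffFun K N) :
    D f = 0 := by
  have hp : ∀ p : JetPoly K N, D (algebraMap _ _ p) = 0 := by
    intro p
    induction p using MvPolynomial.induction_on with
    | C r => rw [algebraMap_C, hK]
    | add p q hp hq => rw [map_add, map_add, hp, hq, add_zero]
    | mul_X p v hp =>
      rw [map_mul, leibniz, hp]
      have := hjet v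
      rw [jet] at this
      rw [this, act_zero, act_zero, add_zero]
  -- Clear the powers of `b_N`: `D` kills both `s` and `f s`, so `s` annihilates `D f`, and `s` acts
  -- invertibly.
  obtain ⟨p, s, hs, h⟩ := exists_mul_eq f
  have h1 := congrArg D h
  rw [leibniz, hp, hp, act_zero, zero_add] at h1
  obtain ⟨t, ht⟩ := (IsLocalization.map_units (DiffFun K N) ⟨s, hs⟩).exists_left_inv
  have h2 := congrArg (act t) h1
  rwa [act_zero, ← act_mul, ht, act_one] at h2

lemma derivation_ext {D E : Derivation K (DiffFun K N) (DiffFun K N)}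
    (h : ∀ v, D (jet v) = E (jet v)) : D = E := by
  ext f
  rw [← sub_eq_zero]
  refine leibniz_eq_zero (fun f m => f * m) one_mul mul_assoc mul_zero
    ((D - E : Derivation K _ _) : DiffFun K N →ₗ[K] DiffFun K N).toAddMonoidHom ?_ ?_ ?_ f
  · intro f g; exact (D - E).leibniz f g
  · intro r; exact (D - E).map_algebraMap r
  · intro v; simp [h]

lemma dx_jet (v : JetVar N) : dx (jet v : DiffFun K N) = jet (v.1, v.2 + 1) := by
  rw [jet, dx, extDer_algebraMap, MvPolynomial.mkDerivation_X]; rfl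

lemma dx_iterate_jet (v : Var N) (s : ℕ) : dx^[s] (jet (v, 0) : DiffFun K N) = jet (v, s) := by
  induction s with
  | zero => rfl
  | succ s ih => rw [Function.iterate_succ_apply', ih, dx_jet]

lemma partialD_jet (v w : JetVar N) :
    partialD v (jet w : DiffFun K N) = if w = v then 1 else 0 := by
  classical
  rw [jet, partialD, extDer_algebraMap, MvPolynomial.pderiv_X, Pi.single_apply]
  split_ifs <;> simp

/-- Derivations that commute with `∂` and agree on the fields are equal. -/
lemma derivation_ext_of_comm {D E : Derivation K (DiffFun K N) (DiffFun K N)}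
    (hD : ∀ f, D (dx f) = dx (D f)) (hE : ∀ f, E (dx f) = dx (E f))
    (h : ∀ v, D (jet (v, 0)) = E (jet (v, 0))) : D = E := by
  refine derivation_ext fun ⟨v, s⟩ => ?_
  induction s with
  | zero => exact h v
  | succ s ih => rw [← dx_jet (v, s), hD, hE, ih]

lemma partialD_zero_dx (v : Var N) (f : DiffFun K N) :
    partialD (v, 0) (dx f) = dx (partialD (v, 0) f) := by
  have h : ⁅partialD (K := K) (v, 0), dx (K := K) (N := N)⁆ = 0 := by
    refine derivation_ext fun w => ?_
    rw [Derivation.commutator_apply, dx_jet, partialD_jet, partialD_jet]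
    have : ¬ ((w.1, w.2 + 1) : JetVar N) = (v, 0) := by simp
    rw [if_neg this]
    split_ifs <;> simp
  have := congrArg (fun D : Derivation K (DiffFun K N) (DiffFun K N) => D f) h
  simpa [Derivation.commutator_apply, sub_eq_zero] using this

/-- Commutators of derivations are derivations, so it suffices to compare both sides on jet
variables. Only `∂ v^{(s)} = v^{(s+1)}` contributes. -/
lemma partialD_succ_dx (v : Var N) (s : ℕ) (f : DiffFun K N) :
    partialD (v, s + 1) (dx f) = dx (partialD (v, s + 1) f) + partialD (v, s) f := by
  have h : ⁅partialD (K := K) (v, s + 1), dx (K := K) (N := N)⁆ = partialD (v, s) := by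
    refine derivation_ext fun w => ?_
    rw [Derivation.commutator_apply, dx_jet, partialD_jet, partialD_jet, partialD_jet]
    obtain ⟨w, t⟩ := w
    simp only [Prod.mk.injEq, Nat.add_right_cancel_iff]
    split_ifs <;> simp
  have := congrArg (fun D : Derivation K (DiffFun K N) (DiffFun K N) => D f) h
  rw [Derivation.commutator_apply] at this
  rw [← this]; ring

lemma partialD_comm (v w : JetVar N) (f : DiffFun K N) :
    partialD v (partialD w f) = partialD w (partialD v f) := by
  have h : ⁅partialD (K := K) v, partialD (K := K) w⁆ = 0 := by
    refine derivation_ext fun u => ?_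
    rw [Derivation.commutator_apply, partialD_jet, partialD_jet]
    split_ifs <;> simp
  have := congrArg (fun D : Derivation K (DiffFun K N) (DiffFun K N) => D f) h
  simpa [Derivation.commutator_apply, sub_eq_zero] using this

lemma exists_order (f : DiffFun K N) : ∃ n, ∀ v s, n ≤ s → partialD (v, s) f = 0 := by
  obtain ⟨n, hn⟩ := ((partialD_finite f).image Prod.snd).bddAbove
  refine ⟨n + 1, fun v s hs => ?_⟩
  by_contra h
  have := hn ⟨(v, s), h, rfl⟩
  simp only at this
  omega

/-! ### Fréchet and variational derivatives -/

lemma partialD_snd_finite (v : Var N) (f : DiffFun K N) : {s | partialD (v, s) f ≠ 0}.Finite :=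
  ((partialD_finite f).image Prod.snd).subset fun s hs => ⟨(v, s), hs, rfl⟩

/-- The Fréchet derivative `∑_s ∂f/∂v^{(s)} ∂^s` with respect to the field `v`. -/
def frechet (v : Var N) (f : DiffFun K N) : Kernel K N :=
  ∑ s ∈ (partialD_snd_finite v f).toFinset, monomial s (partialD (v, s) f)

lemma coeff_frechet (v : Var N) (f : DiffFun K N) (s : ℕ) :
    (frechet v f).coeff s = partialD (v, s) f := by
  classical
  rw [frechet, finsetSum_coeff]
  simp only [coeff_monomial]
  rw [Finset.sum_ite_eq']
  simp only [Set.Finite.mem_toFinset, Set.mem_ofPred_eq, ne_eq, ite_not, ite_eq_right_iff]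
  exact fun h => h.symm

lemma frechet_eq_sum {n : ℕ} {f : DiffFun K N} (hn : ∀ v s, n ≤ s → partialD (v, s) f = 0)
    (v : Var N) : frechet v f = ∑ s ∈ Finset.range n, monomial s (partialD (v, s) f) := by
  ext s
  rw [coeff_frechet, finsetSum_coeff]
  simp only [coeff_monomial]
  rw [Finset.sum_ite_eq']
  split_ifs with h
  · rfl
  · exact hn v s (by simpa using h)

lemma frechet_add (v : Var N) (f g : DiffFun K N) :
    frechet v (f + g) = frechet v f + frechet v g := by
  ext s; simp only [coeff_add, coeff_frechet, map_add]

lemma frechet_smul (v : Var N) (r : K) (f : DiffFun K N) :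
    frechet v (r • f) = r • frechet v f := by
  ext s; simp only [coeff_smul, coeff_frechet, Derivation.map_smul]

lemma frechet_mul (v : Var N) (f g : DiffFun K N) :
    frechet v (f * g) = f • frechet v g + g • frechet v f := by
  ext s; simp only [coeff_add, coeff_smul, coeff_frechet, Derivation.leibniz]

lemma frechet_algebraMap (v : Var N) (r : K) : frechet v (algebraMap K (DiffFun K N) r) = 0 := by
  ext s; simp only [coeff_frechet, coeff_zero, Derivation.map_algebraMap]

lemma frechet_dx (v : Var N) (f : DiffFun K N) : frechet v (dx f) = derivX (frechet v f) := by
  have h : ∀ (A : Kernel K N) s, (derivX A).coeff (s + 1) = dx (A.coeff (s + 1)) + A.coeff s := by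
    intro A s
    induction A using Polynomial.induction_on' with
    | add p q hp hq => simp only [derivX_add, coeff_add, hp, hq, map_add]; ring
    | monomial k c =>
      rw [derivX_monomial]
      simp only [coeff_add, coeff_monomial, Nat.add_right_cancel_iff]
      split_ifs <;> simp
  ext s
  cases s with
  | zero => rw [coeff_frechet, coeff_zero_derivX, partialD_zero_dx, coeff_frechet]
  | succ s => rw [h, coeff_frechet, coeff_frechet, coeff_frechet, partialD_succ_dx]

lemma frechet_jet (v w : Var N) :
    frechet v (jet (w, 0) : DiffFun K N) = if w = v then 1 else 0 := by
  ext s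
  rw [coeff_frechet, partialD_jet]
  by_cases h : w = v
  · rw [if_pos h, coeff_one]
    simp only [Prod.mk.injEq, h, true_and, eq_comm]
  · rw [if_neg h, if_neg (by simp [h])]; simp

/-- The Fréchet derivative as an additive map. -/
def frechetHom (v : Var N) : DiffFun K N →+ Kernel K N := AddMonoidHom.mk' (frechet v) (frechet_add v)

lemma frechet_sum {ι : Type*} (s : Finset ι) (v : Var N) (f : ι → DiffFun K N) :
    frechet v (∑ i ∈ s, f i) = ∑ i ∈ s, frechet v (f i) := map_sum (frechetHom v) f s

lemma frechet_neg (v : Var N) (f : DiffFun K N) : frechet v (-f) = -frechet v f :=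
  map_neg (frechetHom v) f

/-- The variational derivative. -/
def varD (v : Var N) (f : DiffFun K N) : DiffFun K N := integrateX (frechet v f)

/-- Exchanging the two variables conjugates `∂_y` into `∂_x`; this is how derivatives in `y` become
adjoint Fréchet derivatives. -/
lemma derivY_eq (A : Kernel K N) : derivY A = swap (derivX (swap A)) := by
  rw [swap_derivX, swap_swap]; rfl

lemma derivY_iterate_eq (k : ℕ) (A : Kernel K N) :
    derivY^[k] A = swap (derivX^[k] (swap A)) := by
  induction k with
  | zero => exact (swap_swap A).symm
  | succ k ih =>
    rw [Function.iterate_succ_apply', ih, derivY_eq, swap_swap, Function.iterate_succ_apply']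

lemma opComp_comp_swap_monomial (p q : ℕ) (f g : DiffFun K N) (A : Kernel K N) :
    opComp (opComp (monomial p f) A) (swap (monomial q g)) =
      mulX f (mulY g (derivX^[p] (derivY^[q] A))) := by
  rw [derivY_iterate_eq, ← swap_swap (opComp _ _), swap_comp, swap_swap, opComp_monomial, swap_smul,
    swap_comp, ← opComp_derivX_iterate, swap_comp, swap_swap, opComp_monomial, mulX_eq_smul, mulY_smul]

/-- The local bracket in terms of Fréchet derivatives. -/
lemma localBracket_eq (P : Bracket K N) (f g : DiffFun K N) :
    localBracket P f g = ∑ v, ∑ w, opComp (opComp (frechet v f) (P v w)) (swap (frechet w g)) := by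
  obtain ⟨n, hn⟩ := exists_order f
  obtain ⟨m, hm⟩ := exists_order g
  have hfin : ∀ (n : ℕ) (F : JetVar N → Kernel K N), (∀ v s, n ≤ s → F (v, s) = 0) →
      ∑ᶠ v, F v = ∑ v : Var N, ∑ s ∈ Finset.range n, F (v, s) := by
    intro n F hF
    rw [finsum_eq_sum_of_support_subset F
      (s := (Finset.univ : Finset (Var N)) ×ˢ Finset.range n), Finset.sum_product]
    intro x hx
    obtain ⟨v, s⟩ := x
    simp only [Finset.coe_product, Finset.coe_univ, Finset.coe_range, Set.mem_prod, Set.mem_univ,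
      Set.mem_Iio, true_and]
    by_contra h
    exact hx (hF v s (not_lt.mp h))
  have hg : ∀ v : JetVar N, (∑ᶠ w : JetVar N,
      mulX (partialD v f) (mulY (partialD w g) (derivX^[v.2] (derivY^[w.2] (P v.1 w.1))))) =
      ∑ w : Var N, ∑ s ∈ Finset.range m,
        mulX (partialD v f) (mulY (partialD (w, s) g) (derivX^[v.2] (derivY^[s] (P v.1 w)))) := by
    intro v
    refine hfin m _ fun w s hs => ?_
    rw [hm w s hs, mulY_eq_comp]; simp [opComp_zero_right, mulX]
  rw [localBracket]
  simp only [hg]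
  rw [hfin n]
  · refine Finset.sum_congr rfl fun v _ => ?_
    rw [Finset.sum_comm]
    refine Finset.sum_congr rfl fun w _ => ?_
    rw [frechet_eq_sum hn, frechet_eq_sum hm, opComp_sum_left, opComp_sum_left]
    refine Finset.sum_congr rfl fun p _ => ?_
    rw [swap_sum, opComp_sum_right]
    refine Finset.sum_congr rfl fun q _ => ?_
    rw [opComp_comp_swap_monomial]
  · intro v s hs
    simp [hn v s hs, mulX]

lemma localBracket_jet (P : Bracket K N) (v w : Var N) :
    localBracket P (jet (v, 0)) (jet (w, 0)) = P v w := by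
  rw [localBracket_eq, Finset.sum_eq_single v, Finset.sum_eq_single w]
  · rw [frechet_jet, frechet_jet, if_pos rfl, if_pos rfl, ← C_1, swap_C, C_1, Kernel.one_comp, opComp_one]
  · intro b _ hb; rw [frechet_jet b w, if_neg hb.symm]; simp [swap_zero, opComp_zero_right]
  · simp
  · intro b _ hb; simp [frechet_jet, if_neg hb.symm, opComp_zero_left]
  · simp

lemma localBracket_add_left (P : Bracket K N) (f f' g : DiffFun K N) :
    localBracket P (f + f') g = localBracket P f g + localBracket P f' g := by
  simp only [localBracket_eq, frechet_add, opComp_add_left, Finset.sum_add_distrib]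

lemma localBracket_add_right (P : Bracket K N) (f g g' : DiffFun K N) :
    localBracket P f (g + g') = localBracket P f g + localBracket P f g' := by
  simp only [localBracket_eq, frechet_add, swap_add, opComp_add_right, Finset.sum_add_distrib]

lemma localBracket_mul_left (P : Bracket K N) (f f' g : DiffFun K N) :
    localBracket P (f * f') g = f • localBracket P f' g + f' • localBracket P f g := by
  simp only [localBracket_eq, frechet_mul, opComp_smul, opComp_add_left, Finset.sum_add_distrib,
    Finset.smul_sum]

lemma localBracket_mul_right (P : Bracket K N) (f g g' : DiffFun K N) :
    localBracket P f (g * g') = mulY g (localBracket P f g') + mulY g' (localBracket P f g) := by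
  simp only [localBracket_eq, frechet_mul, swap_smul, swap_add, mulY_eq_comp, opComp_add_right,
    Finset.sum_add_distrib, opComp_sum_left, opComp_assoc]

lemma localBracket_algebraMap_left (P : Bracket K N) (r : K) (g : DiffFun K N) :
    localBracket P (algebraMap K _ r) g = 0 := by
  simp [localBracket_eq, frechet_algebraMap, opComp_zero_left]

lemma localBracket_algebraMap_right (P : Bracket K N) (r : K) (f : DiffFun K N) :
    localBracket P f (algebraMap K _ r) = 0 := by
  simp [localBracket_eq, frechet_algebraMap, swap_zero, opComp_zero_right]

lemma localBracket_dx_left (P : Bracket K N) (f g : DiffFun K N) :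
    localBracket P (dx f) g = derivX (localBracket P f g) := by
  simp only [localBracket_eq, frechet_dx, opComp_derivX, derivX_sum]

lemma localBracket_dx_right (P : Bracket K N) (f g : DiffFun K N) :
    localBracket P f (dx g) = derivY (localBracket P f g) := by
  have h : ∀ A : Kernel K N, derivY A = opComp A (-X) := fun A => by
    rw [opComp_neg_right, opComp_X]; rfl
  simp only [localBracket_eq, frechet_dx, swap_derivX, opComp_neg_right, opComp_X_mul, h,
    opComp_X, Finset.mul_sum, Finset.sum_neg_distrib]

lemma localBracket_smul_left (P : Bracket K N) (r : K) (f g : DiffFun K N) :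
    localBracket P (r • f) g = r • localBracket P f g := by
  rw [Algebra.smul_def, localBracket_mul_left, localBracket_algebraMap_left, smul_zero, add_zero,
    algebraMap_smul]

lemma localBracket_smul_right (P : Bracket K N) (r : K) (f g : DiffFun K N) :
    localBracket P f (r • g) = r • localBracket P f g := by
  rw [Algebra.smul_def, localBracket_mul_right, localBracket_algebraMap_right,
    mulY_of_dx_eq_zero (Derivation.map_algebraMap dx r),
    mulY_eq_comp g 0, opComp_zero_left, add_zero, algebraMap_smul]

/-- Skew-symmetry of the brackets of the fields extends to all differential functions. -/
lemma swap_localBracket {P : Bracket K N} (hP : ∀ v w, swap (P v w) = -P w v)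
    (f g : DiffFun K N) : swap (localBracket P f g) = -localBracket P g f := by
  simp only [localBracket_eq, swap_sum, swap_comp, swap_swap, hP, opComp_neg_left, opComp_neg_right,
    Finset.sum_neg_distrib]
  rw [Finset.sum_comm]
  simp only [opComp_assoc]

/-! ### Evolutionary vector fields -/

/-- The evolutionary vector field with characteristic `V`. -/
def evolution (V : Var N → DiffFun K N) : Derivation K (DiffFun K N) (DiffFun K N) where
  toFun g := ∑ w, act (frechet w g) (V w)
  map_add' g h := by simp only [frechet_add, act_add_left, Finset.sum_add_distrib]
  map_smul' r g := by
    simp only [frechet_smul, RingHom.id_apply, Finset.smul_sum]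
    refine Finset.sum_congr rfl fun w _ => ?_
    rw [← algebraMap_smul (DiffFun K N) r, act_smul, Algebra.smul_def]
  map_one_eq_zero' := by
    have h : ∀ w, frechet w (1 : DiffFun K N) = 0 := fun w => by
      rw [← map_one (algebraMap K (DiffFun K N)), frechet_algebraMap]
    simp only [LinearMap.coe_mk, AddHom.coe_mk, h]
    exact Finset.sum_eq_zero fun w _ => by rw [← C_0, act_C, zero_mul]
  leibniz' g h := by
    simp only [LinearMap.coe_mk, AddHom.coe_mk, frechet_mul, act_add_left, act_smul,
      Finset.sum_add_distrib, Finset.mul_sum, smul_eq_mul]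

lemma evolution_apply (V : Var N → DiffFun K N) (g : DiffFun K N) :
    evolution V g = ∑ w, act (frechet w g) (V w) := rfl

lemma evolution_dx (V : Var N → DiffFun K N) (f : DiffFun K N) :
    evolution V (dx f) = dx (evolution V f) := by
  simp only [evolution_apply, frechet_dx, act_derivX, map_sum]

lemma evolution_jet (V : Var N → DiffFun K N) (v : Var N) : evolution V (jet (v, 0)) = V v := by
  rw [evolution_apply, Finset.sum_eq_single v]
  · rw [frechet_jet, if_pos rfl, ← C_1, act_C, one_mul]
  · intro w _ hw; rw [frechet_jet, if_neg hw.symm, ← C_0, act_C, zero_mul]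
  · simp

/-- The Hamiltonian vector field of `∫ f dx`. -/
def hamVF (P : Bracket K N) (f : DiffFun K N) : Derivation K (DiffFun K N) (DiffFun K N) :=
  evolution fun w => ∑ v, integrateX (varD v f • P v w)

/-- Integrating `F_f ∘ P ∘ F_g^*` by parts replaces `F_f` by the variational derivative of `f`; what
remains is `F_g` applied to a characteristic. So `{∫ f dx, ·}` is an evolutionary derivation. -/
lemma functionalBracket_eq (P : Bracket K N) (f g : DiffFun K N) :
    functionalBracket P f g = hamVF P f g := by
  rw [functionalBracket, localBracket_eq, hamVF, evolution_apply, integrateX_sum]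
  simp only [integrateX_sum, act_sum_right]
  rw [Finset.sum_comm]
  refine Finset.sum_congr rfl fun w _ => Finset.sum_congr rfl fun v _ => ?_
  rw [integrateX_comp, integrateX_comp, integrateX_smul, swap_swap]
  rfl

lemma hamVF_dx (P : Bracket K N) (f g : DiffFun K N) : hamVF P f (dx g) = dx (hamVF P f g) :=
  evolution_dx _ _

/-- The Jacobi identity in the form `X_{{f,g}} = [X_f, X_g]`. -/
def StrongJacobi (P : Bracket K N) : Prop :=
  ∀ f g h, functionalBracket P (functionalBracket P f g) h =
    functionalBracket P f (functionalBracket P g h) -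
      functionalBracket P g (functionalBracket P f h)

lemma integralZero_add {f g : DiffFun K N} (hf : IntegralZero f) (hg : IntegralZero g) :
    IntegralZero (f + g) := by
  obtain ⟨a, rfl⟩ := hf
  obtain ⟨b, rfl⟩ := hg
  exact ⟨a + b, (map_add dx a b).symm⟩

lemma integralZero_neg {f : DiffFun K N} (hf : IntegralZero f) : IntegralZero (-f) := by
  obtain ⟨a, rfl⟩ := hf
  exact ⟨-a, (map_neg dx a).symm⟩

/-- The identity for Hamiltonian vector fields differs from the cyclic Jacobi identity only by
reordering arguments. Skew-symmetry allows this modulo total derivatives, which Hamiltonian vector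
fields preserve. -/
lemma isPoisson_of {P : Bracket K N} (hskew : ∀ v w, swap (P v w) = -P w v)
    (hJ : StrongJacobi P) : IsPoisson P := by
  have skew : ∀ f g : DiffFun K N,
      IntegralZero (functionalBracket P f g + functionalBracket P g f) := by
    intro f g
    -- `{∫ f, g}` is minus the coefficient of `δ` in `{g(x), f(y)}`, and the integral of that kernel
    -- over `x` differs from this coefficient by a total derivative.
    have h := congrArg integrateX (swap_localBracket hskew g f)
    rw [integrateX_swap, integrateX_neg] at h
    obtain ⟨a, ha⟩ := exists_integrateX_eq (localBracket P g f)
    refine ⟨a, ?_⟩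
    rw [functionalBracket, functionalBracket, ha, h]; ring
  refine ⟨skew, fun f g h => ?_⟩
  have pres : ∀ {x y}, IntegralZero (x : DiffFun K N) → IntegralZero (functionalBracket P y x) := by
    rintro x y ⟨a, rfl⟩
    exact ⟨functionalBracket P y a, by rw [functionalBracket_eq, hamVF_dx, functionalBracket_eq]⟩
  have hadd : ∀ x y y', functionalBracket P x (y + y') = 
      functionalBracket P x y + functionalBracket P x y' := by
    intro x y y'; simp only [functionalBracket_eq, map_add]
  have h1 := skew (functionalBracket P g h) f
  have h2 := skew (functionalBracket P h f) g
  have h3 : IntegralZero (functionalBracket P g (functionalBracket P h f + functionalBracket P f h)) :=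
    pres (skew h f)
  rw [hadd] at h3
  -- The three relations turn `{{g,h},f}` into `-{f,{g,h}}` and `{{h,f},g}` into `{g,{f,h}}`, modulo
  -- total derivatives.
  have := integralZero_add (integralZero_add h1 h2) (integralZero_neg h3)
  rw [hJ f g h]
  convert this using 1
  ring

end RatToda
end

open scoped LaurentSeries
noncomputable section
namespace RatToda
variable {K : Type*} [Field K] {N : ℕ}
open Kernel Polynomial

/-! ### Symmetry of second variational derivatives -/

lemma varD_add (v : Var N) (f g : DiffFun K N) : varD v (f + g) = varD v f + varD v g := by
  rw [varD, frechet_add, integrateX_add]; rfl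

lemma varD_neg (v : Var N) (f : DiffFun K N) : varD v (-f) = -varD v f := by
  rw [varD, frechet_neg, integrateX_neg]; rfl

lemma varD_sum {ι : Type*} (s : Finset ι) (v : Var N) (f : ι → DiffFun K N) :
    varD v (∑ i ∈ s, f i) = ∑ i ∈ s, varD v (f i) := by
  rw [varD, frechet_sum, integrateX_sum]; rfl

lemma varD_dx (v : Var N) (f : DiffFun K N) : varD v (dx f) = 0 := by
  rw [varD, frechet_dx, integrateX_derivX]

lemma varD_mul (v : Var N) (f g : DiffFun K N) :
    varD v (f * g) = act (swap (frechet v g)) f + act (swap (frechet v f)) g := by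
  rw [varD, frechet_mul, integrateX_add, integrateX_smul, integrateX_smul]

lemma varD_smul (v : Var N) (r : K) (f : DiffFun K N) : varD v (r • f) = r • varD v f := by
  rw [varD, frechet_smul, ← algebraMap_smul (DiffFun K N) r, integrateX_smul]
  rw [act, mulY_of_dx_eq_zero (Derivation.map_algebraMap dx r), coeff_smul, ← integrateX_swap,
    swap_swap, algebraMap_smul]; rfl

lemma frechet_dx_iterate (v : Var N) (k : ℕ) (f : DiffFun K N) :
    frechet v (dx^[k] f) = derivX^[k] (frechet v f) := by
  induction k with
  | zero => rfl
  | succ k ih => rw [Function.iterate_succ_apply', frechet_dx, ih, Function.iterate_succ_apply']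

lemma derivX_iterate_sum {ι : Type*} (k : ℕ) (s : Finset ι) (A : ι → Kernel K N) :
    derivX^[k] (∑ i ∈ s, A i) = ∑ i ∈ s, derivX^[k] (A i) := by
  induction k with
  | zero => rfl
  | succ k ih => simp only [Function.iterate_succ_apply', ih, derivX_sum]

lemma swap_neg_one_pow_smul_derivX_iterate (r : ℕ) (A : Kernel K N) :
    swap ((-1 : DiffFun K N) ^ r • derivX^[r] A) = X ^ r * swap A := by
  induction r with
  | zero => simp
  | succ r ih =>
    have : ((-1 : DiffFun K N) ^ (r + 1) • derivX^[r + 1] A : Kernel K N) =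
        -derivX ((-1 : DiffFun K N) ^ r • derivX^[r] A) := by
      rw [Function.iterate_succ_apply', pow_succ]
      rcases Nat.even_or_odd r with h | h
      · rw [Even.neg_one_pow h, one_mul, neg_one_smul, one_smul]
      · rw [Odd.neg_one_pow h, neg_one_mul, neg_neg, one_smul, neg_one_smul, derivX_neg, neg_neg]
    rw [this, swap_neg, swap_derivX, ih, neg_neg, pow_succ']; ring

lemma X_pow_mul_derivX_iterate (r s : ℕ) (A : Kernel K N) :
    X ^ r * derivX^[s] A = derivX^[s] (X ^ r * A) := by
  induction r with
  | zero => simp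
  | succ r ih => rw [pow_succ', mul_assoc, ih, ← derivX_iterate_X_mul, mul_assoc]

lemma act_smul_right (r : K) (A : Kernel K N) (f : DiffFun K N) :
    act A (r • f) = r • act A f := by
  rw [Algebra.smul_def, act, ← mulY_mulY, mulY_of_dx_eq_zero (Derivation.map_algebraMap dx r),
    coeff_smul, algebraMap_smul]; rfl

lemma act_neg_right (A : Kernel K N) (f : DiffFun K N) : act A (-f) = -act A f :=
  map_neg (actHom A) f

/-- The Fréchet derivative of a variational derivative is self-adjoint. -/
lemma frechet_varD (v w : Var N) (g : DiffFun K N) :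
    frechet w (varD v g) = swap (frechet v (varD w g)) := by
  obtain ⟨n, hn⟩ := exists_order g
  have hvar : ∀ v, varD v g = ∑ s ∈ Finset.range n, (-1 : DiffFun K N) ^ s * dx^[s] (partialD (v, s) g) := by
    intro v
    rw [varD, frechet_eq_sum hn, integrateX_sum]
    exact Finset.sum_congr rfl fun s _ => integrateX_monomial _ _
  have hsgn : ∀ (u : Var N) (s : ℕ) (f : DiffFun K N),
      frechet u ((-1) ^ s * f) = (-1 : DiffFun K N) ^ s • frechet u f := by
    intro u s f
    rcases Nat.even_or_odd s with h | h
    · rw [Even.neg_one_pow h, one_mul, one_smul]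
    · rw [Odd.neg_one_pow h, neg_one_mul, neg_one_smul, frechet_neg]
  -- Partial derivatives commute, so the bound `n` on the order of `g` also bounds the order of its
  -- partial derivatives.
  have hfre : ∀ u v, ∀ s, frechet u (partialD (v, s) g) =
      ∑ r ∈ Finset.range n, monomial r (partialD (u, r) (partialD (v, s) g)) := fun u v s =>
    frechet_eq_sum (fun u r hr => by rw [partialD_comm, hn u r hr, map_zero]) u
  have hexp : ∀ u v, frechet u (varD v g) = ∑ s ∈ Finset.range n, ∑ r ∈ Finset.range n,
      (-1 : DiffFun K N) ^ s • derivX^[s] (monomial r (partialD (u, r) (partialD (v, s) g))) := by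
    intro u v
    rw [hvar, frechet_sum]
    refine Finset.sum_congr rfl fun s _ => ?_
    rw [hsgn, frechet_dx_iterate, hfre, derivX_iterate_sum, Finset.smul_sum]
  -- The operators match term by term: the adjoint of `(-1)^r ∂^r ∘ c ∂^s` is `(-1)^s ∂^s ∘ c ∂^r`,
  -- and the mixed partial derivative `c` is symmetric.
  rw [hexp w v, hexp v w, swap_sum, Finset.sum_comm]
  refine Finset.sum_congr rfl fun r _ => ?_
  rw [swap_sum]
  refine Finset.sum_congr rfl fun s _ => ?_
  rw [swap_neg_one_pow_smul_derivX_iterate, swap_monomial, ← derivX_iterate_one s]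
  have hY : ∀ (c : DiffFun K N), mulY c (derivX^[s] (1 : Kernel K N)) = derivX^[s] (C c) := by
    intro c
    rw [mulY_eq_comp, opComp_derivX_iterate, Kernel.one_comp]
  rw [hY, mul_left_comm, X_pow_mul_derivX_iterate, partialD_comm, ← C_mul_X_pow_eq_monomial, mul_comm (C _),
    smul_eq_C_mul, C_pow, C_neg, C_1]

/-! ### Log-canonical brackets -/

/-- The bracket `{v(x), w(y)} = η_{vw} v(x) w(y) δ'(x - y)`. -/
def logBracket (η : Var N → Var N → K) : Bracket K N := fun v w =>
  η v w • xy (jet (v, 0)) (jet (w, 0))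

lemma xy_eq (f g : DiffFun K N) : xy f g = f • mulY g X := by
  rw [xy, mulX_eq_smul]; rfl

lemma swap_X : swap (X : Kernel K N) = -X := by
  rw [← mul_one X, swap_X_mul, ← C_1, swap_C, C_1, derivX_one, mul_one]

lemma swap_xy (f g : DiffFun K N) : swap (xy f g) = -xy g f := by
  rw [xy_eq, swap_smul, swap_mulY, swap_X, smul_neg, mulY_eq_comp, opComp_neg_left, opComp_smul,
    ← mulY_eq_comp, xy_eq]

lemma algebra_smul_eq (r : K) (A : Kernel K N) : r • A = algebraMap K (DiffFun K N) r • A :=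
  (algebraMap_smul _ _ _).symm

lemma swap_smul' (r : K) (A : Kernel K N) : swap (r • A) = r • swap A := by
  rw [algebra_smul_eq, swap_smul, mulY_of_dx_eq_zero (Derivation.map_algebraMap dx r),
    ← algebra_smul_eq]

lemma swap_logBracket {η : Var N → Var N → K} (hη : ∀ v w, η v w = η w v) (v w : Var N) :
    swap (logBracket η v w) = -logBracket η w v := by
  rw [logBracket, swap_smul', swap_xy, smul_neg, hη]; rfl

/-- `v δ_v f`, the variational derivative with respect to `log v`. -/
def logVarD (v : Var N) (f : DiffFun K N) : DiffFun K N := jet (v, 0) * varD v f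

/-- In the coordinates `log v` the Hamiltonian operator is the constant operator `η ∂`, so `log w`
flows by `-∂ ∑ η_{vw} δf/δ(log v)`. The factor `w` returns to the original coordinate. -/
lemma hamVF_logBracket (η : Var N → Var N → K) (f g : DiffFun K N) :
    hamVF (logBracket η) f g = -∑ w, act (frechet w g) (jet (w, 0) *
      dx (∑ v, η v w • logVarD v f)) := by
  rw [hamVF, evolution_apply, ← Finset.sum_neg_distrib]
  refine Finset.sum_congr rfl fun w _ => ?_
  rw [← act_neg_right]
  congr 1
  rw [map_sum, Finset.mul_sum, ← Finset.sum_neg_distrib]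
  refine Finset.sum_congr rfl fun v _ => ?_
  rw [logBracket, integrateX_smul, swap_smul', swap_xy, smul_neg, act_neg, algebra_smul_eq, act_smul,
    xy_eq, act_smul, act_mulY, ← mul_one X, act_X_mul, ← C_1, act_C, one_mul, Derivation.map_smul,
    logVarD, mul_comm (varD v f), Algebra.smul_def]
  ring

/-- A log-canonical bracket with symmetric constants satisfies the Jacobi identity. -/
lemma strongJacobi_logBracket {η : Var N → Var N → K} (hη : ∀ v w, η v w = η w v) :
    StrongJacobi (logBracket η) := by
  intro f g h
  simp only [functionalBracket_eq]
  set P := logBracket η with hP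
  let F : DiffFun K N → Var N → DiffFun K N := fun f w => ∑ v, η v w • logVarD v f
  have hX : ∀ f g, hamVF P f g = -∑ w, act (frechet w g) (jet (w, 0) * dx (F f w)) :=
    hamVF_logBracket η
  have hjet : ∀ f v, hamVF P f (jet (v, 0)) = -(jet (v, 0) * dx (F f v)) := by
    intro f v
    rw [hX, Finset.sum_eq_single v]
    · rw [frechet_jet, if_pos rfl, ← C_1, act_C, one_mul]
    · intro w _ hw; rw [frechet_jet, if_neg hw.symm, ← C_0, act_C, zero_mul]
    · simp
  -- the variational derivative of the bracket
  have hbr : ∃ r, hamVF P f g = dx r - ∑ w, logVarD w g * dx (F f w) := by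
    have : ∀ w, ∃ r, act (frechet w g) (jet (w, 0) * dx (F f w)) =
        logVarD w g * dx (F f w) - dx r := by
      intro w
      obtain ⟨r, hr⟩ := exists_integrateX_eq (mulY (jet (w, 0) * dx (F f w)) (frechet w g))
      refine ⟨r, ?_⟩
      rw [integrateX_mulY] at hr
      rw [act, eq_sub_iff_add_eq, ← hr, logVarD, varD]; ring
    choose r hr using this
    refine ⟨∑ w, r w, ?_⟩
    rw [hX, Finset.sum_congr rfl fun w _ => hr w, Finset.sum_sub_distrib, map_sum]; ring
  -- Self-adjointness of the second variational derivative, rewritten for derivatives with respect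
  -- to `log u` and `log w`. The terms from differentiating the prefactors occur only for `u = w`
  -- and agree on both sides.
  have hlog : ∀ u w (a b : DiffFun K N), act (swap (frechet u (logVarD w a))) b * jet (u, 0) =
      act (frechet w (logVarD u a)) (jet (w, 0) * b) := by
    intro u w a b
    rw [logVarD, logVarD, frechet_mul, frechet_mul, swap_add, swap_smul, swap_smul, act_add_left,
      act_add_left, act_mulY, act_mulY, act_smul, act_smul, frechet_varD w u, swap_swap, frechet_jet,
      frechet_jet]
    by_cases huw : w = u
    · subst huw
      rw [if_pos rfl, ← C_1, swap_C, act_C, act_C]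
      rw [mul_comm b]; ring
    · rw [if_neg huw, if_neg (Ne.symm huw), ← C_0, swap_C, act_C, act_C, mul_comm b]; ring
  have hlog' : ∀ u w (a b : DiffFun K N), jet (u, 0) * act (swap (frechet u (dx (logVarD w a)))) b =
      -act (frechet w (logVarD u a)) (jet (w, 0) * dx b) := by
    intro u w a b
    rw [frechet_dx, swap_derivX, act_neg, act_X_mul, ← hlog]; ring
  have hF : ∀ v a b, ∑ w, act (frechet w (logVarD v a)) (jet (w, 0) * dx (F b w)) =
      -hamVF P b (logVarD v a) := by
    intro v a b; rw [hX, neg_neg]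
  -- The heart of the Jacobi identity: since the operator has constant coefficients, `δ{f,g} =
  -- X_f(δg) - X_g(δf)` in logarithmic coordinates.
  have hδ : ∀ v, logVarD v (hamVF P f g) =
      hamVF P f (logVarD v g) - hamVF P g (logVarD v f) := by
    intro v
    obtain ⟨r, hr⟩ := hbr
    have e1 : logVarD v (hamVF P f g) = -∑ w, ∑ u, η u w • (jet (v, 0) *
        (act (swap (frechet v (dx (logVarD u f)))) (logVarD w g) +
          act (swap (frechet v (logVarD w g))) (dx (logVarD u f)))) := by
      rw [logVarD, hr, sub_eq_add_neg, varD_add, varD_dx, zero_add, varD_neg, varD_sum, mul_neg,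
        Finset.mul_sum]
      congr 1
      refine Finset.sum_congr rfl fun w _ => ?_
      simp only [F, map_sum, Finset.mul_sum, varD_sum, Derivation.map_smul, mul_smul_comm, varD_smul,
        varD_mul]
    have e2 : logVarD v (hamVF P f g) =
        -∑ w, ∑ u, (η u w • act (frechet w (logVarD v g)) (jet (w, 0) * dx (logVarD u f)) -
          η w u • act (frechet u (logVarD v f)) (jet (u, 0) * dx (logVarD w g))) := by
      rw [e1]
      congr 1
      refine Finset.sum_congr rfl fun w _ => Finset.sum_congr rfl fun u _ => ?_
      rw [mul_add, hlog', mul_comm (jet (v, 0)), hlog, smul_add, smul_neg, hη w u]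
      ring
    have e3 : ∀ a b, ∑ w, ∑ u, η u w • act (frechet w (logVarD v a)) (jet (w, 0) * dx (logVarD u b)) =
        -hamVF P b (logVarD v a) := by
      intro a b
      rw [← hF]
      refine Finset.sum_congr rfl fun w _ => ?_
      simp only [F, map_sum, Finset.mul_sum, act_sum_right, Derivation.map_smul, mul_smul_comm]
      refine Finset.sum_congr rfl fun u _ => ?_
      rw [act_smul_right]
    rw [e2]
    simp only [Finset.sum_sub_distrib]
    rw [e3, Finset.sum_comm (f := fun w u => η w u • _), e3]; ring
  have hδF : ∀ w, F (hamVF P f g) w = hamVF P f (F g w) - hamVF P g (F f w) := by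
    intro w
    simp only [F, map_sum, Derivation.map_smul, hδ, smul_sub, Finset.sum_sub_distrib]
  -- Both sides commute with `∂`, so comparing them on the fields suffices. In the commutator the
  -- products of the two characteristics cancel and only `hδF` remains.
  have hD : hamVF P (hamVF P f g) = ⁅hamVF P f, hamVF P g⁆ := by
    refine derivation_ext_of_comm (hamVF_dx _ _) (fun f => ?_) fun v => ?_
    · simp only [Derivation.commutator_apply, hamVF_dx, map_sub]
    · rw [Derivation.commutator_apply, hjet, hjet, hjet, hδF]
      simp only [map_neg, Derivation.leibniz, hamVF_dx, hjet, map_sub, smul_eq_mul]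
      ring
  rw [hD, Derivation.commutator_apply]

end RatToda
end

open scoped LaurentSeries
noncomputable section
namespace RatToda
variable {K : Type*} [Field K] {N : ℕ}
open Kernel Polynomial

/-! ### Differential homomorphisms -/

/-- The differential endomorphism that sends the fields to `φ`. -/
def fieldHom (φ : Var N → DiffFun K N) (h : IsUnit (φ (Sum.inr (Fin.last N)))) :
    DiffFun K N →ₐ[K] DiffFun K N :=
  IsLocalization.liftAlgHom (M := Submonoid.powers (bTop K N))
    (f := MvPolynomial.aeval fun v : JetVar N => dx^[v.2] (φ v.1)) (by
      rintro ⟨_, n, rfl⟩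
      simpa using h.pow n)

lemma fieldHom_jet (φ : Var N → DiffFun K N) (h : IsUnit (φ (Sum.inr (Fin.last N))))
    (v : JetVar N) : fieldHom φ h (jet v) = dx^[v.2] (φ v.1) := by
  rw [fieldHom, jet, IsLocalization.liftAlgHom_apply, IsLocalization.lift_eq]
  simp

lemma fieldHom_dx (φ : Var N → DiffFun K N) (h : IsUnit (φ (Sum.inr (Fin.last N))))
    (f : DiffFun K N) : fieldHom φ h (dx f) = dx (fieldHom φ h f) := by
  rw [← sub_eq_zero]
  refine leibniz_eq_zero (fun f m => fieldHom φ h f * m) (fun m => by rw [map_one, one_mul])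
    (fun a b m => by rw [map_mul, mul_assoc]) (fun a => mul_zero _)
    (AddMonoidHom.mk' (fun f => fieldHom φ h (dx f) - dx (fieldHom φ h f)) ?_) ?_ ?_ ?_ f
  · intro a b
    simp only [map_add]; ring
  · intro a b
    simp only [AddMonoidHom.mk'_apply, Derivation.leibniz, smul_eq_mul, map_add, map_mul]; ring
  · intro r
    simp only [AddMonoidHom.mk'_apply, Derivation.map_algebraMap, map_zero, AlgHom.commutes, sub_self]
  · intro v
    simp only [AddMonoidHom.mk'_apply, dx_jet, fieldHom_jet, Function.iterate_succ_apply', sub_self]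

section Hom

variable (φ : DiffFun K N →ₐ[K] DiffFun K N)

/-- A homomorphism applied to the coefficients of a kernel. -/
def kmap (A : Kernel K N) : Kernel K N := A.map (φ : DiffFun K N →+* DiffFun K N)

lemma kmap_add (A B : Kernel K N) : kmap φ (A + B) = kmap φ A + kmap φ B := Polynomial.map_add _

lemma kmap_sub (A B : Kernel K N) : kmap φ (A - B) = kmap φ A - kmap φ B := Polynomial.map_sub _

lemma kmap_neg (A : Kernel K N) : kmap φ (-A) = -kmap φ A := Polynomial.map_neg _

lemma kmap_zero : kmap φ 0 = 0 := Polynomial.map_zero _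

lemma kmap_sum {ι : Type*} (s : Finset ι) (A : ι → Kernel K N) :
    kmap φ (∑ i ∈ s, A i) = ∑ i ∈ s, kmap φ (A i) := Polynomial.map_sum _ _ _

lemma kmap_smul (f : DiffFun K N) (A : Kernel K N) : kmap φ (f • A) = φ f • kmap φ A :=
  Polynomial.map_smul _ _

lemma kmap_smul' (r : K) (A : Kernel K N) : kmap φ (r • A) = r • kmap φ A := by
  rw [algebra_smul_eq, kmap_smul, AlgHom.commutes, ← algebra_smul_eq]

lemma kmap_monomial (k : ℕ) (f : DiffFun K N) :
    kmap φ (monomial k f) = monomial k (φ f) := Polynomial.map_monomial _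

lemma kmap_X_mul (A : Kernel K N) : kmap φ (X * A) = X * kmap φ A := by
  rw [kmap, Polynomial.map_mul, map_X]; rfl

lemma kmap_injective (h : Function.Injective φ) : Function.Injective (kmap φ) :=
  Polynomial.map_injective _ h

lemma kmap_derivY (A : Kernel K N) : kmap φ (derivY A) = derivY (kmap φ A) := by
  rw [derivY, kmap_neg, kmap_X_mul]; rfl

variable {φ} (hφ : ∀ f, φ (dx f) = dx (φ f))
include hφ

lemma map_dx_iterate (k : ℕ) (f : DiffFun K N) : φ (dx^[k] f) = dx^[k] (φ f) := by
  induction k with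
  | zero => rfl
  | succ k ih => rw [Function.iterate_succ_apply', hφ, ih, Function.iterate_succ_apply']

lemma kmap_derivX (A : Kernel K N) : kmap φ (derivX A) = derivX (kmap φ A) := by
  induction A using Polynomial.induction_on' with
  | add p q hp hq => simp only [derivX_add, kmap_add, hp, hq]
  | monomial k c => simp only [derivX_monomial, kmap_add, kmap_monomial, hφ]

lemma kmap_derivX_iterate (k : ℕ) (A : Kernel K N) :
    kmap φ (derivX^[k] A) = derivX^[k] (kmap φ A) := by
  induction k with
  | zero => rfl
  | succ k ih => rw [Function.iterate_succ_apply', kmap_derivX hφ, ih, Function.iterate_succ_apply']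

lemma kmap_mulY (g : DiffFun K N) (A : Kernel K N) :
    kmap φ (mulY g A) = mulY (φ g) (kmap φ A) := by
  rw [mulY_eq_comp, mulY_eq_comp]
  induction A using Polynomial.induction_on' with
  | add p q hp hq => simp only [opComp_add_left, kmap_add, hp, hq]
  | monomial k c =>
    rw [opComp_monomial, kmap_smul, kmap_monomial, opComp_monomial, kmap_derivX_iterate hφ]
    congr 2
    exact Polynomial.map_C _

lemma kmap_xy (f g : DiffFun K N) : kmap φ (xy f g) = xy (φ f) (φ g) := by
  rw [xy_eq, xy_eq, kmap_smul, kmap_mulY hφ, kmap, map_X]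

lemma map_integrateX (A : Kernel K N) : φ (integrateX A) = integrateX (kmap φ A) := by
  induction A using Polynomial.induction_on' with
  | add p q hp hq => simp only [integrateX_add, kmap_add, map_add, hp, hq]
  | monomial k c => simp [kmap_monomial, integrateX_monomial, map_dx_iterate hφ]

lemma kmap_swap (A : Kernel K N) : kmap φ (swap A) = swap (kmap φ A) := by
  induction A using Polynomial.induction_on' with
  | add p q hp hq => simp only [swap_add, kmap_add, hp, hq]
  | monomial k c =>
    rw [← C_mul_X_pow_eq_monomial, ← smul_eq_C_mul, swap_smul, kmap_mulY hφ, kmap_smul, swap_smul]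
    congr 1
    induction k with
    | zero => rw [pow_zero, ← C_1, swap_C]; simp [kmap, swap_C, -map_one]
    | succ k ih => rw [pow_succ', swap_X_mul, kmap_neg, kmap_derivX hφ, ih, kmap_X_mul, swap_X_mul]

/-- A differential homomorphism that intertwines two brackets of the fields intertwines the
brackets of all differential functions. -/
lemma localBracket_map {P P' : Bracket K N}
    (h : ∀ v w, localBracket P' (φ (jet (v, 0))) (φ (jet (w, 0))) = kmap φ (P v w))
    (f g : DiffFun K N) : localBracket P' (φ f) (φ g) = kmap φ (localBracket P f g) := by
  have h1 : ∀ w (f : DiffFun K N), localBracket P' (φ f) (φ (jet (w, 0))) =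
      kmap φ (localBracket P f (jet (w, 0))) := by
    intro w f
    rw [← sub_eq_zero]
    refine leibniz_eq_zero (fun f (m : Kernel K N) => φ f • m) (by simp) (by simp [mul_smul])
      (by simp) (AddMonoidHom.mk' (fun f => localBracket P' (φ f) (φ (jet (w, 0))) -
        kmap φ (localBracket P f (jet (w, 0)))) ?_) ?_ ?_ ?_ f
    · intro a b
      rw [map_add, localBracket_add_left, localBracket_add_left, kmap_add]; abel
    · intro a b
      simp only [AddMonoidHom.mk'_apply, map_mul, localBracket_mul_left, kmap_add, kmap_smul,
        smul_sub]
      abel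
    · intro r
      simp only [AddMonoidHom.mk'_apply, AlgHom.commutes, localBracket_algebraMap_left, kmap_zero,
        sub_self]
    · rintro ⟨v, s⟩
      simp only [AddMonoidHom.mk'_apply, sub_eq_zero]
      induction s with
      | zero => rw [h, localBracket_jet]
      | succ s ih => rw [← dx_jet (v, s), hφ, localBracket_dx_left, localBracket_dx_left,
          kmap_derivX hφ, ih]
  rw [← sub_eq_zero]
  refine leibniz_eq_zero (fun g (m : Kernel K N) => mulY (φ g) m) ?_ ?_ ?_
    (AddMonoidHom.mk' (fun g => localBracket P' (φ f) (φ g) -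
      kmap φ (localBracket P f g)) ?_) ?_ ?_ ?_ g
  · intro m; rw [map_one, mulY_eq_comp, C_1, opComp_one]
  · intro a b m; rw [map_mul, mulY_mulY]
  · intro a; rw [mulY_eq_comp, opComp_zero_left]
  · intro a b
    rw [map_add, localBracket_add_right, localBracket_add_right, kmap_add]; abel
  · intro a b
    simp only [AddMonoidHom.mk'_apply, map_mul, localBracket_mul_right, kmap_add, kmap_mulY hφ,
      sub_eq_add_neg, mulY_add]
    simp only [mulY_eq_comp, opComp_neg_left]
    abel
  · intro r
    simp only [AddMonoidHom.mk'_apply, AlgHom.commutes, localBracket_algebraMap_right, kmap_zero,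
      sub_self]
  · rintro ⟨v, s⟩
    simp only [AddMonoidHom.mk'_apply, sub_eq_zero]
    induction s with
    | zero => exact h1 v f
    | succ s ih => rw [← dx_jet (v, s), hφ, localBracket_dx_right, localBracket_dx_right,
        kmap_derivY, ih]

lemma functionalBracket_map {P P' : Bracket K N}
    (h : ∀ v w, localBracket P' (φ (jet (v, 0))) (φ (jet (w, 0))) = kmap φ (P v w))
    (f g : DiffFun K N) : functionalBracket P' (φ f) (φ g) = φ (functionalBracket P f g) := by
  rw [functionalBracket, localBracket_map hφ h, functionalBracket, map_integrateX hφ]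

/-- Used for the embedding into functions of zeros and poles: an identity that holds for the images
holds for the original functions. -/
lemma StrongJacobi.comap {P P' : Bracket K N}
    (h : ∀ v w, localBracket P' (φ (jet (v, 0))) (φ (jet (w, 0))) = kmap φ (P v w))
    (hinj : Function.Injective φ) (hJ : StrongJacobi P') : StrongJacobi P := by
  intro f g k
  apply hinj
  simp only [map_sub, ← functionalBracket_map hφ h]
  exact hJ _ _ _

/-- Used for the invertible substitution `z ↦ z + ε`: every function is an image, so the identity is
inherited from the source. -/
lemma StrongJacobi.map {P P' : Bracket K N}
    (h : ∀ v w, localBracket P' (φ (jet (v, 0))) (φ (jet (w, 0))) = kmap φ (P v w))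
    (hsurj : Function.Surjective φ) (hJ : StrongJacobi P) : StrongJacobi P' := by
  intro f g k
  obtain ⟨f, rfl⟩ := hsurj f
  obtain ⟨g, rfl⟩ := hsurj g
  obtain ⟨k, rfl⟩ := hsurj k
  simp only [functionalBracket_map hφ h, ← map_sub]
  rw [hJ]

end Hom

instance : IsDomain (DiffFun K N) :=
  IsLocalization.isDomain_localization (M := Submonoid.powers (bTop K N))
    (powers_le_nonZeroDivisors_of_noZeroDivisors (MvPolynomial.X_ne_zero _))

/-- Chain rule for differential homomorphisms. -/
lemma partialD_hom (φ : DiffFun K N →ₐ[K] DiffFun K N) {n : ℕ} {f : DiffFun K N}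
    (hn : ∀ v s, n ≤ s → partialD (v, s) f = 0) (w : JetVar N) :
    partialD w (φ f) = ∑ v : Var N, ∑ s ∈ Finset.range n,
      φ (partialD (v, s) f) * partialD w (φ (jet (v, s))) := by
  -- Both sides are derivations along `φ` that agree on jet variables. The sum runs over all jet
  -- variables because no bound on the order holds for every `f` at once.
  have key : ∀ f : DiffFun K N, partialD w (φ f) -
      ∑ᶠ v : JetVar N, φ (partialD v f) * partialD w (φ (jet v)) = 0 := by
    have hfin : ∀ f : DiffFun K N, (Function.support fun v : JetVar N =>
        φ (partialD v f) * partialD w (φ (jet v))).Finite := fun f =>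
      (partialD_finite f).subset fun v hv h => hv (by simp [h])
    refine leibniz_eq_zero (fun f m => φ f * m) (by simp) (by simp [mul_assoc]) (by simp)
      (AddMonoidHom.mk' (fun f => partialD w (φ f) -
        ∑ᶠ v : JetVar N, φ (partialD v f) * partialD w (φ (jet v))) ?_) ?_ ?_ ?_
    · intro a b
      simp only [map_add, add_mul]
      rw [finsum_add_distrib (hfin a) (hfin b)]; ring
    · intro a b
      simp only [AddMonoidHom.mk'_apply, map_mul, Derivation.leibniz, smul_eq_mul, map_add, add_mul,
        mul_assoc]
      rw [finsum_add_distrib, ← mul_finsum, ← mul_finsum]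
      · ring
      · exact (hfin b).subset fun v hv h => hv (by
          dsimp only at h ⊢
          rw [h, mul_zero])
      · exact (hfin a).subset fun v hv h => hv (by
          dsimp only at h ⊢
          rw [h, mul_zero])
    · intro r
      simp
    · intro v
      simp only [AddMonoidHom.mk'_apply]
      rw [finsum_eq_single _ v]
      · simp [partialD_jet]
      · intro u hu; rw [partialD_jet, if_neg hu.symm]; simp
  rw [sub_eq_zero.mp (key f), finsum_eq_sum_of_support_subset _
      (s := (Finset.univ : Finset (Var N)) ×ˢ Finset.range n), Finset.sum_product]
  rintro ⟨v, s⟩ hx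
  simp only [Finset.coe_product, Finset.coe_univ, Finset.coe_range, Set.mem_prod, Set.mem_univ,
    Set.mem_Iio, true_and]
  by_contra h
  exact hx (by simp only [hn v s (not_lt.mp h), map_zero, zero_mul])

/-- A function of the fields only, not of their derivatives. -/
def OrderZero (f : DiffFun K N) : Prop := ∀ v s, partialD (v, s + 1) f = 0

lemma OrderZero.frechet_eq {f : DiffFun K N} (h : OrderZero f) (v : Var N) :
    frechet v f = C (partialD (v, 0) f) := by
  rw [frechet_eq_sum (n := 1), Finset.sum_range_one, monomial_zero_left]
  intro v s hs
  obtain ⟨t, rfl⟩ := Nat.exists_eq_add_of_le' hs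
  exact h v t

lemma OrderZero.partialD_dx_iterate_of_lt {f : DiffFun K N} (h : OrderZero f) (v : Var N) {r s : ℕ}
    (hrs : r < s) : partialD (v, s) (dx^[r] f) = 0 := by
  induction r generalizing s with
  | zero =>
    obtain ⟨t, rfl⟩ := Nat.exists_eq_add_of_le' hrs
    exact h v t
  | succ r ih =>
    obtain ⟨t, rfl⟩ := Nat.exists_eq_add_of_le' (Nat.one_le_of_lt hrs)
    rw [Function.iterate_succ_apply', partialD_succ_dx, ih (by omega), ih (by omega), map_zero,
      add_zero]

lemma OrderZero.partialD_dx_iterate {f : DiffFun K N} (h : OrderZero f) (v : Var N) (r : ℕ) :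
    partialD (v, r) (dx^[r] f) = partialD (v, 0) f := by
  induction r with
  | zero => rfl
  | succ r ih =>
    rw [Function.iterate_succ_apply', partialD_succ_dx, ih,
      h.partialD_dx_iterate_of_lt v (Nat.lt_succ_self r), map_zero, zero_add]

/-- A differential homomorphism is injective if the images of the fields are functions of the
fields with nondegenerate Jacobian matrix. -/
lemma hom_injective [CharZero K] {φ : DiffFun K N →ₐ[K] DiffFun K N}
    (hφ : ∀ f, φ (dx f) = dx (φ f)) (h0 : ∀ v, OrderZero (φ (jet (v, 0))))
    (hdet : ∀ y : Var N → DiffFun K N,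
      (∀ w, ∑ v, y v * partialD (w, 0) (φ (jet (v, 0))) = 0) → y = 0) :
    Function.Injective φ := by
  -- The kernel is stable under partial derivatives, by descending induction on the jet order `s`.
  -- In `∂φ(f)/∂w^{(s)}` the jets of order below `s` do not contribute, those above `s` vanish by
  -- induction, and those of order `s` enter through the Jacobian matrix.
  have hker : ∀ f, φ f = 0 → ∀ v, φ (partialD v f) = 0 := by
    intro f hf
    obtain ⟨n, hn⟩ := exists_order f
    have : ∀ m, ∀ v s, n ≤ s + m → φ (partialD (v, s) f) = 0 := by
      intro m
      induction m with
      | zero => intro v s hs; rw [hn v s hs, map_zero]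
      | succ m ih =>
        intro v s hs
        rcases Nat.lt_or_ge s n with hsn | hsn
        swap
        · rw [hn v s hsn, map_zero]
        have hy : (fun v => φ (partialD (v, s) f)) = 0 := by
          apply hdet
          intro w
          have h1 := partialD_hom φ hn (w, s)
          rw [hf, map_zero] at h1
          rw [h1]
          refine Finset.sum_congr rfl fun v _ => ?_
          rw [Finset.sum_eq_single s]
          · rw [← dx_iterate_jet v s, map_dx_iterate hφ, (h0 v).partialD_dx_iterate]
          · intro t _ hts
            rcases lt_or_gt_of_ne hts with h | h
            · rw [← dx_iterate_jet v t, map_dx_iterate hφ, (h0 v).partialD_dx_iterate_of_lt w h,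
                mul_zero]
            · rw [ih v t (by omega), zero_mul]
          · intro h; exact absurd (Finset.mem_range.mpr hsn) h
        exact congrFun hy v
    rintro ⟨v, s⟩
    exact this n v s (by omega)
  -- Induction on the degree. The partial derivatives of a polynomial in the kernel are again in the
  -- kernel and have smaller degree, so they vanish; in characteristic zero this rules out all
  -- nonconstant monomials.
  have hpoly : ∀ n, ∀ p : JetPoly K N, (∀ m, p.coeff m ≠ 0 → m.degree ≤ n) →
      φ (algebraMap _ _ p) = 0 → p = 0 := by
    intro n
    induction n with
    | zero =>
      intro p hp h
      have hC : p = MvPolynomial.C (p.coeff 0) := by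
        ext m
        rw [MvPolynomial.coeff_C]
        split_ifs with hm
        · rw [hm]
        · by_contra hne
          exact hm ((Finsupp.degree_eq_zero_iff m).mp (Nat.le_zero.mp (hp m hne))).symm
      rw [hC, algebraMap_C, AlgHom.commutes, FaithfulSMul.algebraMap_eq_zero_iff] at h
      rw [hC, h, map_zero]
    | succ n ih =>
      intro p hp h
      have hpd : ∀ v, MvPolynomial.pderiv v p = 0 := by
        intro v
        apply ih
        · intro m hm
          rw [MvPolynomial.coeff_pderiv] at hm
          have := hp _ (left_ne_zero_of_mul hm)
          rw [map_add, Finsupp.degree_single] at this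
          omega
        · have := hker _ h v
          rwa [partialD, extDer_algebraMap] at this
      refine ih p (fun m hm => ?_) h
      by_contra hlt
      have hm0 : m ≠ 0 := by rintro rfl; simp at hlt
      obtain ⟨v, hv⟩ := Finsupp.ne_iff.mp hm0
      have h1 := MvPolynomial.coeff_pderiv (i := v) p (m - Finsupp.single v 1)
      rw [hpd, MvPolynomial.coeff_zero, tsub_add_cancel_of_le
        (by rw [Finsupp.single_le_iff]; exact Nat.one_le_iff_ne_zero.mpr hv)] at h1
      rcases mul_eq_zero.mp h1.symm with h2 | h2
      · exact hm h2
      · exact Nat.cast_add_one_ne_zero _ h2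
  rw [injective_iff_map_eq_zero]
  intro f hf
  obtain ⟨p, s, hs, h⟩ := exists_mul_eq f
  have hp : p = 0 := hpoly _ p (fun m hm => MvPolynomial.le_totalDegree (MvPolynomial.mem_support_iff.mpr hm)) (by rw [← h, map_mul, hf, zero_mul])
  rw [hp, map_zero] at h
  exact (IsLocalization.map_units (DiffFun K N) ⟨s, hs⟩).mul_left_eq_zero.mp h

end RatToda
end

open scoped LaurentSeries
noncomputable section
namespace RatToda
variable {K : Type*} [Field K] {N : ℕ}
open Kernel Polynomial

/-! ### Coefficients of products of linear factors -/

/-- The coefficients `f k` of a product `∏_j (w - β_j)^{ε_j}`, times a factor that does not depend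
on the roots, and the coefficients `h j` of its partial derivatives with respect to the roots. -/
structure RootSeq {J : Type*} [Fintype J] (β ε : J → DiffFun K N) (h : J → ℤ → DiffFun K N)
    (f : ℤ → DiffFun K N) (d κ : DiffFun K N) : Prop where
  sq : ∀ j, ε j * ε j = 1
  dx_eps : ∀ j, dx (ε j) = 0
  dx_deg : dx d = 0
  -- The coefficient of `w^k` in `(w - β_j) ∂_j F = -ε_j F`.
  rec' : ∀ j k, h j (k - 1) = β j * h j k - ε j * f k
  -- `F` is homogeneous of degree `d` in the roots and `w` together.
  euler : ∀ k, ∑ j, β j * h j k = (d - k) * f k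
  -- The chain rule; `κ` is the logarithmic derivative of the factor that does not depend on the
  -- roots.
  chain : ∀ k, ∑ j, dx (β j) * h j k = dx (f k) - κ * f k

namespace RootSeq

variable {J : Type*} [Fintype J] {β ε : J → DiffFun K N} {h : J → ℤ → DiffFun K N}
  {f : ℤ → DiffFun K N} {d κ : DiffFun K N}

/-- By the recursion and `ε_j² = 1`, the terms quadratic in the `h_j` cancel when the indices move
apart by one. The sums that remain are linear and are evaluated by Euler's identity. -/
lemma sum_prod_diff (H : RootSeq β ε h f d κ) (k l : ℤ) :
    ∑ j, ε j * ((β j * h j k) * (β j * h j (l - 1))) -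
      ∑ j, ε j * ((β j * h j (k - 1)) * (β j * h j l)) =
    (d - l + 1) * (f k * f (l - 1)) - (d - k + 1) * (f (k - 1) * f l) := by
  have e : ∀ j, ε j * ((β j * h j k) * (β j * h j (l - 1))) -
      ε j * ((β j * h j (k - 1)) * (β j * h j l)) =
      f k * (β j * h j (l - 1)) - f l * (β j * h j (k - 1)) := by
    intro j
    rw [H.rec' j k, H.rec' j l]
    linear_combination (β j * β j * (f k * h j l - h j k * f l)) * H.sq j
  rw [← Finset.sum_sub_distrib, Finset.sum_congr rfl fun j _ => e j, Finset.sum_sub_distrib,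
    ← Finset.mul_sum, ← Finset.mul_sum, H.euler, H.euler]
  push_cast; ring

/-- The auxiliary quadratic expression that enters the differences of `∑_j ε_j y_j ∂ y_j`. -/
def aux (_ : RootSeq β ε h f d κ) (k l : ℤ) : DiffFun K N :=
  ∑ j, ε j * dx (β j) * (β j * β j) * (h j k * h j l) - f k * f l * ∑ j, ε j * dx (β j) +
    κ * (f k * f (l - 1) + f (k - 1) * f l)

/-- The auxiliary sum cannot be expressed by the coefficients alone, but its differences can, by the
chain rule. The terms with `κ` in its definition cancel those that the chain rule produces. -/
lemma aux_diff (H : RootSeq β ε h f d κ) (k l : ℤ) :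
    H.aux k (l - 1) - H.aux (k - 1) l = f k * dx (f (l - 2)) - f l * dx (f (k - 2)) := by
  have e : ∀ j, ε j * dx (β j) * (β j * β j) * (h j k * h j (l - 1)) -
      ε j * dx (β j) * (β j * β j) * (h j (k - 1) * h j l) =
      f k * (dx (β j) * h j (l - 2)) - f l * (dx (β j) * h j (k - 2)) +
        (f k * f (l - 1) - f l * f (k - 1)) * (ε j * dx (β j)) := by
    intro j
    have h1 := H.rec' j (l - 1)
    have h2 := H.rec' j (k - 1)
    rw [show l - 1 - 1 = l - 2 by ring] at h1
    rw [show k - 1 - 1 = k - 2 by ring] at h2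
    rw [h1, h2, H.rec' j k, H.rec' j l]
    linear_combination (dx (β j) * β j * β j * (f k * h j l - h j k * f l)) * H.sq j
  have s : ∑ j, ε j * dx (β j) * (β j * β j) * (h j k * h j (l - 1)) -
      ∑ j, ε j * dx (β j) * (β j * β j) * (h j (k - 1) * h j l) =
      f k * (dx (f (l - 2)) - κ * f (l - 2)) - f l * (dx (f (k - 2)) - κ * f (k - 2)) +
        (f k * f (l - 1) - f l * f (k - 1)) * ∑ j, ε j * dx (β j) := by
    rw [← Finset.sum_sub_distrib, Finset.sum_congr rfl fun j _ => e j, Finset.sum_add_distrib,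
      Finset.sum_sub_distrib, ← Finset.mul_sum, ← Finset.mul_sum, ← Finset.mul_sum, H.chain, H.chain]
  rw [aux, aux, show l - 1 - 1 = l - 2 by ring, show k - 1 - 1 = k - 2 by ring]
  linear_combination s

/-- Unlike in `sum_prod_diff`, one term quadratic in the `h_j` survives, collected in `aux`. The
coefficient of `δ` therefore needs two nested telescoping sums, whence the weights growing linearly
in the summation index. -/
lemma sum_deriv_diff (H : RootSeq β ε h f d κ) (k l : ℤ) :
    ∑ j, ε j * ((β j * h j k) * dx (β j * h j (l - 1))) -
      ∑ j, ε j * ((β j * h j (k - 1)) * dx (β j * h j l)) =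
    (d - l) * (f k * dx (f (l - 1))) - (d - k + 1) * (f (k - 1) * dx (f l)) -
      f l * dx (f (k - 1)) + H.aux k l := by
  have e : ∀ j, ε j * ((β j * h j k) * dx (β j * h j (l - 1))) -
      ε j * ((β j * h j (k - 1)) * dx (β j * h j l)) =
      f k * dx (β j * h j (l - 1)) - dx (f l) * (β j * h j (k - 1)) -
        f k * (dx (β j) * h j (l - 1)) - f l * (dx (β j) * h j (k - 1)) -
        f k * f l * (ε j * dx (β j)) +
        ε j * dx (β j) * (β j * β j) * (h j k * h j l) := by
    intro j
    rw [H.rec' j k, H.rec' j l]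
    simp only [Derivation.leibniz, map_sub, smul_eq_mul, H.dx_eps]
    have := H.sq j
    linear_combination (β j * β j * f k * dx (h j l) - β j * β j * h j k * dx (f l)
      + β j * f k * dx (β j) * h j l - β j * dx (β j) * f l * h j k) * H.sq j
  have hE : dx ((d - ((l - 1 : ℤ) : DiffFun K N)) * f (l - 1)) = (d - ((l - 1 : ℤ) : DiffFun K N)) * dx (f (l - 1)) := by
    rw [Derivation.leibniz, map_sub, H.dx_deg, Derivation.map_intCast]; simp
  rw [← Finset.sum_sub_distrib, Finset.sum_congr rfl fun j _ => e j]
  simp only [Finset.sum_add_distrib, Finset.sum_sub_distrib, ← Finset.mul_sum]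
  rw [← map_sum, H.euler, H.euler, H.chain, H.chain, hE, aux]
  push_cast; ring

end RootSeq

/-! ### Summation identities for the telescoping -/

section Telescope

variable {R : Type*} [CommRing R]

lemma telescope_sum {E r : ℕ → R} (h : ∀ i, E i = E (i + 1) + r i) (M : ℕ) :
    E 0 = E M + ∑ i ∈ Finset.range M, r i := by
  induction M with
  | zero => simp
  | succ M ih => rw [ih, h M, Finset.sum_range_succ]; ring

/-- Summation by parts: it sums a remainder `U` that is itself known only through its differences.
-/
lemma telescope_sum_sum {U r : ℕ → R} (h : ∀ i, U i = U (i + 1) + r i) (M : ℕ) :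
    ∑ i ∈ Finset.range M, U i = M * U M + ∑ i ∈ Finset.range M, (i + 1) * r i := by
  induction M with
  | zero => simp
  | succ M ih => rw [Finset.sum_range_succ, ih, h M, Finset.sum_range_succ]; push_cast; ring

lemma sum_add_succ (s : ℕ → R) (M : ℕ) : ∑ i ∈ Finset.range M, (s i + s (i + 1)) + s M =
    s 0 + ∑ i ∈ Finset.range M, 2 * s (i + 1) := by
  induction M with
  | zero => simp
  | succ M ih => rw [Finset.sum_range_succ, Finset.sum_range_succ]; linear_combination ih

/-- Pairs of neighbouring terms are collected into a sum over single indices. The initial term gets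
weight `c` and the others twice their weight, the origin of the halved diagonal term in the explicit
brackets. -/
lemma sum_weights_down (c : R) (p q : ℕ → R) (M : ℕ) :
    ∑ i ∈ Finset.range M, ((c - 2 * i - 2) * (p i + p (i + 1)) - 2 * q (i + 1)) +
      2 * ∑ i ∈ Finset.range M, (i + 1) * (p i - q (i + 2)) + c * p M + 2 * M * q (M + 1) =
    c * p 0 + ∑ i ∈ Finset.range M, (2 * (c - (i + 1)) * p (i + 1) - 2 * (i + 1) * q (i + 1)) := by
  induction M with
  | zero => simp
  | succ M ih =>
    simp only [Finset.sum_range_succ]; push_cast; linear_combination ih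

lemma sum_weights_up (c : R) (p q : ℕ → R) (M : ℕ) :
    ∑ i ∈ Finset.range M, ((c + 2 * i) * (p i + p (i + 1)) - 2 * q i) -
      2 * ∑ i ∈ Finset.range M, (i + 1) * (p (i + 2) - q i) =
    c * p 0 + ∑ i ∈ Finset.range M, (2 * (c + (i + 1)) * p (i + 1) + 2 * (i + 1) * q (i + 1))
      - c * p M - 2 * M * (p M + p (M + 1) + q M) := by
  induction M with
  | zero => simp
  | succ M ih =>
    simp only [Finset.sum_range_succ]; push_cast; linear_combination ih

end Telescope

namespace RootSeq

variable {J : Type*} [Fintype J] {β ε : J → DiffFun K N} {h : J → ℤ → DiffFun K N}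
  {f : ℤ → DiffFun K N} {d κ : DiffFun K N}

/-- The indices move along `(k - i, l + i)` until the first one is negative, where `f` and all `h_j`
vanish. -/
lemma sum_prod_down (H : RootSeq β ε h f d κ) (hf : ∀ k < 0, f k = 0) (hh : ∀ j, ∀ k < 0, h j k = 0)
    (k l : ℤ) (M : ℕ) (hM : k < M) :
    2 * ∑ j, ε j * ((β j * h j k) * (β j * h j l)) = (2 * d - k - l) * (f k * f l) +
      (k - l) * (f k * f l) + ∑ i ∈ Finset.range M,
        2 * ((k - l - 2 * (i + 1)) * (f (k - (i + 1)) * f (l + (i + 1)))) := by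
  -- The factor `2d - k - l` is constant along the path. Subtracting this multiple makes each
  -- difference the symmetric sum `s i + s (i + 1)`.
  let E : ℕ → DiffFun K N := fun i => 2 * ∑ j, ε j * ((β j * h j (k - i)) * (β j * h j (l + i))) -
    (2 * d - k - l) * (f (k - i) * f (l + i))
  let s : ℕ → DiffFun K N := fun i => (k - l - 2 * i) * (f (k - i) * f (l + i))
  have hE : ∀ i, E i = E (i + 1) + (s i + s (i + 1)) := by
    intro i
    have := H.sum_prod_diff (k - i) (l + i + 1)
    rw [show l + i + 1 - 1 = l + i by ring, show k - i - 1 = k - (i + 1) by ring,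
      show l + i + 1 = l + (i + 1) by ring] at this
    simp only [E, s]
    push_cast at this ⊢
    linear_combination 2 * this
  have h0 := telescope_sum hE M
  have h1 := sum_add_succ s M
  have hEM : E M = 0 := by simp [E, hf (k - M) (by omega), hh _ (k - M) (by omega)]
  have hsM : s M = 0 := by simp [s, hf (k - M) (by omega)]
  rw [hEM, zero_add] at h0
  rw [hsM, add_zero, ← h0] at h1
  simp only [E, s] at h1
  push_cast at h1
  simp only [sub_zero, add_zero, mul_zero] at h1
  linear_combination h1

/-- The same telescoping in the opposite direction, for a series such as `z` that has no powers of
`w` above the first. -/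
lemma sum_prod_up (H : RootSeq β ε h f d κ) (hf : ∀ k > 1, f k = 0) (hh : ∀ j, ∀ k > 1, h j k = 0)
    (k l : ℤ) (M : ℕ) (hM : 1 < k + M) :
    2 * ∑ j, ε j * ((β j * h j k) * (β j * h j l)) = (2 * d - k - l) * (f k * f l) -
      ((k - l) * (f k * f l) + ∑ i ∈ Finset.range M,
        2 * ((k - l + 2 * (i + 1)) * (f (k + (i + 1)) * f (l - (i + 1))))) := by
  let E : ℕ → DiffFun K N := fun i => -(2 * ∑ j, ε j * ((β j * h j (k + i)) * (β j * h j (l - i))) -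
    (2 * d - k - l) * (f (k + i) * f (l - i)))
  let s : ℕ → DiffFun K N := fun i => (k - l + 2 * i) * (f (k + i) * f (l - i))
  have hE : ∀ i, E i = E (i + 1) + (s i + s (i + 1)) := by
    intro i
    have := H.sum_prod_diff (k + (i + 1)) (l - i)
    rw [show l - i - 1 = l - (i + 1) by ring, show k + (i + 1) - 1 = k + i by ring] at this
    simp only [E, s]
    push_cast at this ⊢
    linear_combination 2 * this
  have h0 := telescope_sum hE M
  have h1 := sum_add_succ s M
  have hEM : E M = 0 := by simp [E, hf (k + M) (by omega), hh _ (k + M) (by omega)]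
  have hsM : s M = 0 := by simp [s, hf (k + M) (by omega)]
  rw [hEM, zero_add] at h0
  rw [hsM, add_zero, ← h0] at h1
  simp only [E, s] at h1
  push_cast at h1
  simp only [sub_zero, add_zero, mul_zero] at h1
  linear_combination -h1

lemma sum_deriv_down (H : RootSeq β ε h f d κ) (hf : ∀ k < 0, f k = 0)
    (hh : ∀ j, ∀ k < 0, h j k = 0) (k l : ℤ) (M : ℕ) (hM : k < M) :
    2 * ∑ j, ε j * ((β j * h j k) * dx (β j * h j l)) = (2 * d - k - l) * (f k * dx (f l)) +
      (k - l) * (f k * dx (f l)) + ∑ i ∈ Finset.range M,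
        2 * ((k - l - (i + 1)) * (f (k - (i + 1)) * dx (f (l + (i + 1)))) -
          (i + 1) * (dx (f (k - (i + 1))) * f (l + (i + 1)))) := by
  let E : ℕ → DiffFun K N := fun i =>
    2 * ∑ j, ε j * ((β j * h j (k - i)) * dx (β j * h j (l + i))) -
      (2 * d - k - l) * (f (k - i) * dx (f (l + i)))
  let p : ℕ → DiffFun K N := fun i => f (k - i) * dx (f (l + i))
  let q : ℕ → DiffFun K N := fun i => dx (f (k - i)) * f (l + i)
  -- The surviving quadratic term along the path. It is telescoped first, and its sum is then
  -- inserted into the telescoping of `E`.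
  let U : ℕ → DiffFun K N := fun i => H.aux (k - i) (l + i + 1)
  have hU : ∀ i, U i = U (i + 1) + (p i - q (i + 2)) := by
    intro i
    have := H.aux_diff (k - i) (l + i + 2)
    rw [show l + i + 2 - 1 = l + i + 1 by ring, show k - i - 1 = k - (i + 1) by ring,
      show l + i + 2 - 2 = l + i by ring, show k - i - 2 = k - (i + 2) by ring,
      show l + i + 2 = l + (i + 2) by ring] at this
    simp only [U, p, q]
    push_cast at this ⊢
    rw [show l + (i + 1) + 1 = l + ((i : ℤ) + 2) by ring]
    linear_combination this
  have hE : ∀ i, E i = E (i + 1) + ((((k - l : ℤ) : DiffFun K N) - 2 * i - 2) * (p i + p (i + 1))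
      - 2 * q (i + 1) + 2 * U i) := by
    intro i
    have := H.sum_deriv_diff (k - i) (l + i + 1)
    simp only [E, p, q, U]
    rw [show l + i + 1 - 1 = l + i by ring, show k - i - 1 = k - (i + 1) by ring,
      show l + i + 1 = l + (i + 1) by ring] at this
    push_cast at this ⊢
    rw [show l + i + 1 = l + ((i : ℤ) + 1) by ring]
    linear_combination 2 * this
  have h0 := telescope_sum hE M
  have h1 := telescope_sum_sum hU M
  have h2 := sum_weights_down ((k - l : ℤ) : DiffFun K N) p q M
  have hEM : E M = 0 := by simp [E, hf (k - M) (by omega), hh _ (k - M) (by omega)]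
  have hUM : U M = 0 := by
    simp [U, aux, hf (k - M) (by omega), hh _ (k - M) (by omega), hf (k - M - 1) (by omega)]
  have hpM : p M = 0 := by simp [p, hf (k - M) (by omega)]
  have hqM : q (M + 1) = 0 := by simp [q, hf (k - (M + 1)) (by omega)]
  rw [hUM, mul_zero, zero_add] at h1
  rw [hEM, zero_add, Finset.sum_add_distrib, ← Finset.mul_sum, h1] at h0
  rw [hpM, hqM, mul_zero, mul_zero, add_zero, add_zero, ← h0] at h2
  simp only [E, p, q] at h2
  push_cast at h2
  simp only [sub_zero, add_zero] at h2
  have e : ∀ i : ℕ, 2 * ((k - l - (i + 1) : DiffFun K N) * (f (k - (i + 1)) * dx (f (l + (i + 1)))) -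
          (i + 1) * (dx (f (k - (i + 1))) * f (l + (i + 1)))) =
      2 * (k - l - (i + 1)) * (f (k - (i + 1)) * dx (f (l + (i + 1)))) -
          2 * (i + 1) * (dx (f (k - (i + 1))) * f (l + (i + 1))) := fun i => by ring
  rw [Finset.sum_congr rfl fun i _ => e i]
  linear_combination h2

lemma sum_deriv_up (H : RootSeq β ε h f d κ) (hf : ∀ k > 1, f k = 0)
    (hh : ∀ j, ∀ k > 1, h j k = 0) (k l : ℤ) (M : ℕ) (hM : 1 < k + M) :
    2 * ∑ j, ε j * ((β j * h j k) * dx (β j * h j l)) = (2 * d - k - l) * (f k * dx (f l)) -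
      ((k - l) * (f k * dx (f l)) + ∑ i ∈ Finset.range M,
        2 * ((k - l + (i + 1)) * (f (k + (i + 1)) * dx (f (l - (i + 1)))) +
          (i + 1) * (dx (f (k + (i + 1))) * f (l - (i + 1))))) := by
  let E : ℕ → DiffFun K N := fun i =>
    -(2 * ∑ j, ε j * ((β j * h j (k + i)) * dx (β j * h j (l - i))) -
      (2 * d - k - l) * (f (k + i) * dx (f (l - i))))
  let p : ℕ → DiffFun K N := fun i => f (k + i) * dx (f (l - i))
  let q : ℕ → DiffFun K N := fun i => dx (f (k + i)) * f (l - i)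
  let U : ℕ → DiffFun K N := fun i => H.aux (k + i + 1) (l - i)
  have hU : ∀ i, U i = U (i + 1) + -(p (i + 2) - q i) := by
    intro i
    have := H.aux_diff (k + i + 2) (l - i)
    rw [show k + i + 2 - 1 = k + i + 1 by ring, show l - i - 1 = l - (i + 1) by ring,
      show k + i + 2 - 2 = k + i by ring, show l - i - 2 = l - (i + 2) by ring,
      show k + i + 2 = k + (i + 2) by ring] at this
    simp only [U, p, q]
    push_cast at this ⊢
    rw [show k + (i + 1) + 1 = k + ((i : ℤ) + 2) by ring]
    linear_combination -this
  have hE : ∀ i, E i = E (i + 1) + ((((k - l : ℤ) : DiffFun K N) + 2 * i) * (p i + p (i + 1))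
      - 2 * q i + 2 * U i) := by
    intro i
    have := H.sum_deriv_diff (k + i + 1) (l - i)
    simp only [E, p, q, U]
    rw [show k + i + 1 - 1 = k + i by ring, show l - i - 1 = l - (i + 1) by ring,
      show k + i + 1 = k + (i + 1) by ring] at this
    push_cast at this ⊢
    rw [show k + i + 1 = k + ((i : ℤ) + 1) by ring]
    linear_combination 2 * this
  have h0 := telescope_sum hE M
  have h1 := telescope_sum_sum hU M
  have h2 := sum_weights_up ((k - l : ℤ) : DiffFun K N) p q M
  have hEM : E M = 0 := by simp [E, hf (k + M) (by omega), hh _ (k + M) (by omega)]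
  have hUM : U M = 0 := by
    simp [U, aux, hf (k + M + 1) (by omega), hh _ (k + M + 1) (by omega), hf (k + M) (by omega)]
  have hpM : p M = 0 := by simp [p, hf (k + M) (by omega)]
  have hpM' : p (M + 1) = 0 := by simp [p, hf (k + (M + 1)) (by omega)]
  have hqM : q M = 0 := by simp [q, hf (k + M) (by omega)]
  rw [hUM, mul_zero, zero_add] at h1
  simp only [mul_neg, Finset.sum_neg_distrib] at h1
  rw [hEM, zero_add, Finset.sum_add_distrib, ← Finset.mul_sum, h1, mul_neg, ← sub_eq_add_neg] at h0
  rw [hpM, hqM, hpM', ← h0] at h2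
  simp only [E, p, q] at h2
  push_cast at h2
  simp only [sub_zero, add_zero, mul_zero] at h2
  have e : ∀ i : ℕ, 2 * ((k - l + (i + 1) : DiffFun K N) * (f (k + (i + 1)) * dx (f (l - (i + 1)))) +
          (i + 1) * (dx (f (k + (i + 1))) * f (l - (i + 1)))) =
      2 * (k - l + (i + 1)) * (f (k + (i + 1)) * dx (f (l - (i + 1)))) +
          2 * (i + 1) * (dx (f (k + (i + 1))) * f (l - (i + 1))) := fun i => by ring
  rw [Finset.sum_congr rfl fun i _ => e i]
  linear_combination -h2

end RootSeq

end RatToda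
end

open scoped LaurentSeries
noncomputable section
namespace RatToda
variable {K : Type*} [Field K] {N : ℕ}
open Kernel

/-! ### Laurent series in `w⁻¹` -/

lemma wCoeff_add (f g : WSeries K N) (n : ℤ) : wCoeff (f + g) n = wCoeff f n + wCoeff g n := rfl

lemma wSeries_ext {f g : WSeries K N} (h : ∀ n, wCoeff f n = wCoeff g n) : f = g := by
  ext n
  have := h (-n)
  rwa [wCoeff, wCoeff, neg_neg] at this

lemma exists_wCoeff_bound (f : WSeries K N) : ∃ B : ℤ, ∀ n, B < n → wCoeff f n = 0 := by
  by_cases hf : f = 0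
  · exact ⟨0, fun n _ => by rw [hf]; rfl⟩
  · refine ⟨-f.order, fun n hn => HahnSeries.coeff_eq_zero_of_lt_order (by omega)⟩

lemma wCoeff_mul {f g : WSeries K N} {A B : ℤ} (hf : ∀ n, A < n → wCoeff f n = 0)
    (hg : ∀ n, B < n → wCoeff g n = 0) (n : ℤ) :
    wCoeff (f * g) n = ∑ i ∈ Finset.Icc (n - B) A, wCoeff f i * wCoeff g (n - i) := by
  rw [wCoeff, HahnSeries.coeff_mul]
  refine Finset.sum_of_injOn (fun ij => -ij.1) ?_ ?_ ?_ ?_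
  · rintro ⟨i, j⟩ hij ⟨i', j'⟩ hij' h
    simp only [Finset.mem_coe, Finset.mem_antidiagonal] at hij hij'
    have h0 : -i = -i' := h
    have h1 : i + j = -n := hij.2.2
    have h2 : i' + j' = -n := hij'.2.2
    refine Prod.ext ?_ ?_ <;> dsimp only <;> omega
  · rintro ⟨i, j⟩ hij
    simp only [Finset.mem_coe, Finset.mem_antidiagonal, HahnSeries.mem_support] at hij ⊢
    obtain ⟨h1, h2, h3⟩ := hij
    rw [Finset.mem_Icc]
    constructor
    · by_contra hlt
      apply h2
      have := hg (-j) (by omega)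
      rwa [wCoeff, neg_neg] at this
    · by_contra hlt
      apply h1
      have := hf (-i) (by omega)
      rwa [wCoeff, neg_neg] at this
  · intro i _ hi
    by_contra hne
    apply hi
    refine ⟨(-i, -(n - i)), ?_, by simp⟩
    simp only [Finset.mem_coe, Finset.mem_antidiagonal, HahnSeries.mem_support]
    exact ⟨left_ne_zero_of_mul hne, right_ne_zero_of_mul hne, by ring⟩
  · rintro ⟨i, j⟩ hij
    simp only [Finset.mem_antidiagonal] at hij
    have h1 := hij.2.2
    rw [wCoeff, wCoeff, neg_neg]
    congr 2
    simp only at h1 ⊢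
    omega

/-- An additive operator that satisfies the Leibniz rule. -/
structure IsLeibniz {R : Type*} [CommRing R] (D : R → R) : Prop where
  add : ∀ f g, D (f + g) = D f + D g
  mul : ∀ f g, D (f * g) = f * D g + g * D f

namespace IsLeibniz

variable {R : Type*} [CommRing R] {D : R → R} (hD : IsLeibniz D)
include hD

lemma one : D 1 = 0 := by simpa using hD.mul 1 1

lemma pow (f : R) (n : ℕ) : f * D (f ^ n) = n * (f ^ n * D f) := by
  induction n with
  | zero => simp [hD.one]
  | succ n ih =>
    rw [pow_succ, hD.mul]
    push_cast
    linear_combination f * ih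

lemma prod_eq_zero {ι : Type*} (s : Finset ι) (F : ι → R) (h : ∀ i ∈ s, D (F i) = 0) :
    D (∏ i ∈ s, F i) = 0 := by
  classical
  induction s using Finset.induction_on with
  | empty => simp [hD.one]
  | insert i s hi ih =>
    rw [Finset.prod_insert hi, hD.mul, h i (Finset.mem_insert_self _ _),
      ih fun j hj => h j (Finset.mem_insert_of_mem hj)]
    simp

lemma prod_eq_card {ι : Type*} (s : Finset ι) (F : ι → R) (h : ∀ i ∈ s, D (F i) = F i) :
    D (∏ i ∈ s, F i) = s.card * ∏ i ∈ s, F i := by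
  classical
  induction s using Finset.induction_on with
  | empty => simp [hD.one]
  | insert i s hi ih =>
    rw [Finset.prod_insert hi, hD.mul, h i (Finset.mem_insert_self _ _),
      ih fun j hj => h j (Finset.mem_insert_of_mem hj), Finset.card_insert_of_notMem hi]
    push_cast; ring

end IsLeibniz

/-- A coefficientwise operator satisfies the Leibniz rule as soon as it does so on products of
monomials in `w`. This covers `w ∂_w` and all derivations applied to coefficients. -/
lemma isLeibniz_of_wCoeff {D : WSeries K N → WSeries K N} (t : ℤ → DiffFun K N → DiffFun K N)
    (hD : ∀ f n, wCoeff (D f) n = t n (wCoeff f n)) (hadd : ∀ n x y, t n (x + y) = t n x + t n y)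
    (hmul : ∀ i j x y, t (i + j) (x * y) = x * t j y + y * t i x) : IsLeibniz D where
  add f g := wSeries_ext fun n => by
    rw [wCoeff_add, hD, hD, hD, wCoeff_add, hadd]
  mul f g := wSeries_ext fun n => by
    have h0 : ∀ n, t n 0 = 0 := fun n => by simpa using hadd n 0 0
    let t' : ℤ → DiffFun K N →+ DiffFun K N := fun n => ⟨⟨t n, h0 n⟩, hadd n⟩
    obtain ⟨A, hA⟩ := exists_wCoeff_bound f
    obtain ⟨B, hB⟩ := exists_wCoeff_bound g
    have hA' : ∀ m, A < m → wCoeff (D f) m = 0 := fun m hm => by rw [hD, hA m hm, h0]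
    have hB' : ∀ m, B < m → wCoeff (D g) m = 0 := fun m hm => by rw [hD, hB m hm, h0]
    rw [hD, wCoeff_add, wCoeff_mul hA hB, mul_comm g, wCoeff_mul hA hB', wCoeff_mul hA' hB,
      ← Finset.sum_add_distrib]
    refine (map_sum (t' n) _ _).trans (Finset.sum_congr rfl fun i _ => ?_)
    have := hmul i (n - i) (wCoeff f i) (wCoeff g (n - i))
    rw [add_sub_cancel] at this
    rw [hD, hD]
    change t n _ = _
    rw [this]; ring

lemma wCoeff_map (D : Derivation K (DiffFun K N) (DiffFun K N)) (f : WSeries K N) (n : ℤ) :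
    wCoeff (f.map D) n = D (wCoeff f n) := rfl

lemma isLeibniz_map (D : Derivation K (DiffFun K N) (DiffFun K N)) :
    IsLeibniz fun f : WSeries K N => f.map D :=
  isLeibniz_of_wCoeff (fun _ => D) (wCoeff_map D) (fun _ => map_add D) fun _ _ => D.leibniz

lemma isLeibniz_wdx : IsLeibniz (wdx : WSeries K N → WSeries K N) := isLeibniz_map dx

lemma wCoeff_wdw (f : WSeries K N) (n : ℤ) : wCoeff (wdw f) n = n * wCoeff f n := by
  change ((-(-n) : ℤ) : DiffFun K N) * f.coeff (-n) = _
  rw [neg_neg]; rfl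

lemma isLeibniz_wdw : IsLeibniz (wdw : WSeries K N → WSeries K N) :=
  isLeibniz_of_wCoeff (fun n x => n * x) wCoeff_wdw (fun _ => mul_add _) fun i j x y => by
    push_cast; ring

/-- The power `w^n` with a coefficient. -/
def wMon (n : ℤ) (x : DiffFun K N) : WSeries K N := HahnSeries.single (-n) x

lemma wCoeff_wMon (n : ℤ) (x : DiffFun K N) (m : ℤ) :
    wCoeff (wMon n x) m = if m = n then x else 0 := by
  classical
  rw [wCoeff, wMon, HahnSeries.coeff_single]
  simp only [neg_inj]

lemma wCoeff_wMon_mul (n : ℤ) (x : DiffFun K N) (f : WSeries K N) (m : ℤ) :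
    wCoeff (wMon n x * f) m = x * wCoeff f (m - n) := by
  rw [wCoeff, wMon, HahnSeries.coeff_single_mul, wCoeff]
  congr 2; ring

lemma wMon_mul_wMon (n m : ℤ) (x y : DiffFun K N) : wMon n x * wMon m y = wMon (n + m) (x * y) := by
  rw [wMon, wMon, HahnSeries.single_mul_single, wMon, neg_add]

lemma wMon_zero_one : wMon 0 (1 : DiffFun K N) = 1 := by rw [wMon, neg_zero]; rfl

/-- A linear factor `w - x`. -/
def lin (x : DiffFun K N) : WSeries K N := wMon 1 1 - wMon 0 x

lemma wCoeff_sub (f g : WSeries K N) (n : ℤ) : wCoeff (f - g) n = wCoeff f n - wCoeff g n := rfl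

lemma wCoeff_neg (f : WSeries K N) (n : ℤ) : wCoeff (-f) n = -wCoeff f n := rfl

lemma wCoeff_lin_mul (x : DiffFun K N) (f : WSeries K N) (n : ℤ) :
    wCoeff (lin x * f) n = wCoeff f (n - 1) - x * wCoeff f n := by
  rw [lin, sub_mul, wCoeff_sub, wCoeff_wMon_mul, wCoeff_wMon_mul, one_mul, sub_zero]

lemma map_wMon (D : Derivation K (DiffFun K N) (DiffFun K N)) (n : ℤ) (x : DiffFun K N) :
    (wMon n x).map D = wMon n (D x) := by
  refine wSeries_ext fun m => ?_
  rw [wCoeff_map, wCoeff_wMon, wCoeff_wMon]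
  split_ifs <;> simp

lemma map_lin (D : Derivation K (DiffFun K N) (DiffFun K N)) (x : DiffFun K N) :
    (lin x).map D = -wMon 0 (D x) := by
  refine wSeries_ext fun m => ?_
  rw [wCoeff_map, lin, wCoeff_sub, wCoeff_neg, wCoeff_wMon, wCoeff_wMon, wCoeff_wMon]
  split_ifs <;> simp

lemma wdw_lin (x : DiffFun K N) : wdw (lin x) = (wMon 1 1 : WSeries K N) := by
  refine wSeries_ext fun m => ?_
  rw [wCoeff_wdw, lin, wCoeff_sub, wCoeff_wMon, wCoeff_wMon]
  split_ifs with h1 h2 h2 <;> simp_all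

/-- A ring homomorphism applied to the coefficients. -/
def mapHom (φ : DiffFun K N →ₐ[K] DiffFun K N) : WSeries K N →+* WSeries K N where
  toFun f := f.map φ
  map_one' := by
    ext k
    simp only [HahnSeries.map_coeff, HahnSeries.coeff_one]
    split_ifs <;> simp
  map_zero' := by ext k; simp
  map_add' f g := by ext k; simp
  map_mul' f g := HahnSeries.map_mul ((φ : DiffFun K N →+* DiffFun K N) : DiffFun K N →ₙ+* DiffFun K N)

lemma wCoeff_mapHom (φ : DiffFun K N →ₐ[K] DiffFun K N) (f : WSeries K N) (n : ℤ) :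
    wCoeff (mapHom φ f) n = φ (wCoeff f n) := rfl

/-! ### Numerator and denominator -/

/-- The numerator `w^{N+1} + ∑ a_i w^i`. -/
def qSer : WSeries K N := wMon (N + 1) 1 * HahnSeries.ofPowerSeries ℤ _ numer

/-- The denominator `∑ b_i w^i`. -/
def pSer : WSeries K N := wMon N 1 * HahnSeries.ofPowerSeries ℤ _ denom

lemma wCoeff_ofPowerSeries (f : PowerSeries (DiffFun K N)) (n : ℤ) :
    wCoeff (HahnSeries.ofPowerSeries ℤ _ f) n =
      if n ≤ 0 then PowerSeries.coeff (-n).toNat f else 0 := by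
  rw [wCoeff]
  split_ifs with h
  · obtain ⟨m, hm⟩ := Int.eq_ofNat_of_zero_le (show 0 ≤ -n by omega)
    rw [hm, Int.toNat_natCast]
    exact HahnSeries.ofPowerSeries_apply_coeff f m
  · rw [HahnSeries.ofPowerSeries_apply]
    refine HahnSeries.embDomain_of_notMem_range ?_
    rintro ⟨m, hm⟩
    simp at hm
    omega

lemma a_of_gt {k : ℤ} (h : N + 1 < k) : (a k : DiffFun K N) = 0 := by
  rw [a, if_neg (by omega), dif_neg (by omega)]

lemma a_of_neg {k : ℤ} (h : k < 0) : (a k : DiffFun K N) = 0 := by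
  rw [a, if_neg (by omega), dif_neg (by omega)]

lemma a_top : (a ((N : ℤ) + 1) : DiffFun K N) = 1 := by rw [a, if_pos rfl]

lemma a_fin (k : Fin (N + 1)) : (a (k : ℕ) : DiffFun K N) = jet (Sum.inl k, 0) := by
  rw [a, if_neg (by omega), dif_pos (by omega)]
  rfl

lemma b_of_gt {k : ℤ} (h : N < k) : (b k : DiffFun K N) = 0 := by
  rw [b, dif_neg (by omega)]

lemma b_of_neg {k : ℤ} (h : k < 0) : (b k : DiffFun K N) = 0 := by
  rw [b, dif_neg (by omega)]

lemma b_fin (k : Fin (N + 1)) : (b (k : ℕ) : DiffFun K N) = jet (Sum.inr k, 0) := by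
  rw [b, dif_pos (by omega)]
  rfl

lemma wCoeff_qSer (k : ℤ) : wCoeff (qSer : WSeries K N) k = a k := by
  rw [qSer, wCoeff_wMon_mul, one_mul, wCoeff_ofPowerSeries]
  split_ifs with h
  · rw [numer, PowerSeries.coeff_mk]
    congr 1; omega
  · rw [a_of_gt (by omega)]

lemma wCoeff_pSer (k : ℤ) : wCoeff (pSer : WSeries K N) k = b k := by
  rw [pSer, wCoeff_wMon_mul, one_mul, wCoeff_ofPowerSeries]
  split_ifs with h
  · rw [denom, PowerSeries.coeff_mk]
    congr 1; omega
  · rw [b_of_gt (by omega)]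

lemma denom_mul_inv : denom * PowerSeries.invOfUnit denom bUnit = (1 : PowerSeries (DiffFun K N)) := by
  apply PowerSeries.mul_invOfUnit
  rw [denom, ← PowerSeries.coeff_zero_eq_constantCoeff_apply, PowerSeries.coeff_mk]
  have := b_fin (K := K) (Fin.last N)
  simp only [Fin.val_last] at this
  simp only [CharP.cast_eq_zero, sub_zero, this]
  rfl

/-- Since the denominator is a unit, this relation determines `z`. Statements about `z` below are
proved by cancelling the denominator, without using its expansion. -/
lemma pSer_mul_z : pSer * z = (qSer : WSeries K N) := by
  have h := congrArg (HahnSeries.ofPowerSeries ℤ (DiffFun K N)) (denom_mul_inv (K := K) (N := N))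
  rw [map_mul, map_one] at h
  have hm : wMon (N : ℤ) (1 : DiffFun K N) * wMon 1 1 = wMon (N + 1) 1 := by
    rw [wMon_mul_wMon, one_mul]
  rw [pSer, z, qSer, ← hm, map_mul]
  change wMon _ _ * _ * (wMon 1 1 * _) = _
  linear_combination (wMon (N : ℤ) (1 : DiffFun K N) * wMon 1 1 * HahnSeries.ofPowerSeries ℤ _ numer) * h

lemma isUnit_pSer : IsUnit (pSer : WSeries K N) := by
  rw [pSer]
  refine IsUnit.mul ?_ ?_
  · refine IsUnit.of_mul_eq_one (wMon (-N) 1) ?_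
    rw [wMon_mul_wMon, one_mul, add_neg_cancel, wMon_zero_one]
  · exact (IsUnit.of_mul_eq_one _ denom_mul_inv).map _

lemma u_of_gt {n : ℤ} (h : 1 < n) : (u n : DiffFun K N) = 0 := by
  rw [u, z]
  change wCoeff (wMon 1 1 * _) n = 0
  rw [wCoeff_wMon_mul, wCoeff_ofPowerSeries, if_neg (by omega), mul_zero]

lemma u_eq (n : ℤ) : wCoeff z n = (u n : DiffFun K N) := rfl

end RatToda
end

open scoped LaurentSeries
noncomputable section
namespace RatToda
variable {K : Type*} [Field K] {N : ℕ}
open Kernel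

/-! ### Products of linear factors -/

lemma wCoeff_one (n : ℤ) : wCoeff (1 : WSeries K N) n = if n = 0 then 1 else 0 := by
  rw [← wMon_zero_one, wCoeff_wMon]

lemma wCoeff_prod_lin_of_gt {J : Type*} (s : Finset J) (β : J → DiffFun K N) {n : ℤ}
    (h : s.card < n) : wCoeff (∏ j ∈ s, lin (β j)) n = 0 := by
  classical
  induction s using Finset.induction_on generalizing n with
  | empty =>
    rw [Finset.card_empty] at h
    rw [Finset.prod_empty, wCoeff_one, if_neg (by omega)]
  | insert i s hi ih =>
    rw [Finset.card_insert_of_notMem hi] at h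
    push_cast at h
    rw [Finset.prod_insert hi, wCoeff_lin_mul, ih (by omega), ih (by omega)]
    simp

lemma wCoeff_prod_lin_of_neg {J : Type*} (s : Finset J) (β : J → DiffFun K N) {n : ℤ}
    (h : n < 0) : wCoeff (∏ j ∈ s, lin (β j)) n = 0 := by
  classical
  induction s using Finset.induction_on generalizing n with
  | empty => rw [Finset.prod_empty, wCoeff_one, if_neg (by omega)]
  | insert i s hi ih =>
    rw [Finset.prod_insert hi, wCoeff_lin_mul, ih (by omega), ih (by omega)]
    simp

lemma wCoeff_prod_lin_card {J : Type*} (s : Finset J) (β : J → DiffFun K N) :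
    wCoeff (∏ j ∈ s, lin (β j)) s.card = 1 := by
  classical
  induction s using Finset.induction_on with
  | empty => rw [Finset.prod_empty, wCoeff_one, if_pos (by simp)]
  | insert i s hi ih =>
    rw [Finset.prod_insert hi, wCoeff_lin_mul, Finset.card_insert_of_notMem hi]
    push_cast
    rw [add_sub_cancel_right, ih, wCoeff_prod_lin_of_gt s β (by omega)]
    simp

lemma derivation_sum_smul_apply {J : Type*} (s : Finset J) (x : J → DiffFun K N)
    (D : J → Derivation K (DiffFun K N) (DiffFun K N)) (f : DiffFun K N) :
    (∑ j ∈ s, x j • D j) f = ∑ j ∈ s, x j * D j f := by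
  classical
  induction s using Finset.induction_on with
  | empty => simp
  | insert j s hj ih =>
    rw [Finset.sum_insert hj, Finset.sum_insert hj, Derivation.add_apply, ih]; rfl

/-- The root recursions for the coefficients of a Laurent series. -/
lemma rootSeq_of_series {J : Type*} [Fintype J] {β ε : J → DiffFun K N}
    {D : J → Derivation K (DiffFun K N) (DiffFun K N)} {F : WSeries K N} {d κ : DiffFun K N}
    (hε : ∀ j, ε j = 1 ∨ ε j = -1) (hd : dx d = 0)
    (hrec : ∀ j, lin (β j) * F.map (D j) = -(wMon 0 (ε j) * F))
    (heuler : F.map (∑ j, β j • D j) + wdw F = wMon 0 d * F)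
    (hchain : F.map (dx - ∑ j, dx (β j) • D j) = wMon 0 κ * F) :
    RootSeq β ε (fun j k => D j (wCoeff F k)) (wCoeff F) d κ where
  sq j := by rcases hε j with h | h <;> simp [h]
  dx_eps j := by rcases hε j with h | h <;> simp [h]
  dx_deg := hd
  rec' j k := by
    have := congrArg (wCoeff · k) (hrec j)
    simp only [wCoeff_lin_mul, wCoeff_neg, wCoeff_wMon_mul, wCoeff_map, sub_zero] at this
    linear_combination this
  euler k := by
    have := congrArg (wCoeff · k) heuler
    simp only [wCoeff_add, wCoeff_wMon_mul, wCoeff_map, sub_zero, wCoeff_wdw,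
      derivation_sum_smul_apply] at this
    linear_combination this
  chain k := by
    have := congrArg (wCoeff · k) hchain
    simp only [wCoeff_wMon_mul, wCoeff_map, sub_zero, Derivation.coe_sub, Pi.sub_apply,
      derivation_sum_smul_apply] at this
    linear_combination -this

/-- Derivatives with respect to the roots are independent when the roots are distinct. -/
lemma RootSeq.eq_zero_of_sum_eq_zero {J : Type*} [Fintype J] {β ε : J → DiffFun K N}
    {h : J → ℤ → DiffFun K N} {f : ℤ → DiffFun K N} {d κ : DiffFun K N}
    (H : RootSeq β ε h f d κ) (hβ : Function.Injective β) {T : ℤ} (hT : f T ≠ 0)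
    (hhT : ∀ j, h j T = 0) {x : J → DiffFun K N} (hx : ∀ k, ∑ j, x j * h j k = 0) : x = 0 := by
  -- The recursion shows that a relation with coefficients `x_j β_j^m` implies the one with `x_j
  -- β_j^{m+1}`, provided `∑ ε_j x_j β_j^m = 0`. That sum vanishes by reading the recursion at the
  -- index `T`, where `f` is nonzero and does not depend on the roots. The Vandermonde matrix of the
  -- distinct roots then gives `ε_j x_j = 0`.
  have key : ∀ m : ℕ, (∀ k, ∑ j, x j * β j ^ m * h j k = 0) ∧
      ∑ j, ε j * x j * β j ^ m = 0 := by
    have hstep : ∀ (m : ℕ) k, ∑ j, x j * β j ^ (m + 1) * h j k =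
        ∑ j, x j * β j ^ m * h j (k - 1) + (∑ j, ε j * x j * β j ^ m) * f k := by
      intro m k
      rw [Finset.sum_mul, ← Finset.sum_add_distrib]
      refine Finset.sum_congr rfl fun j _ => ?_
      rw [H.rec']
      ring
    have hpow : ∀ m : ℕ, (∀ k, ∑ j, x j * β j ^ m * h j k = 0) →
        ∑ j, ε j * x j * β j ^ m = 0 := by
      intro m hm
      have := hstep m T
      rw [hm, zero_add] at this
      simp only [hhT, mul_zero, Finset.sum_const_zero] at this
      exact (mul_eq_zero.mp this.symm).resolve_right hT
    intro m
    induction m with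
    | zero =>
      have h0 : ∀ k, ∑ j, x j * β j ^ 0 * h j k = 0 := by simpa using hx
      exact ⟨h0, hpow 0 h0⟩
    | succ m ih =>
      have h0 : ∀ k, ∑ j, x j * β j ^ (m + 1) * h j k = 0 := by
        intro k
        rw [hstep, ih.1, ih.2, zero_mul, add_zero]
      exact ⟨h0, hpow _ h0⟩
  let e := Fintype.equivFin J
  have hv := Matrix.eq_zero_of_forall_pow_sum_mul_pow_eq_zero (f := fun i => β (e.symm i))
    (v := fun i => ε (e.symm i) * x (e.symm i)) (hβ.comp e.symm.injective) (fun m => by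
      rw [← (key m).2]
      exact Equiv.sum_comp e.symm fun j => ε j * x j * β j ^ (m : ℕ))
  funext j
  have := congrFun hv (e j)
  simp only [Equiv.symm_apply_apply, Pi.zero_apply] at this
  have h2 := H.sq j
  change x j = 0
  linear_combination ε j * this - x j * h2

/-! ### The fields as functions of the zeros and poles -/

/-- The jet variables that play the role of zeros (`inl`) and poles (`inr`). -/
def rootVar : Fin (N + 1) ⊕ Fin N → Var N
  | Sum.inl i => Sum.inl i
  | Sum.inr j => Sum.inr j.castSucc

/-- The zeros and poles. -/
def root (j : Fin (N + 1) ⊕ Fin N) : DiffFun K N := jet (rootVar j, 0)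

/-- The leading coefficient of the denominator. -/
def lead : DiffFun K N := jet (Sum.inr (Fin.last N), 0)

lemma isUnit_lead : IsUnit (lead : DiffFun K N) :=
  IsLocalization.Away.algebraMap_isUnit (S := DiffFun K N) (bTop K N)

/-- The numerator as a product of linear factors. -/
def qRoot : WSeries K N := ∏ i : Fin (N + 1), lin (root (Sum.inl i))

/-- The denominator as a product of linear factors. -/
def pRoot : WSeries K N := wMon 0 lead * ∏ j : Fin N, lin (root (Sum.inr j))

lemma wCoeff_pRoot (n : ℤ) : wCoeff (pRoot : WSeries K N) n =
    lead * wCoeff (∏ j : Fin N, lin (root (Sum.inr j)) : WSeries K N) n := by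
  rw [pRoot, wCoeff_wMon_mul, sub_zero]

lemma wCoeff_pRoot_top : wCoeff (pRoot : WSeries K N) N = lead := by
  have := wCoeff_prod_lin_card (Finset.univ : Finset (Fin N)) fun j => root (K := K) (Sum.inr j)
  rw [Finset.card_fin] at this
  rw [wCoeff_pRoot, this, mul_one]

/-- The values of the fields in terms of zeros and poles. -/
def rootVal : Var N → DiffFun K N
  | Sum.inl k => wCoeff qRoot (k : ℕ)
  | Sum.inr l => wCoeff pRoot (l : ℕ)

lemma isUnit_rootVal : IsUnit (rootVal (Sum.inr (Fin.last N)) : DiffFun K N) := by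
  rw [rootVal, Fin.val_last, wCoeff_pRoot_top]
  exact isUnit_lead

/-- The fields as functions of zeros and poles. -/
def rootHom : DiffFun K N →ₐ[K] DiffFun K N := fieldHom rootVal isUnit_rootVal

lemma rootHom_dx (f : DiffFun K N) : rootHom (dx f) = dx (rootHom f) := fieldHom_dx _ _ f

lemma rootHom_jet (v : Var N) : rootHom (jet (v, 0)) = (rootVal v : DiffFun K N) :=
  fieldHom_jet _ _ _

lemma rootHom_a (k : ℤ) : rootHom (a k) = wCoeff (qRoot : WSeries K N) k := by
  rcases lt_trichotomy k (N + 1) with h | rfl | h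
  · rcases lt_or_ge k 0 with h0 | h0
    · rw [a_of_neg h0, map_zero, qRoot, wCoeff_prod_lin_of_neg _ _ h0]
    · obtain ⟨m, rfl⟩ := Int.eq_ofNat_of_zero_le h0
      have := a_fin (K := K) (⟨m, by omega⟩ : Fin (N + 1))
      simp only at this
      rw [this, rootHom_jet]; rfl
  · have := wCoeff_prod_lin_card (Finset.univ : Finset (Fin (N + 1))) fun j => root (K := K) (Sum.inl j)
    rw [Finset.card_fin] at this
    rw [a_top, map_one, qRoot]
    exact_mod_cast this.symm
  · rw [a_of_gt h, map_zero, qRoot, wCoeff_prod_lin_of_gt _ _ (by simpa using h)]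

lemma rootHom_b (k : ℤ) : rootHom (b k) = wCoeff (pRoot : WSeries K N) k := by
  rcases le_or_gt k N with h | h
  · rcases lt_or_ge k 0 with h0 | h0
    · rw [b_of_neg h0, map_zero, wCoeff_pRoot, wCoeff_prod_lin_of_neg _ _ h0, mul_zero]
    · obtain ⟨m, rfl⟩ := Int.eq_ofNat_of_zero_le h0
      have := b_fin (K := K) (⟨m, by omega⟩ : Fin (N + 1))
      simp only at this
      rw [this, rootHom_jet]; rfl
  · rw [b_of_gt h, map_zero, wCoeff_pRoot, wCoeff_prod_lin_of_gt _ _ (by simpa using h), mul_zero]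

lemma mapHom_qSer : mapHom rootHom qSer = (qRoot : WSeries K N) :=
  wSeries_ext fun n => by rw [wCoeff_mapHom, wCoeff_qSer, rootHom_a]

lemma mapHom_pSer : mapHom rootHom pSer = (pRoot : WSeries K N) :=
  wSeries_ext fun n => by rw [wCoeff_mapHom, wCoeff_pSer, rootHom_b]

/-- `z` in terms of zeros and poles. -/
def zRoot : WSeries K N := mapHom rootHom z

lemma wCoeff_zRoot (n : ℤ) : wCoeff (zRoot : WSeries K N) n = rootHom (u n) := rfl

lemma pRoot_mul_zRoot : pRoot * zRoot = (qRoot : WSeries K N) := by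
  rw [zRoot, ← mapHom_pSer, ← mapHom_qSer, ← map_mul, pSer_mul_z]

lemma isUnit_pRoot : IsUnit (pRoot : WSeries K N) := by
  rw [← mapHom_pSer]; exact isUnit_pSer.map _

lemma pRoot_mul_leibniz_zRoot {T : WSeries K N → WSeries K N} (hT : IsLeibniz T) :
    pRoot * T zRoot = T qRoot - zRoot * T pRoot := by
  rw [← pRoot_mul_zRoot, hT.mul]; ring

section Leibniz

variable {T : WSeries K N → WSeries K N}

lemma leibniz_qRoot_eq_zero (hT : IsLeibniz T) (h : ∀ i, T (lin (root (Sum.inl i))) = 0) :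
    T (qRoot : WSeries K N) = 0 := hT.prod_eq_zero _ _ fun i _ => h i

lemma leibniz_pRoot (hT : IsLeibniz T) {κ : DiffFun K N} (hc : T (wMon 0 lead) = wMon 0 κ * wMon 0 lead)
    (h : ∀ i, T (lin (root (Sum.inr i))) = 0) : T (pRoot : WSeries K N) = wMon 0 κ * pRoot := by
  rw [pRoot, hT.mul, hT.prod_eq_zero _ _ fun i _ => h i, hc]; ring

lemma leibniz_zRoot (hT : IsLeibniz T) {x y : WSeries K N} (hq : T qRoot = x * qRoot)
    (hp : T pRoot = y * pRoot) : T (zRoot : WSeries K N) = (x - y) * zRoot := by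
  apply isUnit_pRoot.mul_left_cancel
  rw [pRoot_mul_leibniz_zRoot hT, hq, hp, ← pRoot_mul_zRoot]
  ring

end Leibniz

lemma partialD_root (i j : Fin (N + 1) ⊕ Fin N) :
    partialD (rootVar i, 0) (root j : DiffFun K N) = if i = j then 1 else 0 := by
  rw [root, partialD_jet]
  have : ((rootVar j, 0) : JetVar N) = (rootVar i, 0) ↔ i = j := by
    rcases i with i | i <;> rcases j with j | j <;> simp [rootVar, eq_comm]
  split_ifs <;> simp_all

lemma partialD_lead (i : Fin (N + 1) ⊕ Fin N) : partialD (rootVar i, 0) (lead : DiffFun K N) = 0 := by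
  rw [lead, partialD_jet, if_neg]
  rcases i with i | i <;> simp [rootVar, Prod.ext_iff, Fin.ext_iff]
  omega

lemma wMon_zero (n : ℤ) : wMon n (0 : DiffFun K N) = 0 := by simp [wMon]

lemma map_partialD_lin (i j : Fin (N + 1) ⊕ Fin N) :
    (lin (root j) : WSeries K N).map (partialD (rootVar i, 0)) = if i = j then -1 else 0 := by
  rw [map_lin, partialD_root]
  split_ifs
  · rw [wMon_zero_one]
  · rw [wMon_zero, neg_zero]

/-- Only the factor `w - root` depends on this root, and its derivative is `-1`. -/
lemma lin_mul_map_prod {ι : Type*} [Fintype ι] (g : ι → Fin (N + 1) ⊕ Fin N)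
    (hg : Function.Injective g) (i : ι) :
    lin (root (g i)) * (∏ j, lin (root (g j)) : WSeries K N).map (partialD (rootVar (g i), 0)) =
      -∏ j, lin (root (g j)) := by
  classical
  have hT := isLeibniz_map (K := K) (partialD (rootVar (g i), 0))
  rw [← Finset.mul_prod_erase _ _ (Finset.mem_univ i)]
  have := hT.mul (lin (root (g i))) (∏ j ∈ Finset.univ.erase i, lin (root (g j)))
  rw [this, hT.prod_eq_zero _ _ fun j hj => by
      rw [map_partialD_lin, if_neg fun h => (Finset.ne_of_mem_erase hj) (hg h.symm)],
    map_partialD_lin, if_pos rfl]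
  ring

lemma lin_mul_map_qRoot (i : Fin (N + 1)) :
    lin (root (Sum.inl i)) * (qRoot : WSeries K N).map (partialD (rootVar (Sum.inl i), 0)) = -qRoot :=
  lin_mul_map_prod Sum.inl Sum.inl_injective i

lemma map_partialD_lead (i : Fin (N + 1) ⊕ Fin N) :
    (wMon 0 lead : WSeries K N).map (partialD (rootVar i, 0)) = 0 := by
  rw [map_wMon, partialD_lead, wMon_zero]

lemma lin_mul_map_pRoot (i : Fin N) :
    lin (root (Sum.inr i)) * (pRoot : WSeries K N).map (partialD (rootVar (Sum.inr i), 0)) = -pRoot := by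
  have hT := isLeibniz_map (K := K) (partialD (rootVar (Sum.inr i : Fin (N + 1) ⊕ Fin N), 0))
  have := hT.mul (wMon 0 lead) (∏ j : Fin N, lin (root (Sum.inr j)))
  rw [pRoot, this, map_partialD_lead]
  linear_combination wMon 0 lead * lin_mul_map_prod (K := K) Sum.inr Sum.inr_injective i

lemma map_qRoot_inr (i : Fin N) :
    (qRoot : WSeries K N).map (partialD (rootVar (Sum.inr i), 0)) = 0 :=
  leibniz_qRoot_eq_zero (isLeibniz_map _) fun j => by rw [map_partialD_lin, if_neg (by simp)]

lemma map_pRoot_inl (i : Fin (N + 1)) :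
    (pRoot : WSeries K N).map (partialD (rootVar (Sum.inl i), 0)) = 0 := by
  have := leibniz_pRoot (isLeibniz_map (K := K) (partialD (rootVar (Sum.inl i : Fin (N + 1) ⊕ Fin N), 0)))
    (κ := 0) (by rw [map_partialD_lead, wMon_zero, zero_mul])
    fun j => by rw [map_partialD_lin, if_neg (by simp)]
  rwa [wMon_zero, zero_mul] at this

/-- The sign `1` for zeros and `-1` for poles. -/
def rootSign : Fin (N + 1) ⊕ Fin N → DiffFun K N
  | Sum.inl _ => 1
  | Sum.inr _ => -1

/-- The quotient rule, checked after multiplication by the denominator; a pole enters with exponent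
`-1`, hence the sign. -/
lemma lin_mul_map_zRoot (j : Fin (N + 1) ⊕ Fin N) :
    lin (root j) * (zRoot : WSeries K N).map (partialD (rootVar j, 0)) =
      -(wMon 0 (rootSign j) * zRoot) := by
  apply isUnit_pRoot.mul_left_cancel
  have h := pRoot_mul_leibniz_zRoot (isLeibniz_map (K := K) (partialD (rootVar j, 0)))
  rcases j with i | j
  · rw [map_pRoot_inl] at h
    have h2 := lin_mul_map_qRoot (K := K) i
    rw [rootSign, wMon_zero_one]
    linear_combination lin (root (Sum.inl i)) * h + h2 + pRoot_mul_zRoot (K := K)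
  · rw [map_qRoot_inr] at h
    have h2 := lin_mul_map_pRoot (K := K) j
    have h3 : wMon 0 (-1 : DiffFun K N) = -1 := by rw [← wMon_zero_one]; simp [wMon]
    rw [rootSign, h3]
    linear_combination lin (root (Sum.inr j)) * h - zRoot * h2

end RatToda
end

open scoped LaurentSeries
noncomputable section
namespace RatToda
variable {K : Type*} [Field K] {N : ℕ}
open Kernel

/-! ### Homogeneity and chain rule in the zeros and poles -/

lemma wMon_zero_natCast (n : ℕ) : wMon 0 (n : DiffFun K N) = n := by
  rw [wMon, neg_zero]; exact map_natCast (HahnSeries.C : DiffFun K N →+* _) n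

lemma wMon_zero_neg (x : DiffFun K N) : wMon 0 (-x) = -wMon 0 x := by
  rw [wMon, neg_zero]; exact map_neg (HahnSeries.C : DiffFun K N →+* _) x

section Subset

variable {ι : Type*} [Fintype ι] (g : ι → Fin (N + 1) ⊕ Fin N)

/-- The Euler operator of some of the roots and of `w`. -/
def eulerOp (f : WSeries K N) : WSeries K N :=
  f.map (∑ i, root (K := K) (g i) • partialD (K := K) (rootVar (g i), 0)) + wdw f

/-- The total derivative along everything but some of the roots. -/
def chainOp (f : WSeries K N) : WSeries K N :=
  f.map (dx - ∑ i, dx (root (K := K) (g i)) • partialD (K := K) (rootVar (g i), 0))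

lemma isLeibniz_eulerOp : IsLeibniz (eulerOp g : WSeries K N → WSeries K N) where
  add f h := by
    have h1 := (isLeibniz_map (∑ i, root (K := K) (g i) • partialD (K := K) (rootVar (g i), 0))).add f h
    have h2 := isLeibniz_wdw.add f h
    simp only [eulerOp] at *
    rw [h1, h2]; ring
  mul f h := by
    have h1 := (isLeibniz_map (∑ i, root (K := K) (g i) • partialD (K := K) (rootVar (g i), 0))).mul f h
    have h2 := isLeibniz_wdw.mul f h
    simp only [eulerOp] at *
    rw [h1, h2]; ring

lemma isLeibniz_chainOp : IsLeibniz (chainOp g : WSeries K N → WSeries K N) := isLeibniz_map _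

variable {g}

lemma sum_smul_partialD_root (hg : Function.Injective g) (x : ι → DiffFun K N) (i : ι) :
    (∑ i, x i • partialD (rootVar (g i), 0)) (root (g i) : DiffFun K N) = x i := by
  rw [derivation_sum_smul_apply, Finset.sum_eq_single i]
  · rw [partialD_root, if_pos rfl, mul_one]
  · intro j _ hj
    rw [partialD_root, if_neg fun h => hj (hg h), mul_zero]
  · simp

lemma sum_smul_partialD_lead (x : ι → DiffFun K N) :
    (∑ i, x i • partialD (rootVar (g i), 0)) (lead : DiffFun K N) = 0 := by
  rw [derivation_sum_smul_apply]
  exact Finset.sum_eq_zero fun i _ => by rw [partialD_lead, mul_zero]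

lemma eulerOp_lin (hg : Function.Injective g) (i : ι) :
    eulerOp g (lin (root (g i))) = (lin (root (g i)) : WSeries K N) := by
  rw [eulerOp, map_lin, sum_smul_partialD_root hg, wdw_lin, lin]; ring

lemma eulerOp_lead : eulerOp g (wMon 0 lead) = (0 : WSeries K N) := by
  rw [eulerOp, map_wMon, sum_smul_partialD_lead, wMon_zero, zero_add]
  refine wSeries_ext fun n => ?_
  rw [wCoeff_wdw, wCoeff_wMon]
  split_ifs with h
  · subst h; simp [wCoeff]
  · simp [wCoeff]

lemma chainOp_lin (hg : Function.Injective g) (i : ι) :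
    chainOp g (lin (root (g i))) = (0 : WSeries K N) := by
  rw [chainOp, map_lin, Derivation.sub_apply, sum_smul_partialD_root hg, sub_self, wMon_zero, neg_zero]

lemma chainOp_lead : chainOp g (wMon 0 lead) = (wMon 0 (dx lead) : WSeries K N) := by
  rw [chainOp, map_wMon, Derivation.sub_apply, sum_smul_partialD_lead, sub_zero]

end Subset

/-- The logarithmic derivative of the leading coefficient. -/
def dlogLead : DiffFun K N := (dx lead : DiffFun K N) * (isUnit_lead (K := K) (N := N)).unit⁻¹.val

lemma dlogLead_mul : dlogLead * lead = dx (lead : DiffFun K N) := by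
  rw [dlogLead, mul_assoc, IsUnit.val_inv_mul, mul_one]

lemma wMon_dlogLead : wMon 0 (dx lead : DiffFun K N) = wMon 0 dlogLead * wMon 0 lead := by
  rw [wMon_mul_wMon, add_zero, dlogLead_mul]

/-- The numerator is monic of degree `N + 1`, so no logarithmic derivative enters. -/
lemma rootSeq_q : RootSeq (fun i => root (Sum.inl i)) (fun _ => 1)
    (fun i k => partialD (rootVar (Sum.inl i), 0) (wCoeff (qRoot : WSeries K N) k)) (wCoeff qRoot)
    ((N + 1 : ℕ) : DiffFun K N) 0 := by
  refine rootSeq_of_series (fun _ => Or.inl rfl) (Derivation.map_natCast _ _) (fun i => ?_) ?_ ?_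
  · rw [lin_mul_map_qRoot, wMon_zero_one, one_mul]
  · rw [wMon_zero_natCast]
    have := (isLeibniz_eulerOp (K := K) (Sum.inl : Fin (N + 1) → Fin (N + 1) ⊕ Fin N)).prod_eq_card
      Finset.univ _ fun i _ => eulerOp_lin Sum.inl_injective i
    rwa [Finset.card_fin] at this
  · rw [wMon_zero, zero_mul]
    exact leibniz_qRoot_eq_zero (isLeibniz_chainOp Sum.inl) (chainOp_lin Sum.inl_injective)

/-- The leading coefficient `b_N` does not depend on the roots and contributes `κ = b_N'/b_N`. -/
lemma rootSeq_p : RootSeq (fun i => root (Sum.inr i)) (fun _ => 1)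
    (fun i k => partialD (rootVar (Sum.inr i), 0) (wCoeff (pRoot : WSeries K N) k)) (wCoeff pRoot)
    (N : DiffFun K N) dlogLead := by
  refine rootSeq_of_series (fun _ => Or.inl rfl) (Derivation.map_natCast _ _) (fun i => ?_) ?_ ?_
  · rw [lin_mul_map_pRoot, wMon_zero_one, one_mul]
  · rw [wMon_zero_natCast]
    have hT := isLeibniz_eulerOp (K := K) (Sum.inr : Fin N → Fin (N + 1) ⊕ Fin N)
    have := hT.prod_eq_card Finset.univ _ fun i _ => eulerOp_lin Sum.inr_injective i
    rw [Finset.card_fin] at this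
    change eulerOp _ _ = _
    rw [pRoot, hT.mul, this, eulerOp_lead]
    ring
  · exact leibniz_pRoot (isLeibniz_chainOp Sum.inr) (by rw [chainOp_lead, wMon_dlogLead])
      (chainOp_lin Sum.inr_injective)

/-- The quotient has degree `(N + 1) - N = 1`; its root-independent factor is `1/b_N`, hence `κ =
-b_N'/b_N`. -/
lemma rootSeq_z : RootSeq root rootSign
    (fun j k => partialD (rootVar j, 0) (wCoeff (zRoot : WSeries K N) k)) (wCoeff zRoot)
    ((1 : ℕ) : DiffFun K N) (-dlogLead) := by
  have hid : Function.Injective (id : Fin (N + 1) ⊕ Fin N → _) := Function.injective_id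
  refine rootSeq_of_series (fun j => ?_) (Derivation.map_natCast _ _) lin_mul_map_zRoot ?_ ?_
  · rcases j with _ | _
    · exact Or.inl rfl
    · exact Or.inr rfl
  · have hT := isLeibniz_eulerOp (K := K) (id : Fin (N + 1) ⊕ Fin N → _)
    have hq := hT.prod_eq_card Finset.univ _ fun (i : Fin (N + 1)) _ => eulerOp_lin hid (Sum.inl i)
    have hp := hT.prod_eq_card Finset.univ _ fun (i : Fin N) _ => eulerOp_lin hid (Sum.inr i)
    rw [Finset.card_fin] at hq hp
    have hp' : eulerOp id (pRoot : WSeries K N) = (N : WSeries K N) * pRoot := by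
      rw [pRoot, hT.mul]
      change _ * eulerOp id (∏ i : Fin N, lin (root (id (Sum.inr i)))) + _ = _
      rw [hp, eulerOp_lead]
      change _ * (_ * ∏ i : Fin N, lin (root (Sum.inr i))) + _ = _
      ring
    have := leibniz_zRoot hT hq hp'
    change eulerOp id _ = _
    rw [this, wMon_zero_natCast]
    push_cast; ring
  · have hT := isLeibniz_chainOp (K := K) (id : Fin (N + 1) ⊕ Fin N → _)
    have := leibniz_zRoot hT (x := 0)
      (by rw [zero_mul]; exact leibniz_qRoot_eq_zero hT fun i => chainOp_lin hid (Sum.inl i))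
      (leibniz_pRoot hT (κ := dlogLead) (by rw [chainOp_lead, wMon_dlogLead]) fun i => chainOp_lin hid (Sum.inr i))
    rw [zero_sub, ← wMon_zero_neg] at this
    exact this

/-! ### Functions of order zero -/

lemma orderZero_jet (v : Var N) : OrderZero (jet (v, 0) : DiffFun K N) := fun w s => by
  rw [partialD_jet, if_neg (by simp)]

lemma orderZero_qRoot (k : ℤ) : OrderZero (wCoeff (qRoot : WSeries K N) k) := fun v s => by
  have := leibniz_qRoot_eq_zero (isLeibniz_map (K := K) (partialD (v, s + 1))) fun i => by
    rw [map_lin, root, orderZero_jet, wMon_zero, neg_zero]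
  rw [← wCoeff_map, this]; rfl

lemma map_pRoot_order (v : Var N) (s : ℕ) :
    (pRoot : WSeries K N).map (partialD (v, s + 1)) = 0 := by
  have := leibniz_pRoot (isLeibniz_map (K := K) (partialD (v, s + 1))) (κ := 0)
    (by rw [map_wMon, lead, orderZero_jet, wMon_zero, zero_mul]) fun i => by
    rw [map_lin, root, orderZero_jet, wMon_zero, neg_zero]
  rwa [wMon_zero, zero_mul] at this

lemma orderZero_pRoot (k : ℤ) : OrderZero (wCoeff (pRoot : WSeries K N) k) := fun v s => by
  rw [← wCoeff_map, map_pRoot_order]; rfl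

lemma orderZero_zRoot (k : ℤ) : OrderZero (wCoeff (zRoot : WSeries K N) k) := fun v s => by
  have hT := isLeibniz_map (K := K) (partialD (v, s + 1))
  have := leibniz_zRoot hT (x := 0) (y := 0)
    (by rw [zero_mul]; exact leibniz_qRoot_eq_zero hT fun i => by
          rw [map_lin, root, orderZero_jet, wMon_zero, neg_zero])
    (by rw [zero_mul]; exact map_pRoot_order v s)
  rw [← wCoeff_map, this, sub_zero, zero_mul]; rfl

lemma orderZero_rootVal (v : Var N) : OrderZero (rootVal v : DiffFun K N) := by
  rcases v with k | l
  · exact orderZero_qRoot _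
  · exact orderZero_pRoot _

lemma orderZero_a (k : ℤ) : OrderZero (a k : DiffFun K N) := fun v s => by
  rw [a]
  split_ifs
  · simp
  · exact orderZero_jet _ v s
  · simp

lemma orderZero_b (k : ℤ) : OrderZero (b k : DiffFun K N) := fun v s => by
  rw [b]
  split_ifs
  · exact orderZero_jet _ v s
  · simp

lemma pSer_mul_map_z (D : Derivation K (DiffFun K N) (DiffFun K N)) :
    pSer * z.map D = qSer.map D - z * pSer.map D := by
  have := (isLeibniz_map D).mul pSer z
  rw [← pSer_mul_z, this]; ring

lemma orderZero_u (n : ℤ) : OrderZero (u n : DiffFun K N) := fun v s => by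
  have h := pSer_mul_map_z (K := K) (partialD (v, s + 1))
  have hq : (qSer : WSeries K N).map (partialD (v, s + 1)) = 0 := wSeries_ext fun k => by
    rw [wCoeff_map, wCoeff_qSer, orderZero_a]; rfl
  have hp : (pSer : WSeries K N).map (partialD (v, s + 1)) = 0 := wSeries_ext fun k => by
    rw [wCoeff_map, wCoeff_pSer, orderZero_b]; rfl
  rw [hq, hp, mul_zero, sub_zero] at h
  have := isUnit_pSer.mul_right_eq_zero.mp h
  rw [← u_eq, ← wCoeff_map, this]; rfl

/-! ### Nondegeneracy -/

lemma sum_var {M : Type*} [AddCommMonoid M] (F : Var N → M) :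
    ∑ v, F v = ∑ j, F (rootVar j) + F (Sum.inr (Fin.last N)) := by
  rw [Fintype.sum_sum_type, Fintype.sum_sum_type, Fin.sum_univ_castSucc fun i => F (Sum.inr i),
    add_assoc]
  rfl

lemma b_mul_u : b N * u 1 = (1 : DiffFun K N) := by
  have h := congrArg (wCoeff · ((N : ℤ) + 1)) (pSer_mul_z (K := K) (N := N))
  rw [wCoeff_mul (A := N) (B := 1) (fun n hn => by rw [wCoeff_pSer, b_of_gt hn])
    (fun n hn => by rw [u_eq, u_of_gt hn]), wCoeff_qSer, a_top, add_sub_cancel_right,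
    Finset.Icc_self, Finset.sum_singleton, wCoeff_pSer, u_eq, add_sub_cancel_left] at h
  exact h

lemma lead_mul_zRoot : lead * wCoeff zRoot 1 = (1 : DiffFun K N) := by
  have := congrArg (rootHom (K := K) (N := N)) b_mul_u
  rwa [map_mul, map_one, rootHom_b, wCoeff_pRoot_top] at this

lemma root_injective : Function.Injective (root : _ → DiffFun K N) := by
  intro i j h
  by_contra hij
  have h1 := partialD_root (K := K) i i
  rw [h, partialD_root, if_neg hij, if_pos rfl] at h1
  exact zero_ne_one h1

/-- The coefficient of `w` in `z` is `1/b_N`, so it isolates the component along `b_N`. The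
components along the roots then vanish by the Vandermonde argument, as the roots are independent
variables and thus distinct. -/
lemma eq_zero_of_sum_partialD_zRoot {y : Var N → DiffFun K N}
    (h : ∀ n, ∑ v, y v * partialD (v, 0) (wCoeff zRoot n) = 0) : y = 0 := by
  have hder : ∀ D : Derivation K (DiffFun K N) (DiffFun K N),
      lead * D (wCoeff zRoot 1) + wCoeff zRoot 1 * D lead = 0 := fun D => by
    have := congrArg D (lead_mul_zRoot (K := K) (N := N))
    rwa [D.leibniz, D.map_one_eq_zero] at this
  have hz : wCoeff (zRoot : WSeries K N) 1 ≠ 0 := right_ne_zero_of_mul_eq_one lead_mul_zRoot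
  have hl : (lead : DiffFun K N) ≠ 0 := left_ne_zero_of_mul_eq_one lead_mul_zRoot
  have hlast : y (Sum.inr (Fin.last N)) = 0 := by
    have h1 := hder (∑ v, y v • partialD (v, 0))
    rw [derivation_sum_smul_apply, derivation_sum_smul_apply, h, mul_zero, zero_add] at h1
    have h2 := (mul_eq_zero.mp h1).resolve_left hz
    rw [sum_var] at h2
    simp only [partialD_lead, mul_zero, Finset.sum_const_zero, zero_add] at h2
    rwa [lead, partialD_jet, if_pos rfl, mul_one] at h2
  have hr : (fun j => y (rootVar j)) = 0 := by
    refine rootSeq_z.eq_zero_of_sum_eq_zero root_injective hz (fun j => ?_) fun n => ?_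
    · have := hder (partialD (rootVar j, 0))
      rw [partialD_lead, mul_zero, add_zero] at this
      exact (mul_eq_zero.mp this).resolve_left hl
    · have := h n
      rwa [sum_var, hlast, zero_mul, add_zero] at this
  funext v
  rcases v with k | l
  · exact congrFun hr (Sum.inl k)
  · induction l using Fin.lastCases with
    | last => exact hlast
    | cast l => exact congrFun hr (Sum.inr l)

lemma partialD_zRoot (r : Var N) (n : ℤ) : partialD (r, 0) (wCoeff zRoot n : DiffFun K N) =
    ∑ v, rootHom (partialD (v, 0) (u n)) * partialD (r, 0) (rootVal v) := by
  rw [wCoeff_zRoot, partialD_hom rootHom (n := 1)]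
  · simp only [Finset.sum_range_one, rootHom_jet]
  · intro v s hs
    obtain ⟨t, rfl⟩ := Nat.exists_eq_add_of_le' hs
    exact orderZero_u n v t

/-- The Jacobian of the fields with respect to zeros, poles and leading coefficient. -/
def rootJacobian : Matrix (Var N) (Var N) (DiffFun K N) :=
  fun r v => partialD (r, 0) (rootVal v)

lemma vecMul_rootJacobian {y : Var N → DiffFun K N} (n : ℤ) :
    ∑ r, y r * partialD (r, 0) (wCoeff zRoot n) =
      ∑ v, rootHom (partialD (v, 0) (u n)) * Matrix.vecMul y rootJacobian v := by
  simp only [partialD_zRoot, Matrix.vecMul, dotProduct, Finset.mul_sum]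
  rw [Finset.sum_comm]
  refine Finset.sum_congr rfl fun v _ => Finset.sum_congr rfl fun r _ => ?_
  rw [rootJacobian]; ring

/-- By the chain rule, a vector killed by the Jacobian of the fields would also annihilate all
coefficients of `z`. -/
lemma det_rootJacobian_ne_zero : (rootJacobian : Matrix (Var N) (Var N) (DiffFun K N)).det ≠ 0 := by
  intro h
  obtain ⟨y, hy, hyJ⟩ := Matrix.exists_vecMul_eq_zero_iff.mpr h
  refine hy (eq_zero_of_sum_partialD_zRoot fun n => ?_)
  rw [vecMul_rootJacobian, hyJ]
  simp

lemma rootHom_injective [CharZero K] : Function.Injective (rootHom : DiffFun K N → DiffFun K N) := by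
  refine hom_injective rootHom_dx (fun v => by rw [rootHom_jet]; exact orderZero_rootVal v) ?_
  intro y hy
  by_contra hne
  refine det_rootJacobian_ne_zero (K := K) (N := N)
    (Matrix.exists_mulVec_eq_zero_iff.mp ⟨y, hne, ?_⟩)
  funext r
  rw [Pi.zero_apply, ← hy r]
  simp only [Matrix.mulVec, dotProduct, rootJacobian, rootHom_jet]
  exact Finset.sum_congr rfl fun v _ => mul_comm _ _

/-- The fields are determined, infinitesimally, by the coefficients of `z`. -/
lemma eq_zero_of_sum_partialD_u [CharZero K] {ρ : Var N → DiffFun K N}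
    (h : ∀ n ≤ 1, ∑ v, partialD (v, 0) (u n) * ρ v = 0) : ρ = 0 := by
  set J : Matrix (Var N) (Var N) (DiffFun K N) := rootJacobian
  set σ : Var N → DiffFun K N := fun v => rootHom (ρ v)
  -- The adjugate replaces the inverse of the Jacobian: along `σ · adj J` the derivative of each
  -- coefficient of `z` is `det J` times the image of the given vanishing sum.
  have hy : Matrix.vecMul σ J.adjugate = 0 := by
    refine eq_zero_of_sum_partialD_zRoot fun n => ?_
    rw [vecMul_rootJacobian, Matrix.vecMul_vecMul, Matrix.adjugate_mul, Matrix.vecMul_smul,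
      Matrix.vecMul_one]
    have hn : ∑ v, partialD (v, 0) (u n) * ρ v = 0 := by
      rcases le_or_gt n 1 with hn | hn
      · exact h n hn
      · simp [u_of_gt hn]
    have := congrArg (fun f => J.det * rootHom (K := K) f) hn
    simp only [map_sum, map_mul, map_zero, mul_zero, Finset.mul_sum] at this
    rw [← this]
    refine Finset.sum_congr rfl fun v _ => ?_
    simp only [Pi.smul_apply, smul_eq_mul, σ]
    ring
  have hz : J.det • σ = 0 := by
    rw [← Matrix.vecMul_one σ, ← Matrix.vecMul_smul, ← Matrix.adjugate_mul, ← Matrix.vecMul_vecMul,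
      hy, Matrix.zero_vecMul]
  funext v
  have := congrFun hz v
  simp only [Pi.smul_apply, smul_eq_mul, Pi.zero_apply] at this
  refine rootHom_injective (K := K) ?_
  rw [Pi.zero_apply, map_zero]
  exact (mul_eq_zero.mp this).resolve_left det_rootJacobian_ne_zero

end RatToda
end

open scoped LaurentSeries
noncomputable section
namespace RatToda
variable {K : Type*} [Field K] {N : ℕ}
open Kernel

/-! ### First order kernels -/

/-- The kernel `p δ' + r δ`. -/
def lk (p r : DiffFun K N) : Kernel K N := p • Polynomial.X + Polynomial.C r

lemma lk_add (p r p' r' : DiffFun K N) : lk p r + lk p' r' = lk (p + p') (r + r') := by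
  rw [lk, lk, lk, add_smul, map_add]; abel

lemma lk_neg (p r : DiffFun K N) : -lk p r = lk (-p) (-r) := by
  rw [lk, lk, neg_smul, map_neg, neg_add]

lemma lk_sub (p r p' r' : DiffFun K N) : lk p r - lk p' r' = lk (p - p') (r - r') := by
  rw [sub_eq_add_neg, lk_neg, lk_add, ← sub_eq_add_neg, ← sub_eq_add_neg]

lemma lk_sum {ι : Type*} (s : Finset ι) (p r : ι → DiffFun K N) :
    ∑ i ∈ s, lk (p i) (r i) = lk (∑ i ∈ s, p i) (∑ i ∈ s, r i) := by
  simp only [lk, Finset.sum_add_distrib, Finset.sum_smul, map_sum]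

lemma smul_lk (c : K) (p r : DiffFun K N) : c • lk p r = lk (c • p) (c • r) := by
  rw [lk, lk, smul_add, smul_assoc, Polynomial.smul_C]

lemma xy_eq_lk (f g : DiffFun K N) : xy f g = lk (f * g) (f * dx g) := by
  rw [xy_eq, mulY_X, smul_add, smul_smul, Polynomial.smul_C, smul_eq_mul, lk]

lemma mulX_delta'_eq_lk (f : DiffFun K N) : mulX f delta' = lk f 0 := by
  rw [mulX_eq_smul, lk, map_zero, add_zero]; rfl

lemma mulX_delta_eq_lk (f : DiffFun K N) : mulX f delta = lk 0 f := by
  rw [mulX_eq_smul, lk, zero_smul, zero_add, delta, ← Polynomial.C_1, Polynomial.smul_C, smul_eq_mul,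
    mul_one]

lemma mulY_mulX_eq_lk (f g : DiffFun K N) : mulY f (mulX g delta') = lk (f * g) (dx f * g) := by
  rw [mulX_eq_smul, mulY_smul, delta', mulY_X, smul_add, smul_smul, Polynomial.smul_C, smul_eq_mul, lk,
    mul_comm, mul_comm g]

lemma intCast_smul_eq (n : ℤ) (y : DiffFun K N) : (n : K) • y = (n : DiffFun K N) * y := by
  rw [Int.cast_smul_eq_zsmul, zsmul_eq_mul]

lemma two_smul_eq (y : DiffFun K N) : (2 : K) • y = 2 * y := by
  have := intCast_smul_eq (K := K) 2 y
  push_cast at this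
  exact this

lemma two_smul_div_two [CharZero K] {M : Type*} [AddCommGroup M] [Module K M] (r : K) (y : M) :
    (2 : K) • (r / 2) • y = r • y := by
  rw [smul_smul, mul_div_cancel₀ _ two_ne_zero]

/-- Bracket identities are compared after doubling, which removes the halves from the formulas and
leaves identities with integer coefficients. -/
lemma two_smul_cancel [CharZero K] {M : Type*} [AddCommGroup M] [Module K M] {x y : M}
    (h : (2 : K) • x = (2 : K) • y) : x = y := by
  have := congrArg ((2 : K)⁻¹ • ·) h
  simpa only [smul_smul, inv_mul_cancel₀ (two_ne_zero : (2 : K) ≠ 0), one_smul] using this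

lemma sum_Icc_one {M : Type*} [AddCommMonoid M] (m : ℕ) (F : ℤ → M) :
    ∑ n ∈ Finset.Icc (1 : ℤ) m, F n = ∑ i ∈ Finset.range m, F (i + 1) := by
  refine Finset.sum_nbij' (fun n => (n - 1).toNat) (fun i => (i : ℤ) + 1) ?_ ?_ ?_ ?_ ?_
  · intro n hn
    rw [Finset.mem_Icc] at hn
    rw [Finset.mem_range]; omega
  · intro i hi
    rw [Finset.mem_range] at hi
    rw [Finset.mem_Icc]; omega
  · intro n hn
    rw [Finset.mem_Icc] at hn
    omega
  · intro i _; omega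
  · intro n hn
    rw [Finset.mem_Icc] at hn
    congr 1; omega

/-! ### The explicit quadratic sums as sums over roots -/

section Families

/-- The common form of the quadratic brackets of polynomial coefficients. -/
def polyQuadratic (f : ℤ → DiffFun K N) (k l : ℤ) : Kernel K N :=
  (∑ n ∈ Finset.Icc (1 : ℤ) N,
    (((k - l - n : ℤ) : K) • xy (f (k - n)) (f (l + n)) -
      (n : K) • mulY (f (k - n)) (mulX (f (l + n)) delta'))) +
  (((k - l : ℤ) : K) / 2) • xy (f k) (f l)

lemma kmap_polyQuadratic {φ : DiffFun K N →ₐ[K] DiffFun K N} (hφ : ∀ f, φ (dx f) = dx (φ f))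
    (f : ℤ → DiffFun K N) (k l : ℤ) :
    kmap φ (polyQuadratic f k l) = polyQuadratic (fun n => φ (f n)) k l := by
  simp only [polyQuadratic, kmap_add, kmap_sum, kmap_sub, kmap_smul', kmap_xy hφ, kmap_mulY hφ,
    mulX_eq_smul, kmap_smul]
  simp only [delta', kmap, Polynomial.map_X]

lemma two_smul_polyQuadratic [CharZero K] (f : ℤ → DiffFun K N) (k l : ℤ) :
    (2 : K) • polyQuadratic f k l = lk
      ((k - l : DiffFun K N) * (f k * f l) + ∑ i ∈ Finset.range N,
        2 * ((k - l - 2 * (i + 1)) * (f (k - (i + 1)) * f (l + (i + 1)))))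
      ((k - l : DiffFun K N) * (f k * dx (f l)) + ∑ i ∈ Finset.range N,
        2 * ((k - l - (i + 1)) * (f (k - (i + 1)) * dx (f (l + (i + 1)))) -
          (i + 1) * (dx (f (k - (i + 1))) * f (l + (i + 1))))) := by
  rw [polyQuadratic, sum_Icc_one, smul_add, two_smul_div_two, add_comm]
  simp only [xy_eq_lk, mulY_mulX_eq_lk, smul_lk, lk_sub, lk_sum, lk_add, intCast_smul_eq,
    two_smul_eq, Finset.mul_sum]
  push_cast
  congr 2
  refine Finset.sum_congr rfl fun i _ => ?_
  ring

lemma RootSeq.two_smul_polyQuadratic [CharZero K] {J : Type*} [Fintype J] {β ε : J → DiffFun K N}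
    {h : J → ℤ → DiffFun K N} {f : ℤ → DiffFun K N} {d κ : DiffFun K N} (H : RootSeq β ε h f d κ)
    (hf : ∀ k < 0, f k = 0) (hh : ∀ j, ∀ k < 0, h j k = 0) {k : ℤ} (hk : k ≤ N) (l : ℤ) :
    (2 : K) • polyQuadratic f k l = lk
      (2 * ∑ j, ε j * ((β j * h j k) * (β j * h j l)) - (2 * d - k - l : DiffFun K N) * (f k * f l))
      (2 * ∑ j, ε j * ((β j * h j k) * dx (β j * h j l)) - (2 * d - k - l : DiffFun K N) * (f k * dx (f l))) := by
  -- It takes `N + 1` steps to make the index negative for every `k ≤ N`; the last summand vanishes,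
  -- which leaves the `N` terms of the explicit bracket.
  have h1 := H.sum_prod_down hf hh k l (N + 1) (by push_cast; omega)
  have h2 := H.sum_deriv_down hf hh k l (N + 1) (by push_cast; omega)
  have h0 : f (k - (N + 1)) = 0 := hf _ (by omega)
  rw [Finset.sum_range_succ] at h1 h2
  simp only [h0, map_zero, zero_mul, mul_zero, sub_zero, add_zero] at h1 h2
  rw [RatToda.two_smul_polyQuadratic, h1, h2]
  congr 1 <;> ring

/-- The quadratic bracket of the coefficients of a series. -/
def seriesQuadratic (f : ℤ → DiffFun K N) (n m : ℤ) : Kernel K N :=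
  mulX ((((n - m : ℤ) : K) / 2) • (f n * dx (f m)) +
      ∑ k ∈ Finset.Icc 1 (1 - n),
        (((n - m + k : ℤ) : K) • (f (n + k) * dx (f (m - k))) +
          (k : K) • (dx (f (n + k)) * f (m - k)))) delta +
    mulX ((((n - m : ℤ) : K) / 2) • (f n * f m) +
      ∑ k ∈ Finset.Icc 1 (1 - n), ((n - m + 2 * k : ℤ) : K) • (f (n + k) * f (m - k))) delta'

lemma kmap_seriesQuadratic {φ : DiffFun K N →ₐ[K] DiffFun K N} (hφ : ∀ f, φ (dx f) = dx (φ f))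
    (f : ℤ → DiffFun K N) (n m : ℤ) :
    kmap φ (seriesQuadratic f n m) = seriesQuadratic (fun n => φ (f n)) n m := by
  simp only [seriesQuadratic, kmap_add, mulX_eq_smul, kmap_smul, map_add, map_sum, map_smul, map_mul, hφ]
  simp only [delta', delta, kmap, Polynomial.map_X, Polynomial.map_one]

lemma RootSeq.two_smul_seriesQuadratic [CharZero K] {J : Type*} [Fintype J] {β ε : J → DiffFun K N}
    {h : J → ℤ → DiffFun K N} {f : ℤ → DiffFun K N} {d κ : DiffFun K N} (H : RootSeq β ε h f d κ)
    (hf : ∀ k > 1, f k = 0) (hh : ∀ j, ∀ k > 1, h j k = 0) {n : ℤ} (hn : n ≤ 1) (m : ℤ) :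
    (2 : K) • seriesQuadratic f n m = lk
      ((2 * d - n - m : DiffFun K N) * (f n * f m) - 2 * ∑ j, ε j * ((β j * h j n) * (β j * h j m)))
      ((2 * d - n - m : DiffFun K N) * (f n * dx (f m)) - 2 * ∑ j, ε j * ((β j * h j n) * dx (β j * h j m))) := by
  obtain ⟨M, hM⟩ := Int.eq_ofNat_of_zero_le (show 0 ≤ 1 - n by omega)
  -- With `M = 1 - n`, the step `M + 1` reaches index `2`, where the series vanishes; this recovers
  -- the range up to `1 - n`.
  have h1 := H.sum_prod_up hf hh n m (M + 1) (by push_cast; omega)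
  have h2 := H.sum_deriv_up hf hh n m (M + 1) (by push_cast; omega)
  have h0 : f (n + (M + 1)) = 0 := hf _ (by omega)
  rw [Finset.sum_range_succ] at h1 h2
  simp only [h0, map_zero, zero_mul, mul_zero, add_zero] at h1 h2
  rw [seriesQuadratic, hM]
  simp only [sum_Icc_one]
  simp only [mulX_delta'_eq_lk, mulX_delta_eq_lk, lk_add, smul_lk, smul_add, two_smul_div_two,
    intCast_smul_eq, two_smul_eq, zero_add, add_zero]
  rw [h1, h2, Finset.mul_sum, Finset.mul_sum]
  push_cast
  congr 1
  · ring
  · ring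

end Families

/-! ### Log-canonical brackets in zeros, poles and leading coefficient -/

lemma OrderZero.localBracket_eq {f g : DiffFun K N} (hf : OrderZero f) (hg : OrderZero g)
    (P : Bracket K N) : localBracket P f g =
      ∑ v, ∑ w, partialD (v, 0) f • mulY (partialD (w, 0) g) (P v w) := by
  rw [RatToda.localBracket_eq]
  simp only [hf.frechet_eq, hg.frechet_eq, swap_C, opComp_C, opComp_smul, mulY_eq_comp]

/-- `v ∂_v f`. -/
def logD (v : Var N) (f : DiffFun K N) : DiffFun K N := jet (v, 0) * partialD (v, 0) f

lemma OrderZero.localBracket_logBracket {f g : DiffFun K N} (hf : OrderZero f) (hg : OrderZero g)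
    (η : Var N → Var N → K) : localBracket (logBracket η) f g =
      ∑ v, ∑ w, η v w • xy (logD v f) (logD w g) := by
  rw [hf.localBracket_eq hg]
  refine Finset.sum_congr rfl fun v _ => Finset.sum_congr rfl fun w _ => ?_
  rw [logBracket, xy_eq, xy_eq, algebra_smul_eq, mulY_smul, mulY_smul, mulY_mulY, ← algebra_smul_eq,
    smul_comm, smul_smul, logD, logD, mul_comm (jet (v, 0)), mul_comm (jet (w, 0))]

open Classical in
/-- The coefficients of the log-canonical bracket that induces the quadratic Toda bracket. -/
def rootEta (v w : Var N) : K :=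
  if v = w then Sum.elim (fun _ => -1) (fun j => if j = Fin.last N then 0 else 1) v
  else if v = Sum.inr (Fin.last N) ∨ w = Sum.inr (Fin.last N) then -2⁻¹ else 0

lemma rootEta_symm (v w : Var N) : (rootEta v w : K) = rootEta w v := by
  simp only [rootEta, eq_comm (a := v), or_comm]
  by_cases h : w = v
  · rw [if_pos h, if_pos h, h]
  · rw [if_neg h, if_neg h]

lemma rootVar_injective : Function.Injective (rootVar : _ → Var N) := by
  rintro (i | i) (j | j) h <;> simp_all [rootVar]

lemma rootVar_ne_last (i : Fin (N + 1) ⊕ Fin N) : rootVar i ≠ Sum.inr (Fin.last N) := by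
  rcases i with i | i
  · simp [rootVar]
  · simp only [rootVar, ne_eq, Sum.inr.injEq]
    exact (Fin.castSucc_lt_last i).ne

lemma sum_rootEta {M : Type*} [AddCommGroup M] [Module K M] (F : Var N → Var N → M) :
    ∑ v, ∑ w, (rootEta v w : K) • F v w =
      ∑ i : Fin N, F (Sum.inr i.castSucc) (Sum.inr i.castSucc) - ∑ i, F (Sum.inl i) (Sum.inl i) -
      (2⁻¹ : K) • ∑ j, (F (rootVar j) (Sum.inr (Fin.last N)) + F (Sum.inr (Fin.last N)) (rootVar j)) := by
  have h1 : ∀ j, (rootEta (rootVar j) (Sum.inr (Fin.last N)) : K) = -2⁻¹ := fun j => by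
    rw [rootEta, if_neg (rootVar_ne_last j), if_pos (Or.inr rfl)]
  have h2 : ∀ j, (rootEta (Sum.inr (Fin.last N)) (rootVar j) : K) = -2⁻¹ := fun j => by
    rw [rootEta_symm, h1]
  have h3 : (rootEta (Sum.inr (Fin.last N)) (Sum.inr (Fin.last N)) : K) = 0 := by simp [rootEta]
  have h4 : ∀ i, ∑ j, (rootEta (rootVar i) (rootVar j) : K) • F (rootVar i) (rootVar j) =
      (rootEta (rootVar i) (rootVar i) : K) • F (rootVar i) (rootVar i) := fun i => by
    refine Finset.sum_eq_single i (fun j _ hj => ?_) (by simp)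
    rw [rootEta, if_neg fun h => hj (rootVar_injective h).symm,
      if_neg (by simp [rootVar_ne_last]), zero_smul]
  have h5 : ∀ i : Fin N, (rootEta (rootVar (Sum.inr i)) (rootVar (Sum.inr i)) : K) = 1 := fun i => by
    rw [rootEta, if_pos rfl]
    simp [rootVar, (Fin.castSucc_lt_last i).ne]
  have h6 : ∀ i : Fin (N + 1), (rootEta (rootVar (Sum.inl i)) (rootVar (Sum.inl i)) : K) = -1 :=
    fun i => by rw [rootEta, if_pos rfl]; simp [rootVar]
  rw [sum_var]
  simp only [sum_var fun w => (rootEta _ w : K) • F _ w, Finset.sum_add_distrib, h1, h2, h3, h4,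
    zero_smul, add_zero, Fintype.sum_sum_type fun i => (rootEta (rootVar i) (rootVar i) : K) • _, h5,
    h6, one_smul, neg_smul, Finset.sum_neg_distrib, ← Finset.smul_sum, smul_add]
  simp only [rootVar]
  abel

/-- The log-canonical bracket in zeros, poles and leading coefficient. -/
def rootBracket : Bracket K N := logBracket rootEta

lemma strongJacobi_rootBracket : StrongJacobi (rootBracket : Bracket K N) :=
  strongJacobi_logBracket rootEta_symm

/-- Only diagonal pairs of roots and pairs of a root with `b_N` contribute. For a pair with `b_N`
the sum over the roots is an Euler sum, so for coefficients of the numerator, denominator or `z` it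
is a multiple of the coefficient itself. -/
lemma two_smul_rootBracket [CharZero K] {f g : DiffFun K N} (hf : OrderZero f) (hg : OrderZero g)
    {e e' s s' : DiffFun K N} (he : ∑ j, root j * partialD (rootVar j, 0) f = e)
    (he' : ∑ j, root j * partialD (rootVar j, 0) g = e')
    (hs : lead * partialD (Sum.inr (Fin.last N), 0) f = s)
    (hs' : lead * partialD (Sum.inr (Fin.last N), 0) g = s') :
    (2 : K) • localBracket rootBracket f g = lk
      (2 * (∑ i, (root (Sum.inr i) * partialD (rootVar (Sum.inr i), 0) f) *
          (root (Sum.inr i) * partialD (rootVar (Sum.inr i), 0) g) -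
        ∑ i, (root (Sum.inl i) * partialD (rootVar (Sum.inl i), 0) f) *
          (root (Sum.inl i) * partialD (rootVar (Sum.inl i), 0) g)) - (e * s' + s * e'))
      (2 * (∑ i, (root (Sum.inr i) * partialD (rootVar (Sum.inr i), 0) f) *
          dx (root (Sum.inr i) * partialD (rootVar (Sum.inr i), 0) g) -
        ∑ i, (root (Sum.inl i) * partialD (rootVar (Sum.inl i), 0) f) *
          dx (root (Sum.inl i) * partialD (rootVar (Sum.inl i), 0) g)) - (e * dx s' + s * dx e')) := by
  rw [rootBracket, hf.localBracket_logBracket hg, sum_rootEta]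
  subst he he' hs hs'
  simp only [smul_sub, smul_smul, mul_inv_cancel₀ (two_ne_zero : (2 : K) ≠ 0), one_smul, xy_eq_lk, lk_sum,
    lk_add, lk_sub, smul_lk, two_smul_eq, map_sum, Finset.sum_add_distrib, Finset.sum_mul,
    Finset.mul_sum, mul_sub]
  rfl

end RatToda
end

open scoped LaurentSeries
noncomputable section
namespace RatToda
variable {K : Type*} [Field K] {N : ℕ}
open Kernel

/-! ### The second bracket in zeros, poles and leading coefficient -/

lemma partialD_last_root (j : Fin (N + 1) ⊕ Fin N) :
    partialD (Sum.inr (Fin.last N), 0) (root j : DiffFun K N) = 0 := by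
  rw [root, partialD_jet, if_neg]
  intro h
  exact rootVar_ne_last j (Prod.ext_iff.mp h).1

/-- `b_N ∂/∂b_N` with zeros and poles fixed. -/
def leadOp (f : WSeries K N) : WSeries K N :=
  f.map ((lead : DiffFun K N) • partialD (Sum.inr (Fin.last N), 0))

lemma isLeibniz_leadOp : IsLeibniz (leadOp : WSeries K N → WSeries K N) := isLeibniz_map _

lemma leadOp_lin (j : Fin (N + 1) ⊕ Fin N) : leadOp (lin (root j)) = (0 : WSeries K N) := by
  rw [leadOp, map_lin, Derivation.smul_apply, partialD_last_root, smul_zero, wMon_zero, neg_zero]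

lemma leadOp_lead : leadOp (wMon 0 lead) = (wMon 0 1 * wMon 0 lead : WSeries K N) := by
  rw [leadOp, map_wMon, Derivation.smul_apply, wMon_zero_one, one_mul]
  conv_lhs => rw [lead, partialD_jet, if_pos rfl, smul_eq_mul, mul_one]
  rfl

lemma leadOp_qRoot : leadOp qRoot = (0 : WSeries K N) :=
  leibniz_qRoot_eq_zero isLeibniz_leadOp fun _ => leadOp_lin _

lemma leadOp_pRoot : leadOp pRoot = (pRoot : WSeries K N) := by
  rw [leibniz_pRoot isLeibniz_leadOp (κ := 1) leadOp_lead fun _ => leadOp_lin _, wMon_zero_one, one_mul]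

lemma leadOp_zRoot : leadOp zRoot = (-zRoot : WSeries K N) := by
  rw [leibniz_zRoot isLeibniz_leadOp (x := 0) (y := 1) (by rw [leadOp_qRoot, zero_mul])
    (by rw [leadOp_pRoot, one_mul])]
  ring

lemma lead_partialD (F : WSeries K N) (k : ℤ) :
    lead * partialD (Sum.inr (Fin.last N), 0) (wCoeff F k) = wCoeff (leadOp F) k := rfl

lemma lead_qRoot (k : ℤ) :
    lead * partialD (Sum.inr (Fin.last N), 0) (wCoeff (qRoot : WSeries K N) k) = 0 := by
  rw [lead_partialD, leadOp_qRoot]; rfl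

lemma lead_pRoot (k : ℤ) :
    lead * partialD (Sum.inr (Fin.last N), 0) (wCoeff (pRoot : WSeries K N) k) = wCoeff pRoot k := by
  rw [lead_partialD, leadOp_pRoot]

lemma lead_zRoot (k : ℤ) :
    lead * partialD (Sum.inr (Fin.last N), 0) (wCoeff (zRoot : WSeries K N) k) = -wCoeff zRoot k := by
  rw [lead_partialD, leadOp_zRoot]; rfl

lemma partialD_qRoot_inr (i : Fin N) (k : ℤ) :
    partialD (rootVar (Sum.inr i), 0) (wCoeff (qRoot : WSeries K N) k) = 0 := by
  rw [← wCoeff_map, map_qRoot_inr]; rfl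

lemma partialD_pRoot_inl (i : Fin (N + 1)) (k : ℤ) :
    partialD (rootVar (Sum.inl i), 0) (wCoeff (pRoot : WSeries K N) k) = 0 := by
  rw [← wCoeff_map, map_pRoot_inl]; rfl

lemma euler_qRoot (k : ℤ) : ∑ j, root j * partialD (rootVar j, 0) (wCoeff (qRoot : WSeries K N) k) =
    (N + 1 - k) * wCoeff qRoot k := by
  rw [Fintype.sum_sum_type]
  simp only [partialD_qRoot_inr, mul_zero, Finset.sum_const_zero, add_zero]
  have := rootSeq_q.euler (K := K) (N := N) k
  push_cast at this
  exact this

lemma euler_pRoot (k : ℤ) : ∑ j, root j * partialD (rootVar j, 0) (wCoeff (pRoot : WSeries K N) k) =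
    (N - k) * wCoeff pRoot k := by
  rw [Fintype.sum_sum_type]
  simp only [partialD_pRoot_inl, mul_zero, Finset.sum_const_zero, zero_add]
  exact rootSeq_p.euler k

lemma euler_zRoot (k : ℤ) : ∑ j, root j * partialD (rootVar j, 0) (wCoeff (zRoot : WSeries K N) k) =
    (1 - k) * wCoeff zRoot k := by
  have := rootSeq_z.euler (K := K) (N := N) k
  rwa [Nat.cast_one] at this

lemma wCoeff_qRoot_of_neg {k : ℤ} (hk : k < 0) : wCoeff (qRoot : WSeries K N) k = 0 := by
  rw [← rootHom_a, a_of_neg hk, map_zero]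

lemma wCoeff_pRoot_of_neg {k : ℤ} (hk : k < 0) : wCoeff (pRoot : WSeries K N) k = 0 := by
  rw [← rootHom_b, b_of_neg hk, map_zero]

lemma wCoeff_zRoot_of_gt {k : ℤ} (hk : 1 < k) : wCoeff (zRoot : WSeries K N) k = 0 := by
  rw [wCoeff_zRoot, u_of_gt hk, map_zero]

lemma swap_rootBracket (v w : Var N) : swap (rootBracket v w : Kernel K N) = -rootBracket w v :=
  swap_logBracket rootEta_symm v w

lemma swap_localBracket_rootBracket (f g : DiffFun K N) :
    swap (localBracket rootBracket f g) = -localBracket rootBracket g f :=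
  swap_localBracket swap_rootBracket f g

section CharZero

variable [CharZero K]

/-- Zeros enter the log-canonical bracket with `-1`, hence the sign. The numerator does not involve
`b_N`, so the multiple `2d - k - l` with `d = N + 1` left by the telescoping stays as a correction.
-/
lemma aa2_eq (k l : ℤ) : aa2 k l = -polyQuadratic a k l +
    (((k + l - 2 * N - 2 : ℤ) : K) / 2) • (xy (a k) (a l) : Kernel K N) := by
  rw [aa2, polyQuadratic, neg_add, ← Finset.sum_neg_distrib, add_assoc, ← neg_smul, ← add_smul]
  congr 1
  · refine Finset.sum_congr rfl fun n _ => ?_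
    rw [show l + n - k = -(k - l - n) by ring, Int.cast_neg, neg_smul]
    abel
  · congr 1
    push_cast
    ring

lemma rootBracket_qRoot {k : ℤ} (hk : k ≤ N) (l : ℤ) :
    localBracket rootBracket (wCoeff qRoot k) (wCoeff qRoot l) = kmap rootHom (aa2 k l : Kernel K N) := by
  refine two_smul_cancel (K := K) ?_
  rw [two_smul_rootBracket (orderZero_qRoot k) (orderZero_qRoot l) (euler_qRoot k) (euler_qRoot l)
    (lead_qRoot k) (lead_qRoot l), aa2_eq, kmap_add, kmap_neg, kmap_polyQuadratic rootHom_dx,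
    kmap_smul', kmap_xy rootHom_dx, smul_add, two_smul_div_two, smul_neg]
  simp only [rootHom_a]
  rw [rootSeq_q.two_smul_polyQuadratic (fun k hk => wCoeff_qRoot_of_neg hk)
    (fun j k hk => by rw [wCoeff_qRoot_of_neg hk, map_zero]) hk, xy_eq_lk, smul_lk, lk_neg, lk_add,
    intCast_smul_eq, intCast_smul_eq]
  simp only [partialD_qRoot_inr, mul_zero, zero_mul, Finset.sum_const_zero, map_zero, one_mul]
  push_cast
  congr 1 <;> ring

/-- Here the pairs with `b_N`, of weight `-1/2`, contribute exactly the multiple of `b_k b_l` that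
the telescoping leaves over, so no correction appears. -/
lemma rootBracket_pRoot {k : ℤ} (hk : k ≤ N) (l : ℤ) :
    localBracket rootBracket (wCoeff pRoot k) (wCoeff pRoot l) = kmap rootHom (bb2 k l : Kernel K N) := by
  refine two_smul_cancel (K := K) ?_
  change _ = (2 : K) • kmap rootHom (polyQuadratic b k l)
  rw [two_smul_rootBracket (orderZero_pRoot k) (orderZero_pRoot l) (euler_pRoot k) (euler_pRoot l)
    (lead_pRoot k) (lead_pRoot l), kmap_polyQuadratic rootHom_dx]
  simp only [rootHom_b]
  rw [rootSeq_p.two_smul_polyQuadratic (fun k hk => wCoeff_pRoot_of_neg hk)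
    (fun j k hk => by rw [wCoeff_pRoot_of_neg hk, map_zero]) hk]
  simp only [partialD_pRoot_inl, mul_zero, Finset.sum_const_zero, map_zero, one_mul,
    Derivation.leibniz, map_sub, Derivation.map_natCast, Derivation.map_intCast, smul_eq_mul]
  congr 1 <;> ring

/-- Zeros commute with poles, so only zeros paired with `b_N` contribute, through the degree `N + 1
- k` of `a_k` in the zeros. -/
lemma rootBracket_qRoot_pRoot (k l : ℤ) :
    localBracket rootBracket (wCoeff qRoot k) (wCoeff pRoot l) = kmap rootHom (ab2 k l : Kernel K N) := by
  refine two_smul_cancel (K := K) ?_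
  rw [two_smul_rootBracket (orderZero_qRoot k) (orderZero_pRoot l) (euler_qRoot k) (euler_pRoot l)
    (lead_qRoot k) (lead_pRoot l), ab2, kmap_smul', kmap_xy rootHom_dx, two_smul_div_two, rootHom_a,
    rootHom_b, xy_eq_lk, smul_lk, intCast_smul_eq, intCast_smul_eq]
  simp only [partialD_pRoot_inl, partialD_qRoot_inr, mul_zero, zero_mul, Finset.sum_const_zero,
    map_zero]
  push_cast
  congr 1 <;> ring

/-- The signs `-1` for zeros and `+1` for poles are opposite to their exponents in `z`, so one
telescoping covers both. The dependence of `z` on `1/b_N` makes the remaining multiple cancel. -/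
lemma rootBracket_zRoot {n : ℤ} (hn : n ≤ 1) (m : ℤ) :
    localBracket rootBracket (wCoeff zRoot n) (wCoeff zRoot m) =
      kmap rootHom (genericQuadratic n m : Kernel K N) := by
  refine two_smul_cancel (K := K) ?_
  change _ = (2 : K) • kmap rootHom (seriesQuadratic u n m)
  rw [two_smul_rootBracket (orderZero_zRoot n) (orderZero_zRoot m) (euler_zRoot n) (euler_zRoot m)
    (lead_zRoot n) (lead_zRoot m), kmap_seriesQuadratic rootHom_dx]
  simp only [← wCoeff_zRoot]
  rw [rootSeq_z.two_smul_seriesQuadratic (fun k hk => wCoeff_zRoot_of_gt hk)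
    (fun j k hk => by rw [wCoeff_zRoot_of_gt hk, map_zero]) hn]
  simp only [Fintype.sum_sum_type, rootSign, one_mul, neg_one_mul, Finset.sum_neg_distrib,
    Derivation.leibniz, map_sub, map_neg, Derivation.map_intCast,
    Derivation.map_one_eq_zero, smul_eq_mul, Nat.cast_one]
  congr 1 <;> ring

lemma rootBracket_fields (v w : Var N) :
    localBracket rootBracket (rootHom (jet (v, 0))) (rootHom (jet (w, 0))) =
      kmap rootHom (bracket2 v w : Kernel K N) := by
  simp only [rootHom_jet]
  rcases v with k | k <;> rcases w with l | l
  · exact rootBracket_qRoot (by omega) _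
  · exact rootBracket_qRoot_pRoot _ _
  · rw [bracket2, kmap_neg, kmap_swap rootHom_dx, ← rootBracket_qRoot_pRoot,
      swap_localBracket_rootBracket, neg_neg]
    rfl
  · exact rootBracket_pRoot (by omega) _

lemma strongJacobi_bracket2 : StrongJacobi (bracket2 : Bracket K N) :=
  StrongJacobi.comap rootHom_dx rootBracket_fields rootHom_injective strongJacobi_rootBracket

lemma swap_bracket2 (v w : Var N) : swap (bracket2 v w : Kernel K N) = -bracket2 w v := by
  apply kmap_injective rootHom rootHom_injective
  rw [kmap_swap rootHom_dx, kmap_neg, ← rootBracket_fields, ← rootBracket_fields,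
    swap_localBracket_rootBracket]

/-- The second bracket induces the quadratic Toda bracket. -/
lemma bracket2_u {n : ℤ} (hn : n ≤ 1) (m : ℤ) :
    localBracket bracket2 (u n) (u m) = (genericQuadratic n m : Kernel K N) := by
  apply kmap_injective rootHom rootHom_injective
  rw [← localBracket_map rootHom_dx rootBracket_fields]
  exact rootBracket_zRoot hn m

end CharZero

end RatToda
end

open scoped LaurentSeries
noncomputable section
namespace RatToda
variable {K : Type*} [Field K] {N : ℕ}
open Kernel

/-! ### The shift `z ↦ z + ε` -/

lemma xy_add_left (f f' g : DiffFun K N) : xy (f + f') g = xy f g + xy f' g := by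
  rw [xy_eq, xy_eq, xy_eq, add_smul]

lemma xy_add_right (f g g' : DiffFun K N) : xy f (g + g') = xy f g + xy f g' := by
  rw [xy_eq, xy_eq, xy_eq, mulY_add_left, smul_add]

lemma mulY_smul_left (r : K) (g : DiffFun K N) (A : Kernel K N) :
    mulY (r • g) A = r • mulY g A := by
  rw [Algebra.smul_def, mul_comm, ← mulY_mulY, mulY_of_dx_eq_zero (Derivation.map_algebraMap dx r),
    mulY_smul, ← algebra_smul_eq]

lemma xy_smul_left (r : K) (f g : DiffFun K N) : xy (r • f) g = r • xy f g := by
  rw [xy_eq, xy_eq, smul_assoc]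

lemma xy_smul_right (r : K) (f g : DiffFun K N) : xy f (r • g) = r • xy f g := by
  rw [xy_eq, xy_eq, mulY_smul_left, smul_comm]

/-- The polarization of `polyQuadratic`. -/
def polyBilinear (f g : ℤ → DiffFun K N) (k l : ℤ) : Kernel K N :=
  (∑ n ∈ Finset.Icc (1 : ℤ) N,
    (((k - l - n : ℤ) : K) • xy (f (k - n)) (g (l + n)) -
      (n : K) • mulY (f (k - n)) (mulX (g (l + n)) delta'))) +
  (((k - l : ℤ) : K) / 2) • xy (f k) (g l)

lemma polyQuadratic_add_smul (f g : ℤ → DiffFun K N) (r : K) (k l : ℤ) :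
    polyQuadratic (fun n => f n + r • g n) k l = polyQuadratic f k l +
      r • (polyBilinear f g k l + polyBilinear g f k l) + (r * r) • polyQuadratic g k l := by
  simp only [polyQuadratic, polyBilinear, smul_add, Finset.smul_sum, xy_add_left, xy_add_right,
    xy_smul_left, xy_smul_right, mulX_eq_smul, add_smul, smul_assoc, mulY_add, mulY_add_left,
    mulY_smul_left]
  have e : ∀ A B C D A' B' C' D' : Kernel K N, A + B + (C + D + (A' + B')) + (C' + D') =
    (A + C + A' + C') + (B + D + B' + D') := fun _ _ _ _ _ _ _ _ => by abel
  rw [e, ← Finset.sum_add_distrib, ← Finset.sum_add_distrib, ← Finset.sum_add_distrib]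
  congr 1
  · refine Finset.sum_congr rfl fun n _ => ?_
    have h : ∀ (h : DiffFun K N) A, mulY h (r • A) = r • mulY h A := fun h A => by
      rw [algebra_smul_eq, mulY_smul, ← algebra_smul_eq]
    simp only [h]
    module
  · module

/-- The part of the first bracket that matters is the polarization of the quadratic one between
numerator and denominator, which is what a shift of `a` by `ε b` produces. -/
lemma aa1_eq (k l : ℤ) : aa1 k l = polyBilinear a b k l + polyBilinear b a k l +
    (((N + 1 - k : ℤ) : K) / 2) • xy (b k) (a l) +
    (((N + 1 - l : ℤ) : K) / 2) • (xy (a k) (b l) : Kernel K N) := by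
  have e : ∀ A B C D : Kernel K N, A + B + (C + D) = A + C + (B + D) := fun _ _ _ _ => by abel
  rw [aa1, polyBilinear, polyBilinear, e, ← Finset.sum_add_distrib]
  simp only [add_assoc]
  congr 1
  · exact Finset.sum_congr rfl fun n _ => by module
  · push_cast
    module

lemma ab1_eq [CharZero K] (k l : ℤ) : ab1 k l = bb2 k l -
    (((k - N - 1 : ℤ) : K) / 2) • (xy (b k) (b l) : Kernel K N) := by
  rw [ab1, bb2]
  push_cast
  module

/-- The images of the fields under `z ↦ z + ε`. -/
def shiftVal (ε : K) : Var N → DiffFun K N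
  | Sum.inl k => jet (Sum.inl k, 0) + ε • jet (Sum.inr k, 0)
  | Sum.inr l => jet (Sum.inr l, 0)

/-- The substitution `z ↦ z + ε`. -/
def shiftHom (ε : K) : DiffFun K N →ₐ[K] DiffFun K N := fieldHom (shiftVal ε) isUnit_lead

lemma shiftHom_dx (ε : K) (f : DiffFun K N) : shiftHom ε (dx f) = dx (shiftHom ε f) :=
  fieldHom_dx _ _ f

lemma shiftHom_jet (ε : K) (v : Var N) : shiftHom ε (jet (v, 0)) = shiftVal ε v :=
  fieldHom_jet _ _ _

lemma a_induction {C : ℤ → Prop} (hneg : ∀ k < 0, C k) (hmid : ∀ k : Fin (N + 1), C (k : ℕ))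
    (htop : C (N + 1)) (hgt : ∀ k : ℤ, N + 1 < k → C k) (k : ℤ) : C k := by
  rcases lt_trichotomy k (N + 1) with h | rfl | h
  · rcases lt_or_ge k 0 with h0 | h0
    · exact hneg k h0
    · obtain ⟨m, rfl⟩ := Int.eq_ofNat_of_zero_le h0
      exact hmid ⟨m, by omega⟩
  · exact htop
  · exact hgt k h

lemma shiftHom_b (ε : K) (k : ℤ) : shiftHom ε (b k : DiffFun K N) = b k := by
  induction k using a_induction (N := N) with
  | hneg k hk => rw [b_of_neg hk, map_zero]
  | hmid k => rw [b_fin, shiftHom_jet]; rfl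
  | htop => rw [b_of_gt (by omega), map_zero]
  | hgt k hk => rw [b_of_gt (by omega), map_zero]

lemma shiftHom_a (ε : K) (k : ℤ) : shiftHom ε (a k : DiffFun K N) = a k + ε • b k := by
  induction k using a_induction (N := N) with
  | hneg k hk => rw [a_of_neg hk, b_of_neg hk, map_zero, smul_zero, add_zero]
  | hmid k => rw [a_fin, b_fin, shiftHom_jet]; rfl
  | htop => rw [a_top, b_of_gt (by omega), map_one, smul_zero, add_zero]
  | hgt k hk => rw [a_of_gt hk, b_of_gt (by omega), map_zero, smul_zero, add_zero]

lemma algHom_ext_of_comm {φ ψ : DiffFun K N →ₐ[K] DiffFun K N} (hφ : ∀ f, φ (dx f) = dx (φ f))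
    (hψ : ∀ f, ψ (dx f) = dx (ψ f)) (h : ∀ v, φ (jet (v, 0)) = ψ (jet (v, 0))) (f : DiffFun K N) :
    φ f = ψ f := by
  have hjet : ∀ v, φ (jet v) = ψ (jet v) := fun v => by
    rw [← dx_iterate_jet v.1 v.2, map_dx_iterate hφ, map_dx_iterate hψ, h]
  have hp : (φ : DiffFun K N →+* DiffFun K N).comp (algebraMap (JetPoly K N) _) =
      (ψ : DiffFun K N →+* DiffFun K N).comp (algebraMap (JetPoly K N) _) := by
    refine MvPolynomial.ringHom_ext (fun r => ?_) hjet
    change φ (algebraMap (JetPoly K N) _ (algebraMap K _ r)) =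
      ψ (algebraMap (JetPoly K N) _ (algebraMap K _ r))
    rw [← IsScalarTower.algebraMap_apply, AlgHom.commutes, AlgHom.commutes]
  exact RingHom.congr_fun (IsLocalization.ringHom_ext (Submonoid.powers (bTop K N)) hp) f

lemma shiftHom_shiftHom_neg (ε : K) (f : DiffFun K N) : shiftHom ε (shiftHom (-ε) f) = f := by
  refine algHom_ext_of_comm (φ := (shiftHom ε).comp (shiftHom (-ε))) (ψ := AlgHom.id K _)
    (fun f => ?_) (fun _ => rfl) (fun v => ?_) f
  · simp only [AlgHom.comp_apply, shiftHom_dx]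
  · simp only [AlgHom.comp_apply, shiftHom_jet, AlgHom.id_apply]
    rcases v with k | l
    · simp only [shiftVal, map_add, map_smul, shiftHom_jet]
      module
    · simp only [shiftVal, shiftHom_jet]

lemma shiftHom_surjective (ε : K) : Function.Surjective (shiftHom ε : DiffFun K N → DiffFun K N) :=
  fun f => ⟨_, shiftHom_shiftHom_neg ε f⟩

/-- The members `s {·,·}₁ + t {·,·}₂` of the pencil. -/
def pencil (s t : K) : Bracket K N := fun v w => s • bracket1 v w + t • bracket2 v w

section CharZero

variable [CharZero K]

lemma swap_bb2 (k l : Fin (N + 1)) :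
    swap (bb2 (k : ℕ) (l : ℕ) : Kernel K N) = -bb2 (l : ℕ) (k : ℕ) :=
  swap_bracket2 (Sum.inr k) (Sum.inr l)

/-- Since `z + ε = (q + ε p)/p`, only the numerator coefficients move. Expanding in `ε`, the
polarized terms of the `a`-`a` bracket assemble into the first bracket, and the terms in `ε²` match
because `{a_k, b_l}_1` and `{b_k, b_l}_2` differ by a multiple of `b_k(x) b_l(y) δ'`. -/
lemma shift_bracket (ε : K) (v w : Var N) :
    localBracket (pencil (-ε) 1) (shiftHom ε (jet (v, 0))) (shiftHom ε (jet (w, 0))) =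
      kmap (shiftHom ε) (bracket2 v w : Kernel K N) := by
  have hab : ∀ k l : Fin (N + 1), (localBracket (pencil (-ε) 1) (shiftHom ε (jet (Sum.inl k, 0)))
      (shiftHom ε (jet (Sum.inr l, 0))) : Kernel K N) =
      kmap (shiftHom ε) (bracket2 (Sum.inl k) (Sum.inr l) : Kernel K N) := by
    intro k l
    simp only [shiftHom_jet, shiftVal, localBracket_add_left, localBracket_smul_left,
      localBracket_jet, pencil, bracket1, bracket2, ab1_eq, ab2, kmap_smul', kmap_xy (shiftHom_dx ε),
      shiftHom_a, shiftHom_b, xy_add_left, xy_smul_left]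
    module
  rcases v with k | k <;> rcases w with l | l
  · have hswap : swap (ab1 (l : ℕ) (k : ℕ)) = -bb2 (k : ℕ) (l : ℕ) +
        (((l - N - 1 : ℤ) : K) / 2) • (xy (b (k : ℕ)) (b (l : ℕ)) : Kernel K N) := by
      rw [ab1_eq, swap_sub, swap_bb2, swap_smul', swap_xy]
      module
    simp only [shiftHom_jet, shiftVal, localBracket_add_left, localBracket_smul_left,
      localBracket_add_right, localBracket_smul_right, localBracket_jet, pencil, bracket1, bracket2,
      hswap]
    simp only [aa2_eq, ab1_eq, ab2, kmap_add, kmap_neg, kmap_polyQuadratic (shiftHom_dx ε), kmap_smul',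
      kmap_xy (shiftHom_dx ε), shiftHom_a, polyQuadratic_add_smul, swap_smul', swap_xy, aa1_eq,
      xy_add_left, xy_add_right, xy_smul_left, xy_smul_right]
    change _ = -(_ + _ + (ε * ε) • bb2 _ _) + _
    push_cast
    module
  · exact hab k l
  · simp only [shiftHom_jet, shiftVal, localBracket_add_right, localBracket_smul_right,
      localBracket_jet, pencil, bracket1, bracket2, ab1_eq, ab2, kmap_smul', kmap_neg, swap_smul',
      swap_sub, swap_bb2, swap_xy, kmap_xy (shiftHom_dx ε), shiftHom_a, shiftHom_b, xy_add_right,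
      xy_smul_right]
    module
  · simp only [shiftHom_jet, shiftVal, localBracket_jet, pencil, bracket1, bracket2]
    change _ = kmap (shiftHom ε) (polyQuadratic _ _ _)
    rw [kmap_polyQuadratic (shiftHom_dx ε)]
    simp only [shiftHom_b, smul_zero, zero_add, one_smul]
    rfl

end CharZero

end RatToda
end

open scoped LaurentSeries
noncomputable section
namespace RatToda
variable {K : Type*} [Field K] {N : ℕ}
open Kernel

/-! ### The pencil and the linear Toda bracket -/

lemma localBracket_pencil (s t : K) (f g : DiffFun K N) :
    localBracket (pencil s t) f g = s • localBracket bracket1 f g + t • localBracket bracket2 f g := by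
  have h : ∀ (A : Kernel K N) (r : K) (B : Kernel K N), opComp A (r • B) = r • opComp A B := by
    intro A r B
    rw [algebra_smul_eq, Polynomial.smul_eq_C_mul, ← Polynomial.smul_eq_C_mul, ← opComp_C, ← opComp_assoc,
      ← mulY_eq_comp, mulY_of_dx_eq_zero (Derivation.map_algebraMap dx r), opComp_smul, ← algebra_smul_eq]
  have h' : ∀ (A : Kernel K N) (r : K) (B : Kernel K N), opComp (r • A) B = r • opComp A B := by
    intro A r B
    rw [algebra_smul_eq, opComp_smul, ← algebra_smul_eq]
  simp only [localBracket_eq, pencil, opComp_add_right, opComp_add_left, h, h', Finset.sum_add_distrib,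
    ← Finset.smul_sum]

lemma integrateX_smul' (r : K) (A : Kernel K N) : integrateX (r • A) = r • integrateX A := by
  rw [algebra_smul_eq, integrateX_smul, act, mulY_of_dx_eq_zero (Derivation.map_algebraMap dx r),
    Polynomial.coeff_smul, ← integrateX_swap, swap_swap, algebraMap_smul]

lemma functionalBracket_pencil (s t : K) (f g : DiffFun K N) : functionalBracket (pencil s t) f g =
    s • functionalBracket bracket1 f g + t • functionalBracket bracket2 f g := by
  simp only [functionalBracket, localBracket_pencil, integrateX_add, integrateX_smul']

lemma functionalBracket_add_left (P : Bracket K N) (f f' g : DiffFun K N) :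
    functionalBracket P (f + f') g = functionalBracket P f g + functionalBracket P f' g := by
  simp only [functionalBracket, localBracket_add_left, integrateX_add]

lemma functionalBracket_add_right (P : Bracket K N) (f g g' : DiffFun K N) :
    functionalBracket P f (g + g') = functionalBracket P f g + functionalBracket P f g' := by
  simp only [functionalBracket, localBracket_add_right, integrateX_add]

lemma functionalBracket_smul_left (P : Bracket K N) (r : K) (f g : DiffFun K N) :
    functionalBracket P (r • f) g = r • functionalBracket P f g := by
  simp only [functionalBracket, localBracket_smul_left, integrateX_smul']

lemma functionalBracket_smul_right (P : Bracket K N) (r : K) (f g : DiffFun K N) :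
    functionalBracket P f (r • g) = r • functionalBracket P f g := by
  simp only [functionalBracket, localBracket_smul_right, integrateX_smul']

lemma shiftHom_u (ε : K) (n : ℤ) : shiftHom ε (u n : DiffFun K N) =
    u n + if n = 0 then algebraMap K _ ε else 0 := by
  have hz : mapHom (shiftHom ε) z = z + wMon 0 (algebraMap K (DiffFun K N) ε) := by
    apply isUnit_pSer.mul_left_cancel
    have hp : mapHom (shiftHom ε) pSer = (pSer : WSeries K N) := wSeries_ext fun n => by
      rw [wCoeff_mapHom, wCoeff_pSer, shiftHom_b]
    have hq : mapHom (shiftHom ε) qSer = qSer + wMon 0 (algebraMap K (DiffFun K N) ε) * pSer :=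
      wSeries_ext fun n => by
        rw [wCoeff_mapHom, wCoeff_add, wCoeff_wMon_mul, sub_zero, wCoeff_pSer, wCoeff_qSer,
          shiftHom_a, Algebra.smul_def]
    have := congrArg (mapHom (shiftHom ε)) (pSer_mul_z (K := K) (N := N))
    rw [map_mul, hp, hq] at this
    rw [this, ← pSer_mul_z]
    ring
  have := congrArg (wCoeff · n) hz
  rwa [wCoeff_add, wCoeff_wMon] at this

lemma localBracket_add_const (P : Bracket K N) (f g : DiffFun K N) (r s : K) :
    localBracket P (f + algebraMap K _ r) (g + algebraMap K _ s) = localBracket P f g := by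
  rw [localBracket_add_left, localBracket_add_right, localBracket_algebraMap_left,
    localBracket_algebraMap_right, add_zero, add_zero]

/-- `2 c_n` as a differential function. -/
def twoC (n : ℤ) : DiffFun K N := if 0 < n then 2 else if n = 0 then 1 else 0

/-- Shifting `u_0` by `1` changes only the summands `k = -n` and `k = m`, and their contributions
are multiples of `f (n + m)`. The product of the two constants occurs only for `n + m = 0`, where
its weight vanishes. Which of the two indices lies in the range, together with the half terms for `n
= 0` or `m = 0`, is recorded by `twoC`. -/
lemma quadratic_shift_delta' {f : ℤ → DiffFun K N} (hf : ∀ k > 1, f k = 0) {n : ℤ} (hn : n ≤ 1)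
    (m : ℤ) :
    (n - m : DiffFun K N) * ((f n + if n = 0 then 1 else 0) * (f m + if m = 0 then 1 else 0)) +
      2 * ∑ k ∈ Finset.Icc 1 (1 - n), ((n - m + 2 * k : ℤ) : DiffFun K N) *
        ((f (n + k) + if n + k = 0 then 1 else 0) * (f (m - k) + if m - k = 0 then 1 else 0)) =
    (n - m : DiffFun K N) * (f n * f m) + 2 * ∑ k ∈ Finset.Icc 1 (1 - n), ((n - m + 2 * k : ℤ) : DiffFun K N) *
        (f (n + k) * f (m - k)) + (twoC n + twoC m - 2) * ((n + m : DiffFun K N) * f (n + m)) := by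
  have e : ∀ k ∈ Finset.Icc 1 (1 - n), ((n - m + 2 * k : ℤ) : DiffFun K N) *
        ((f (n + k) + if n + k = 0 then 1 else 0) * (f (m - k) + if m - k = 0 then 1 else 0)) =
      ((n - m + 2 * k : ℤ) : DiffFun K N) * (f (n + k) * f (m - k)) +
        (if k = -n then -(n + m : DiffFun K N) * f (n + m) else 0) + (if k = m then (n + m : DiffFun K N) * f (n + m) else 0) := by
    intro k _
    by_cases h1 : k = -n
    · subst h1
      by_cases h2 : -n = m
      · subst h2; simp; right; ring
      · simp [h2, show ¬ n + m = 0 by omega, add_comm m n]; ring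
    · by_cases h2 : k = m
      · subst h2
        simp [h1, show ¬ n + k = 0 by omega]; ring
      · simp [h1, h2, show ¬ n + k = 0 by omega, show ¬ m - k = 0 by omega]
  rw [Finset.sum_congr rfl e, Finset.sum_add_distrib, Finset.sum_add_distrib, Finset.sum_ite_eq',
    Finset.sum_ite_eq']
  simp only [Finset.mem_Icc, twoC]
  generalize ∑ k ∈ Finset.Icc 1 (1 - n), ((n - m + 2 * k : ℤ) : DiffFun K N) *
    (f (n + k) * f (m - k)) = S
  rcases eq_or_ne n 0 with rfl | h1
  · rcases eq_or_ne m 0 with rfl | h2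
    · split_ifs <;> first | omega | (push_cast; ring)
    · by_cases hm : 1 < m
      · rw [zero_add, hf m hm]
        split_ifs <;> first | omega | (push_cast; ring)
      · rw [zero_add]
        split_ifs <;> first | omega | (push_cast; ring)
  · rcases eq_or_ne m 0 with rfl | h2
    · rw [add_zero]
      split_ifs <;> first | omega | (push_cast; ring)
    · by_cases hnm : 1 < n + m
      · rw [hf _ hnm]
        split_ifs <;> first | omega | ring
      · split_ifs <;> first | omega | ring

/-- As for `δ'`, except that differentiated factors do not feel the shift, so no product of two
constants arises. -/
lemma quadratic_shift_delta {f : ℤ → DiffFun K N} (hf : ∀ k > 1, f k = 0) {n : ℤ} (hn : n ≤ 1)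
    (m : ℤ) :
    (n - m : DiffFun K N) * ((f n + if n = 0 then 1 else 0) * dx (f m)) +
      2 * ∑ k ∈ Finset.Icc 1 (1 - n), (((n - m + k : ℤ) : DiffFun K N) *
        ((f (n + k) + if n + k = 0 then 1 else 0) * dx (f (m - k))) +
        (k : DiffFun K N) * (dx (f (n + k)) * (f (m - k) + if m - k = 0 then 1 else 0))) =
    (n - m : DiffFun K N) * (f n * dx (f m)) + 2 * ∑ k ∈ Finset.Icc 1 (1 - n),
      (((n - m + k : ℤ) : DiffFun K N) * (f (n + k) * dx (f (m - k))) +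
        (k : DiffFun K N) * (dx (f (n + k)) * f (m - k))) + (twoC n + twoC m - 2) * ((m : DiffFun K N) * dx (f (n + m))) := by
  have e : ∀ k ∈ Finset.Icc 1 (1 - n), (((n - m + k : ℤ) : DiffFun K N) *
        ((f (n + k) + if n + k = 0 then 1 else 0) * dx (f (m - k))) +
        (k : DiffFun K N) * (dx (f (n + k)) * (f (m - k) + if m - k = 0 then 1 else 0))) =
      (((n - m + k : ℤ) : DiffFun K N) * (f (n + k) * dx (f (m - k))) +
        (k : DiffFun K N) * (dx (f (n + k)) * f (m - k))) +
        (if k = -n then -(m : DiffFun K N) * dx (f (n + m)) else 0) + (if k = m then (m : DiffFun K N) * dx (f (n + m)) else 0) := by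
    intro k _
    by_cases h1 : k = -n
    · subst h1
      by_cases h2 : -n = m
      · subst h2; simp; ring
      · simp [h2, show ¬ n + m = 0 by omega, add_comm m n]; ring
    · by_cases h2 : k = m
      · subst h2
        simp [h1, show ¬ n + k = 0 by omega]; ring
      · simp [h1, h2, show ¬ n + k = 0 by omega, show ¬ m - k = 0 by omega]
  rw [Finset.sum_congr rfl e, Finset.sum_add_distrib, Finset.sum_add_distrib, Finset.sum_ite_eq',
    Finset.sum_ite_eq']
  simp only [Finset.mem_Icc, twoC]
  generalize ∑ k ∈ Finset.Icc 1 (1 - n), (((n - m + k : ℤ) : DiffFun K N) *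
    (f (n + k) * dx (f (m - k))) + (k : DiffFun K N) * (dx (f (n + k)) * f (m - k))) = S
  rcases eq_or_ne n 0 with rfl | h1
  · rcases eq_or_ne m 0 with rfl | h2
    · split_ifs <;> first | omega | (push_cast; ring)
    · by_cases hm : 1 < m
      · rw [zero_add, hf m hm]
        split_ifs <;> first | omega | (simp only [map_zero]; push_cast; ring)
      · rw [zero_add]
        split_ifs <;> first | omega | (push_cast; ring)
  · rcases eq_or_ne m 0 with rfl | h2
    · rw [add_zero]
      split_ifs <;> first | omega | (push_cast; ring)
    · by_cases hnm : 1 < n + m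
      · rw [hf _ hnm]
        split_ifs <;> first | omega | (simp only [map_zero]; ring)
      · split_ifs <;> first | omega | ring

section CharZero

variable [CharZero K]

lemma strongJacobi_pencil_one (ε : K) : StrongJacobi (pencil (-ε) 1 : Bracket K N) :=
  StrongJacobi.map (shiftHom_dx ε) (shift_bracket ε) (shiftHom_surjective ε) strongJacobi_bracket2

/-- The Jacobiator of the pencil is a quadratic form `s² X + s t Y + t² Z`. It vanishes at `(0, 1)`,
`(-1, 1)` and `(1, 1)` by the shift argument, which forces `Z`, `X` and `Y` to vanish in turn. -/
lemma strongJacobi_pencil (s t : K) : StrongJacobi (pencil s t : Bracket K N) := by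
  intro f g h
  let F := functionalBracket (bracket1 : Bracket K N)
  let G := functionalBracket (bracket2 : Bracket K N)
  let X := F (F f g) h - (F f (F g h) - F g (F f h))
  let Y := F (G f g) h + G (F f g) h - (F f (G g h) + G f (F g h) - (F g (G f h) + G g (F f h)))
  let Z := G (G f g) h - (G f (G g h) - G g (G f h))
  have key : ∀ s t : K, functionalBracket (pencil s t) (functionalBracket (pencil s t) f g) h -
      (functionalBracket (pencil s t) f (functionalBracket (pencil s t) g h) -
      functionalBracket (pencil s t) g (functionalBracket (pencil s t) f h)) =
      (s * s) • X + (s * t) • Y + (t * t) • Z := by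
    intro s t
    simp only [functionalBracket_pencil, functionalBracket_add_left, functionalBracket_add_right,
      functionalBracket_smul_left, functionalBracket_smul_right, X, Y, Z, F, G]
    module
  have h0 := key (-0) 1
  have h1 := key (-1) 1
  have h2 := key (-(-1)) 1
  rw [sub_eq_zero.mpr (strongJacobi_pencil_one _ f g h)] at h0 h1 h2
  have hZ : Z = 0 := by rw [h0]; module
  rw [hZ] at h1 h2
  have hX : X = 0 := two_smul_cancel (K := K) (by
    rw [smul_zero, ← add_zero (0 : DiffFun K N)]
    calc (2 : K) • X = ((-1 * -1 : K) • X + (-1 * 1 : K) • Y + (1 * 1 : K) • 0) +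
          ((- -1 * - -1 : K) • X + (- -1 * 1 : K) • Y + (1 * 1 : K) • 0) := by module
      _ = 0 + 0 := by rw [← h1, ← h2])
  have hY : Y = 0 := by
    rw [hX] at h2
    rw [h2]; module
  rw [← sub_eq_zero, key, hX, hY, hZ]
  simp

/-- The combination of the second bracket minus the first is an image of the second under the shift,
hence skew; subtracting the skew second bracket isolates the first. -/
lemma swap_bracket1 (v w : Var N) : swap (bracket1 v w : Kernel K N) = -bracket1 w v := by
  have h : ∀ v w, swap (pencil (-1) 1 v w : Kernel K N) = -pencil (-1) 1 w v := by
    intro v w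
    rw [← localBracket_jet (pencil (-1) 1) v w, ← localBracket_jet (pencil (-1) 1) w v,
      ← shiftHom_shiftHom_neg 1 (jet (v, 0)), ← shiftHom_shiftHom_neg 1 (jet (w, 0)),
      localBracket_map (shiftHom_dx 1) (shift_bracket 1),
      localBracket_map (shiftHom_dx 1) (shift_bracket 1), ← kmap_swap (shiftHom_dx 1),
      swap_localBracket swap_bracket2, kmap_neg]
  have := h v w
  simp only [pencil, swap_add, swap_bracket2, one_smul, neg_smul] at this
  rw [neg_add, add_left_inj, swap_neg] at this
  exact neg_injective this

lemma isPoisson_pencil (s t : K) : IsPoisson (pencil s t : Bracket K N) := by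
  refine isPoisson_of (fun v w => ?_) (strongJacobi_pencil s t)
  simp only [pencil, swap_add, swap_smul', swap_bracket1, swap_bracket2]
  module

lemma smul_c_eq (n m : ℤ) (y : DiffFun K N) :
    (2 * (c n + c m - 1) : K) • y = (twoC n + twoC m - 2) * y := by
  have h : ∀ n, algebraMap K (DiffFun K N) (2 * c n) = twoC n := fun n => by
    rw [c, twoC]
    split_ifs
    · rw [mul_one, map_ofNat]
    · rw [mul_inv_cancel₀ two_ne_zero, map_one]
    · rw [mul_zero, map_zero]
  rw [mul_sub, mul_add, mul_one, Algebra.smul_def, map_sub, map_add, h, h, map_ofNat]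

lemma seriesQuadratic_shift {n : ℤ} (hn : n ≤ 1) (m : ℤ) :
    seriesQuadratic (fun k => u k + if k = 0 then 1 else 0) n m =
      seriesQuadratic u n m + (2⁻¹ : K) • (genericLinear n m : Kernel K N) := by
  have hd : ∀ k : ℤ, dx (u k + if k = 0 then 1 else 0 : DiffFun K N) = dx (u k) := fun k => by
    rw [map_add]; split_ifs <;> simp
  refine two_smul_cancel (K := K) ?_
  rw [smul_add, smul_smul, mul_inv_cancel₀ (two_ne_zero : (2 : K) ≠ 0), one_smul, genericLinear]
  simp only [seriesQuadratic, hd, mulX_delta'_eq_lk, mulX_delta_eq_lk, lk_add, smul_lk, smul_add,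
    two_smul_div_two, intCast_smul_eq, two_smul_eq, smul_zero, zero_add, add_zero, smul_c_eq]
  congr 1
  · have := quadratic_shift_delta' (fun k hk => u_of_gt (K := K) (N := N) hk) hn m
    push_cast at this ⊢
    exact this
  · have := quadratic_shift_delta (fun k hk => u_of_gt (K := K) (N := N) hk) hn m
    push_cast at this ⊢
    exact this

/-- The first bracket induces the linear Toda bracket. -/
lemma bracket1_u {n : ℤ} (hn : n ≤ 1) (m : ℤ) : localBracket bracket1 (u n) (u m) =
    (-2⁻¹ : K) • (genericLinear n m : Kernel K N) := by
  have h := localBracket_map (shiftHom_dx 1) (shift_bracket (K := K) (N := N) 1) (u n) (u m)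
  have hc : ∀ n : ℤ, shiftHom 1 (u n : DiffFun K N) = u n + algebraMap K _ (if n = 0 then 1 else 0) :=
    fun n => by rw [shiftHom_u]; split_ifs <;> simp
  have hc' : ∀ n : ℤ, shiftHom 1 (u n : DiffFun K N) = u n + if n = 0 then 1 else 0 :=
    fun n => by rw [shiftHom_u, map_one]
  rw [hc, hc, localBracket_add_const, localBracket_pencil, bracket2_u hn] at h
  change _ = kmap (shiftHom 1) (seriesQuadratic u n m) at h
  rw [kmap_seriesQuadratic (shiftHom_dx 1)] at h
  simp only [hc'] at h
  rw [seriesQuadratic_shift hn, one_smul] at h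
  change _ + seriesQuadratic u n m = _ at h
  rw [add_comm, add_right_inj, neg_smul, one_smul] at h
  rw [neg_smul, ← h, neg_neg]

/-- A bracket is determined by the brackets of the coefficients of `z`. -/
lemma bracket_ext_u {P P' : Bracket K N}
    (h : ∀ n m : ℤ, n ≤ 1 → m ≤ 1 → localBracket P (u n) (u m) = localBracket P' (u n) (u m)) :
    P = P' := by
  -- The `u_n` have order zero, so each coefficient in `δ^{(k)}` of the difference is a linear
  -- relation with coefficients `∂u_n/∂v`. Nondegeneracy strips off the left index; the adjoint then
  -- turns `mulY` into multiplication and the right index is stripped off the same way.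
  have h1 : ∀ m ≤ 1, ∀ v, ∑ w, mulY (partialD (w, 0) (u m)) (P v w - P' v w) = 0 := by
    intro m hm v
    ext k
    refine congrFun (eq_zero_of_sum_partialD_u (ρ := fun v =>
      (∑ w, mulY (partialD (w, 0) (u m)) (P v w - P' v w)).coeff k) fun n hn => ?_) v
    have := sub_eq_zero.mpr (h n m hn hm)
    rw [(orderZero_u n).localBracket_eq (orderZero_u m), (orderZero_u n).localBracket_eq (orderZero_u m),
      ← Finset.sum_sub_distrib] at this
    have := congrArg (Polynomial.coeff · k) this
    simp only [Polynomial.finsetSum_coeff, ← Finset.sum_sub_distrib, ← smul_sub, ← Finset.smul_sum,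
      Polynomial.coeff_smul, smul_eq_mul, Polynomial.coeff_zero] at this
    rw [← this]
    refine Finset.sum_congr rfl fun v _ => ?_
    simp only [Polynomial.finsetSum_coeff, mulY_eq_comp, sub_eq_add_neg, opComp_add_left, opComp_neg_left]
  funext v w
  rw [← sub_eq_zero, ← swap_swap (P v w - P' v w)]
  have h2 : ∀ w, swap (P v w - P' v w) = 0 := by
    intro w
    ext k
    refine congrFun (eq_zero_of_sum_partialD_u (ρ := fun w =>
      (swap (P v w - P' v w)).coeff k) fun m hm => ?_) w
    have := congrArg (fun A => (swap A).coeff k) (h1 m hm v)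
    simpa only [swap_sum, swap_mulY, Polynomial.finsetSum_coeff, Polynomial.coeff_smul, smul_eq_mul,
      swap_zero, Polynomial.coeff_zero] using this
  rw [h2, swap_zero]

end CharZero

end RatToda
end

open scoped LaurentSeries
noncomputable section
namespace RatToda
variable {K : Type*} [Field K] {N : ℕ}
open Kernel

/-! ### Uniqueness of the Toda flows -/

lemma eq_evolution {D : Derivation K (DiffFun K N) (DiffFun K N)} (hD : ∀ f, D (dx f) = dx (D f)) :
    D = evolution fun v => D (jet (v, 0)) :=
  derivation_ext_of_comm hD (evolution_dx _) fun v =>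
    (evolution_jet (fun v => D (jet (v, 0))) v).symm

/-- The difference of two flows is an evolutionary field that kills every `u_n`, hence has zero
characteristic. -/
lemma IsTodaFlow.eq [CharZero K] {i : ℕ} {D E : Derivation K (DiffFun K N) (DiffFun K N)}
    (hD : IsTodaFlow i D) (hE : IsTodaFlow i E) : D = E := by
  have hc : ∀ f, (D - E) (dx f) = dx ((D - E) f) := fun f => by
    simp only [Derivation.sub_apply, hD.comm, hE.comm, map_sub]
  have hu : ∀ n, (D - E) (u n) = 0 := fun n => by
    have := congrArg (wCoeff · n) (hD.lax.trans hE.lax.symm)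
    exact sub_eq_zero.mpr this
  have h0 : (fun v => (D - E) (jet (v, 0))) = 0 := by
    refine eq_zero_of_sum_partialD_u fun n _ => ?_
    have := hu n
    rw [eq_evolution hc, evolution_apply] at this
    simpa only [(orderZero_u n).frechet_eq, act_C] using this
  refine derivation_ext_of_comm hD.comm hE.comm fun v => ?_
  exact sub_eq_zero.mp (congrFun h0 v)

/-! ### Coefficients of the Lax equations -/

lemma wCoeff_mul_of_subset {f g : WSeries K N} {n : ℤ} {s : Finset ℤ}
    (hs : ∀ j ∉ s, wCoeff f j * wCoeff g (n - j) = 0) :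
    wCoeff (f * g) n = ∑ j ∈ s, wCoeff f j * wCoeff g (n - j) := by
  classical
  obtain ⟨A, hA⟩ := exists_wCoeff_bound f
  obtain ⟨B, hB⟩ := exists_wCoeff_bound g
  rw [wCoeff_mul hA hB, Finset.sum_subset (Finset.subset_union_left (s₂ := s)),
    ← Finset.sum_subset (Finset.subset_union_right (s₁ := Finset.Icc (n - B) A) (s₂ := s))]
  · exact fun j _ hj => hs j hj
  · intro j _ hj
    rw [Finset.mem_Icc, not_and_or] at hj
    rcases hj with hj | hj
    · rw [hB _ (by omega), mul_zero]
    · rw [hA _ (by omega), zero_mul]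

lemma wCoeff_z_pow_of_gt (i : ℕ) {n : ℤ} (hn : i < n) : wCoeff (z ^ i : WSeries K N) n = 0 := by
  induction i generalizing n with
  | zero => rw [pow_zero, wCoeff_one, if_neg (by push_cast at hn; omega)]
  | succ i ih =>
    push_cast at hn
    rw [pow_succ, wCoeff_mul_of_subset (s := ∅), Finset.sum_empty]
    intro j _
    rcases lt_or_ge (i : ℤ) j with h | h
    · rw [ih h, zero_mul]
    · rw [u_eq, u_of_gt (by omega), mul_zero]

lemma wCoeff_z_mul_pow (i : ℕ) {n : ℤ} {s : Finset ℤ} (hs : Finset.Icc (n - 1) i ⊆ s) :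
    wCoeff (z ^ (i + 1) : WSeries K N) n = ∑ j ∈ s, wCoeff (z ^ i) j * u (n - j) := by
  rw [pow_succ]
  refine wCoeff_mul_of_subset fun j hj => ?_
  have hj' : j ∉ Finset.Icc (n - 1) (i : ℤ) := fun h => hj (hs h)
  rw [Finset.mem_Icc, not_and_or] at hj'
  rcases hj' with h | h
  · rw [u_eq, u_of_gt (by omega), mul_zero]
  · rw [wCoeff_z_pow_of_gt i (by omega), zero_mul]

/-- The image of `c_n` in the differential functions. -/
def cF (n : ℤ) : DiffFun K N := algebraMap K _ (c n)

lemma wCoeff_plusHalf (f : WSeries K N) (n : ℤ) : wCoeff (plusHalf f) n = cF n * wCoeff f n := by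
  change (if -n < 0 then f.coeff (-n) else if -n = 0 then (2⁻¹ : K) • f.coeff (-n) else 0) = _
  rw [cF, c, ← Algebra.smul_def]
  split_ifs <;> first | omega | simp [wCoeff]

/-- The coefficients of `{f, z}` as sums. -/
def laxTerm (f : ℤ → DiffFun K N) (m j : ℤ) : DiffFun K N :=
  (j : DiffFun K N) * f j * dx (u (m - j)) - (m - j : DiffFun K N) * dx (f j) * u (m - j)

lemma wCoeff_laxBracket {f : WSeries K N} {m : ℤ} {s : Finset ℤ}
    (hs : ∀ j ∉ s, wCoeff f j = 0 ∨ 1 < m - j) : wCoeff (laxBracket f z) m =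
      ∑ j ∈ s, laxTerm (wCoeff f) m j := by
  rw [laxBracket, wCoeff_sub, wCoeff_mul_of_subset (s := s), wCoeff_mul_of_subset (s := s),
    ← Finset.sum_sub_distrib]
  · refine Finset.sum_congr rfl fun j _ => ?_
    rw [wCoeff_wdw, wCoeff_wdw]
    change (j : DiffFun K N) * wCoeff f j * dx (u (m - j)) - dx (wCoeff f j) * (_ * u (m - j)) = _
    rw [laxTerm]
    push_cast; ring
  · intro j hj
    rw [wCoeff_wdw]
    change dx (wCoeff f j) * (_ * u (m - j)) = 0
    rcases hs j hj with h | h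
    · rw [h, map_zero, zero_mul]
    · rw [u_of_gt h, mul_zero, mul_zero]
  · intro j hj
    rw [wCoeff_wdw]
    change _ * wCoeff f j * dx (u (m - j)) = 0
    rcases hs j hj with h | h
    · rw [h, mul_zero, zero_mul]
    · rw [u_of_gt h, map_zero, mul_zero]

lemma IsLeibniz.pow_succ {R : Type*} [CommRing R] {D : R → R} (hD : IsLeibniz D) (f : R) (n : ℕ) :
    D (f ^ (n + 1)) = (n + 1) * (f ^ n * D f) := by
  rw [_root_.pow_succ, hD.mul, hD.pow]; ring

/-- A power of `z` is a function of `z`. This commutation supplies the cancellations in both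
Hamiltonian computations below. -/
lemma laxBracket_pow (i : ℕ) : laxBracket (z ^ i) z = (0 : WSeries K N) := by
  cases i with
  | zero => rw [laxBracket, pow_zero, isLeibniz_wdw.one, isLeibniz_wdx.one, zero_mul, zero_mul, sub_zero]
  | succ i => rw [laxBracket, isLeibniz_wdw.pow_succ, isLeibniz_wdx.pow_succ]; ring

/-! ### Hamiltonian vector fields of the densities `(z^{i+1})_0 / (i+1)` -/

/-- A coefficient of `{f(x), w(y)}` as a derivation in `f`. -/
def bracketDer (P : Bracket K N) (w : DiffFun K N) (k : ℕ) :
    Derivation K (DiffFun K N) (DiffFun K N) :=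
  Derivation.mk'
    { toFun := fun f => (localBracket P f w).coeff k
      map_add' := fun f g => by rw [localBracket_add_left, Polynomial.coeff_add]
      map_smul' := fun r f => by rw [localBracket_smul_left, Polynomial.coeff_smul]; rfl }
    fun f g => by
      simp only [LinearMap.coe_mk, AddHom.coe_mk, localBracket_mul_left, Polynomial.coeff_add,
        Polynomial.coeff_smul]

lemma localBracket_hamDensity [CharZero K] (P : Bracket K N) (i : ℕ) (w : DiffFun K N) :
    localBracket P (hamDensity i) w =
      ∑ j ∈ Finset.Icc (-1 : ℤ) i, wCoeff (z ^ i : WSeries K N) j • localBracket P (u (-j)) w := by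
  ext k
  -- The bracket is a derivation in its first argument, so the power rule for series gives
  -- `{(z^{i+1})_0, w} = (i + 1) (z^i {z, w})_0`. The range comes from `u_{-j} = 0` for `j < -1` and
  -- `(z^i)_j = 0` for `j > i`.
  change bracketDer P w k (hamDensity i) = _
  have h := congrArg (fun F : WSeries K N => wCoeff F 0)
    ((isLeibniz_map (bracketDer P w k)).pow_succ z i)
  have hi : ((i : WSeries K N) + 1) = wMon 0 (((i + 1 : ℕ) : DiffFun K N)) := by
    rw [wMon_zero_natCast]; push_cast; rfl
  rw [hi, wCoeff_wMon_mul, sub_zero, wCoeff_mul_of_subset (s := Finset.Icc (-1 : ℤ) i)] at h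
  · rw [hamDensity, Derivation.map_smul, ← wCoeff_map, h, Finset.mul_sum, Finset.smul_sum,
      Polynomial.finsetSum_coeff]
    refine Finset.sum_congr rfl fun j _ => ?_
    have hK : ((i + 1 : ℕ) : DiffFun K N) = algebraMap K _ (i + 1) := by push_cast; simp
    rw [hK, ← Algebra.smul_def, smul_smul, inv_mul_cancel₀ (by exact_mod_cast i.succ_ne_zero), one_smul,
      zero_sub, Polynomial.coeff_smul]
    rfl
  · intro j hj
    rw [Finset.mem_Icc, not_and_or] at hj
    rcases hj with h | h
    · rw [wCoeff_map, u_eq, u_of_gt (by omega), map_zero, mul_zero]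
    · rw [wCoeff_z_pow_of_gt i (by omega), zero_mul]

lemma integrateX_lk (p r : DiffFun K N) : integrateX (lk p r) = r - dx p := by
  rw [lk, integrateX_add, integrateX_C, Polynomial.smul_eq_C_mul, Polynomial.C_mul_X_eq_monomial,
    integrateX_monomial]
  simp
  ring

lemma smul_lk' (f p r : DiffFun K N) : f • lk p r = lk (f * p) (f * r) := by
  rw [lk, lk, smul_add, smul_smul, Polynomial.smul_C, smul_eq_mul]

lemma integrateX_smul_lk (f p r : DiffFun K N) :
    integrateX (f • lk p r) = f * r - f * dx p - p * dx f := by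
  rw [smul_lk', integrateX_lk, Derivation.leibniz, smul_eq_mul, smul_eq_mul]; ring

lemma c_neg [CharZero K] (n : ℤ) : (c (-n) : K) = 1 - c n := by
  rw [c, c]
  split_ifs <;> first | omega | norm_num

/-- With `c_0 = 1/2` the separate half term becomes the term `k = 0` of a single sum. The range may
be extended because `u_{n+k}` vanishes beyond it, so one range serves all `n` in the Hamiltonian
computation. -/
lemma genericQuadratic_eq_lk {n M : ℤ} (hn : n ≤ 1) (hM : 1 - n ≤ M) (m : ℤ) :
    genericQuadratic n m = lk
      (∑ k ∈ Finset.Icc 0 M, cF k * ((n - m + 2 * k : DiffFun K N) * (u (n + k) * u (m - k))))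
      (∑ k ∈ Finset.Icc 0 M, cF k * ((n - m + k : DiffFun K N) * (u (n + k) * dx (u (m - k))) +
        (k : DiffFun K N) * (dx (u (n + k)) * u (m - k)))) := by
  have hc0 : (cF 0 : DiffFun K N) = algebraMap K _ 2⁻¹ := by simp [cF, c]
  have hc1 : ∀ k ∈ Finset.Icc 1 M, (cF k : DiffFun K N) = 1 := fun k hk => by
    rw [Finset.mem_Icc] at hk
    rw [cF, c, if_pos (by omega), map_one]
  have hI : Finset.Icc 0 M = insert 0 (Finset.Icc 1 M) := by
    ext k; simp only [Finset.mem_Icc, Finset.mem_insert]; omega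
  have hext : ∀ F : ℤ → DiffFun K N, (∀ k, u (n + k) = (0 : DiffFun K N) → F k = 0) →
      ∑ k ∈ Finset.Icc 1 (1 - n), F k = ∑ k ∈ Finset.Icc 1 M, F k := fun F hF => by
    refine Finset.sum_subset (Finset.Icc_subset_Icc_right hM) fun k hk hk' => hF k (u_of_gt ?_)
    rw [Finset.mem_Icc] at hk hk'
    omega
  have h0 : (0 : ℤ) ∉ Finset.Icc 1 M := by simp
  rw [hI, Finset.sum_insert h0, Finset.sum_insert h0]
  have hone : ∀ F : ℤ → DiffFun K N, ∑ k ∈ Finset.Icc 1 M, cF k * F k = ∑ k ∈ Finset.Icc 1 M, F k :=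
    fun F => Finset.sum_congr rfl fun k hk => by rw [hc1 k hk, one_mul]
  have hhalf : ∀ (x : ℤ) (y : DiffFun K N), ((x : K) / 2) • y = algebraMap K _ 2⁻¹ * (x * y) :=
    fun x y => by rw [div_eq_mul_inv, mul_comm, mul_smul, intCast_smul_eq, Algebra.smul_def]
  rw [hone, hone]
  rw [genericQuadratic, mulX_delta'_eq_lk, mulX_delta_eq_lk, lk_add, zero_add, add_zero, hext, hext, hc0]
  · simp only [hhalf, intCast_smul_eq]
    simp only [Int.cast_zero, mul_zero, add_zero, zero_mul, sub_zero, Int.cast_sub, Int.cast_add, Int.cast_mul, Int.cast_ofNat]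
  · intro k hk; rw [hk, map_zero]; simp
  · intro k hk; rw [hk]; simp

section CharZero

variable [CharZero K]

/-- The summand for `u_{-j}` is `c_j - c_m` times the `j`-th term of the Lax bracket of `z^i` and
`z`. The part with `c_m` sums to zero since `z^i` and `z` commute, and the part with `c_j` is the
projection `(z^i)_+ + (1/2)(z^i)_0`. -/
lemma functionalBracket1_hamDensity (i : ℕ) (m : ℤ) :
    functionalBracket bracket1 (hamDensity i) (u m) =
      wCoeff (laxBracket (plusHalf (z ^ i)) z : WSeries K N) m := by
  set g : ℤ → DiffFun K N := wCoeff (z ^ i) with hg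
  set s : Finset ℤ := Finset.Icc (min (-1) (m - 1)) i with hs
  have hmem : ∀ j ∉ s, g j = 0 ∨ 1 < m - j := by
    intro j hj
    rw [hs, Finset.mem_Icc, not_and_or] at hj
    rcases hj with h | h
    · exact Or.inr (by omega)
    · exact Or.inl (wCoeff_z_pow_of_gt i (by omega))
  have h0 : ∑ j ∈ s, laxTerm g m j = 0 := by
    rw [hg, ← wCoeff_laxBracket (f := z ^ i) hmem, laxBracket_pow]; rfl
  have hcF : ∀ j, dx (cF j : DiffFun K N) = 0 := fun j => Derivation.map_algebraMap dx _
  have h1 : wCoeff (laxBracket (plusHalf (z ^ i)) z : WSeries K N) m = ∑ j ∈ s, cF j * laxTerm g m j := by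
    rw [wCoeff_laxBracket (s := s) fun j hj => ?_]
    · refine Finset.sum_congr rfl fun j _ => ?_
      rw [laxTerm, laxTerm, wCoeff_plusHalf, Derivation.leibniz, hcF]
      simp only [smul_eq_mul]
      ring
    · rw [wCoeff_plusHalf]
      exact (hmem j hj).imp_left fun h => by rw [← hg, h, mul_zero]
  have h2 : ∀ j ∈ Finset.Icc (-1 : ℤ) i, integrateX (g j • localBracket bracket1 (u (-j)) (u m)) =
      (cF j - cF m) * laxTerm g m j := by
    intro j hj
    rw [Finset.mem_Icc] at hj
    have hc : (-2⁻¹ : K) * (2 * (c (-j) + c m - 1)) = c j - c m := by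
      rw [c_neg]; field_simp; ring
    rw [bracket1_u (by omega), genericLinear, smul_smul, hc, mulX_delta'_eq_lk, mulX_delta_eq_lk,
      smul_lk, smul_lk, lk_add, smul_lk, integrateX_smul_lk]
    simp only [smul_zero, zero_add, add_zero, intCast_smul_eq, Algebra.smul_def (c j - c m), map_sub,
      Derivation.leibniz, Derivation.map_algebraMap, Derivation.map_intCast, smul_eq_mul, laxTerm, cF]
    rw [show -j + m = m - j by ring]
    push_cast
    ring
  rw [functionalBracket, localBracket_hamDensity, integrateX_sum, Finset.sum_congr rfl h2, h1,
    Finset.sum_subset (s₂ := s)]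
  · simp only [sub_mul, Finset.sum_sub_distrib, ← Finset.mul_sum, h0, mul_zero, sub_zero]
  · intro j hj
    rw [Finset.mem_Icc] at hj
    rw [hs, Finset.mem_Icc]
    omega
  -- For `j < -1` the extra terms vanish: either `m < 0` and `c_j = c_m = 0`, or `m ≥ 0` and
  -- `u_{m-j} = 0`.
  · intro j hj hj'
    rw [hs, Finset.mem_Icc] at hj
    rw [Finset.mem_Icc] at hj'
    have hj1 : j < -1 := by omega
    have e1 : cF j = (0 : DiffFun K N) := by
      rw [cF, c, if_neg (by omega), if_neg (by omega), map_zero]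
    rcases lt_or_ge m 0 with hm | hm
    · rw [e1, show cF m = (0 : DiffFun K N) by
        rw [cF, c, if_neg (by omega), if_neg (by omega), map_zero], sub_zero, zero_mul]
    · rw [laxTerm, u_of_gt (show 1 < m - j by omega), map_zero, mul_zero, mul_zero, sub_zero, mul_zero]

/-- After exchanging the two summations, the sum over the index `j` of `z^i` at fixed `k` is the
`k`-th term of the Lax bracket of `z^{i+1}` with `z`. The weights `c_k` of the quadratic bracket are
already those of the projection. -/
lemma functionalBracket2_hamDensity (i : ℕ) (m : ℤ) :
    -functionalBracket bracket2 (hamDensity i) (u m) =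
      wCoeff (laxBracket (plusHalf (z ^ (i + 1))) z : WSeries K N) m := by
  set g : ℤ → DiffFun K N := wCoeff (z ^ i) with hg
  set f : ℤ → DiffFun K N := wCoeff (z ^ (i + 1)) with hf
  have hcF : ∀ j, dx (cF j : DiffFun K N) = 0 := fun j => Derivation.map_algebraMap dx _
  have hlax : wCoeff (laxBracket (plusHalf (z ^ (i + 1))) z : WSeries K N) m =
      ∑ k ∈ Finset.Icc (0 : ℤ) (i + 1),
        cF k * laxTerm f m k := by
    rw [wCoeff_laxBracket (s := Finset.Icc (0 : ℤ) (i + 1)) fun j hj => ?_]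
    · refine Finset.sum_congr rfl fun j _ => ?_
      rw [laxTerm, laxTerm, wCoeff_plusHalf, Derivation.leibniz, hcF]
      simp only [smul_eq_mul]
      ring
    · left
      rw [Finset.mem_Icc, not_and_or] at hj
      rw [wCoeff_plusHalf]
      rcases hj with h | h
      · rw [cF, c, if_neg (by omega), if_neg (by omega), map_zero, zero_mul]
      · rw [wCoeff_z_pow_of_gt (i + 1) (by push_cast; omega), mul_zero]
  have hint : ∀ j ∈ Finset.Icc (-1 : ℤ) i,
      integrateX (g j • localBracket bracket2 (u (-j)) (u m)) =
      -∑ k ∈ Finset.Icc (0 : ℤ) (i + 1), cF k *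
        (g j * ((k : DiffFun K N) * (u (k - j) * dx (u (m - k))) +
            (k - m - j : DiffFun K N) * (dx (u (k - j)) * u (m - k))) +
          dx (g j) * ((2 * k - m - j : DiffFun K N) * (u (k - j) * u (m - k)))) := by
    intro j hj
    rw [Finset.mem_Icc] at hj
    rw [bracket2_u (by omega), genericQuadratic_eq_lk (M := i + 1) (by omega) (by omega),
      integrateX_smul_lk, map_sum, Finset.mul_sum, Finset.mul_sum, Finset.sum_mul,
      ← Finset.sum_sub_distrib, ← Finset.sum_sub_distrib, ← Finset.sum_neg_distrib]
    refine Finset.sum_congr rfl fun k _ => ?_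
    rw [show -j + k = k - j by ring]
    have htwo : dx (2 : DiffFun K N) = 0 := by exact_mod_cast Derivation.map_natCast dx 2
    simp only [Derivation.leibniz, hcF, map_add, map_sub, Derivation.map_intCast, smul_eq_mul, htwo]
    push_cast
    ring
  have hk : ∀ k ∈ Finset.Icc (0 : ℤ) (i + 1), ∑ j ∈ Finset.Icc (-1 : ℤ) i,
      (g j * ((k : DiffFun K N) * (u (k - j) * dx (u (m - k))) +
            (k - m - j : DiffFun K N) * (dx (u (k - j)) * u (m - k))) +
          dx (g j) * ((2 * k - m - j : DiffFun K N) * (u (k - j) * u (m - k)))) =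
      laxTerm f m k := by
    intro k hk
    rw [Finset.mem_Icc] at hk
    have h1 : f k = ∑ j ∈ Finset.Icc (-1 : ℤ) i, g j * u (k - j) :=
      wCoeff_z_mul_pow i (Finset.Icc_subset_Icc_left (by omega))
    have h2 : ∑ j ∈ Finset.Icc (-1 : ℤ) i,
        laxTerm g k j = 0 := by
      rw [hg, ← wCoeff_laxBracket fun j hj => ?_, laxBracket_pow]
      · rfl
      · rw [Finset.mem_Icc, not_and_or] at hj
        rcases hj with h | h
        · exact Or.inr (by omega)
        · exact Or.inl (wCoeff_z_pow_of_gt i (by omega))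
    have h3 : dx (f k) = ∑ j ∈ Finset.Icc (-1 : ℤ) i, (g j * dx (u (k - j)) + dx (g j) * u (k - j)) := by
      rw [h1, map_sum]
      refine Finset.sum_congr rfl fun j _ => ?_
      rw [Derivation.leibniz, smul_eq_mul, smul_eq_mul]; ring
    -- Expanding `z^{i+1} = z^i z` does not give the left side term by term; it does so after adding
    -- `-u_{m-k}` times the vanishing coefficient of `w^k` in the Lax bracket of `z^i` and `z`.
    rw [← add_zero (laxTerm f m k), ← mul_zero (-u (m - k)), ← h2, laxTerm, h3, h1]
    simp only [laxTerm, Finset.mul_sum, Finset.sum_mul, ← Finset.sum_sub_distrib, ← Finset.sum_add_distrib]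
    refine Finset.sum_congr rfl fun j _ => ?_
    ring
  rw [hlax, functionalBracket, localBracket_hamDensity, integrateX_sum, Finset.sum_congr rfl hint,
    Finset.sum_neg_distrib, neg_neg, Finset.sum_comm]
  refine Finset.sum_congr rfl fun k hk' => ?_
  rw [← Finset.mul_sum, hk k hk']

lemma isTodaFlow_bracket1 (i : ℕ) : IsTodaFlow i (hamVF bracket1 (hamDensity i) :
    Derivation K (DiffFun K N) (DiffFun K N)) where
  comm := hamVF_dx _ _
  lax := wSeries_ext fun m => by
    rw [← functionalBracket1_hamDensity, functionalBracket_eq]; rfl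

lemma isTodaFlow_bracket2 (i : ℕ) : IsTodaFlow (i + 1) (-hamVF bracket2 (hamDensity i) :
    Derivation K (DiffFun K N) (DiffFun K N)) where
  comm f := by
    rw [Derivation.neg_apply, hamVF_dx, Derivation.neg_apply, map_neg]
  lax := wSeries_ext fun m => by
    rw [← functionalBracket2_hamDensity, functionalBracket_eq]; rfl

end CharZero

end RatToda
end

/-! ### The bi-Hamiltonian structure of the rational Toda flows -/

theorem mainTheorem12 (K : Type*) [Field K] [CharZero K] (N : ℕ) :
    -- the brackets induced on the fields `a_k, b_l` by the linear and quadratic Toda brackets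
    (∀ P : Bracket K N,
      (∀ n m : ℤ, n ≤ 1 → m ≤ 1 →
        localBracket P (u n) (u m) = (-2⁻¹ : K) • genericLinear n m) ↔ P = bracket1) ∧
    (∀ P : Bracket K N,
      (∀ n m : ℤ, n ≤ 1 → m ≤ 1 →
        localBracket P (u n) (u m) = genericQuadratic n m) ↔ P = bracket2) ∧
    -- they form a pair of compatible Poisson structures
    (∀ s t : K, IsPoisson (fun v w => s • bracket1 v w + t • bracket2 v w : Bracket K N)) ∧
    -- every Toda flow restricts, in a unique way, to the rational functions
    (∀ i : ℕ, ∃! D : Derivation K (DiffFun K N) (DiffFun K N), IsTodaFlow i D) ∧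
    -- and it is Hamiltonian with respect to both structures
    (∀ (i : ℕ) (D : Derivation K (DiffFun K N) (DiffFun K N)), IsTodaFlow i D →
      ∀ f, D f = functionalBracket bracket1 (hamDensity i) f) ∧
    (∀ (i : ℕ) (D : Derivation K (DiffFun K N) (DiffFun K N)), IsTodaFlow (i + 1) D →
      ∀ f, D f = -functionalBracket bracket2 (hamDensity i) f) := by
  refine ⟨fun P => ⟨fun h => ?_, ?_⟩, fun P => ⟨fun h => ?_, ?_⟩, isPoisson_pencil, fun i => ?_,
    fun i D hD f => ?_, fun i D hD f => ?_⟩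
  · exact bracket_ext_u fun n m hn hm => by rw [h n m hn hm, bracket1_u hn]
  · rintro rfl n m hn -
    exact bracket1_u hn m
  · exact bracket_ext_u fun n m hn hm => by rw [h n m hn hm, bracket2_u hn]
  · rintro rfl n m hn -
    exact bracket2_u hn m
  · exact ⟨_, isTodaFlow_bracket1 i, fun E hE => hE.eq (isTodaFlow_bracket1 i)⟩
  · rw [functionalBracket_eq, hD.eq (isTodaFlow_bracket1 i)]
  · rw [functionalBracket_eq, hD.eq (isTodaFlow_bracket2 i), Derivation.neg_apply]
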